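/- **Setting.** Fix a countably infinite set $\mathcal{PS}$ of propositional symbols, among them pairwise distinct reserved symbols $\sigma_0,\sigma_1,\dots$ Classical modal formulas (ML) are built from symbols and $\top$ by $\neg,\land,\lor,\Box,\Diamond$. Modal team logic (MTL) has all ML-formulas $\alpha$ as atoms and is closed under $\sim,\land,\lor,\Box,\Diamond$. $\mathrm{ML}_k^\Phi$ and $\mathrm{MTL}_k$ denote the fragments of modal depth at most $k$ (and symbols from $\Phi$). For a Kripke structure $\mathcal K=(W,R,V)$ and a team $T\subseteq W$ let $RT$ be the set of $R$-successors of worlds in $T$, let $R^iT$ be its $i$-fold iterate, and $Rw=R\{w\}$. Team semantics: $T\vDash\alpha$ iff all $w\in T$ satisfy $\alpha$ (for $\alpha\in\mathrm{ML}$); $\sim$ and $\land$ are Boolean; $T\vDash\psi\lor\theta$ iff $T=S\cup U$ for some $S\vDash\psi$, $U\vDash\theta$; $T\vDash\Box\psi$ iff $RT\vDash\psi$; $T\vDash\Diamond\psi$ iff $S\vDash\psi$ for some $S\subseteq RT$ such that every $w\in T$ has a successor in $S$. Let $\Phi\subseteq\mathcal{PS}$ be finite with a strict linear order $<$. The type of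 $w$ is $[w]_k=\{\alpha\in\mathrm{ML}^\Phi_k\mid w\vDash\alpha\}$, and $[T]_k=\{[w]_k\mid w\in T\}$. $\Delta_k$ is the set of all $(\Phi,k)$-types, i.e. of the satisfiable sets $\tau\subseteq\mathrm{ML}_k^\Phi$ containing $\alpha$ or $\neg\alpha$ for each $\alpha\in\mathrm{ML}_k^\Phi$. For $\tau\in\Delta_{k+1}$ let $\mathcal R\tau=\{\tau'\in\Delta_k\mid\{\alpha\mid\Box\alpha\in\tau\}\subseteq\tau'\}$. For an order $\sqsubset$ on $X$, define the lexicographic order on the subsets of $X$ by: $X_1\sqsubset^*X_2$ iff there is $x\in X_2\setminus X_1$ such that $x'\in X_1\Leftrightarrow x'\in X_2$ for all $x'\in X$ with $x\sqsubset x'$. Define $\tau\prec_0\tau'$ iff $\tau\cap\Phi<^*\tau'\cap\Phi$, and $\tau\prec_{k+1}\tau'$ iff $\tau\cap\Phi<^*\tau'\cap\Phi$, or $\tau\cap\Phi=\tau'\cap\Phi$ and $\mathcal R\tau\prec_k^*\mathcal R\tau'$. Put $T_\alpha=\{w\in T\mid w\vDash\alpha\}$, $T^\alpha_S=T_{\neg\alpha}\cup(T_\alpha\cap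 S)$, and $T^{\alpha,\beta}_{w,v}=(T^\alpha_{\{w\}})^\beta_{\{v\}}$. A *scope* in $\mathcal K$ is a formula $\alpha\in\mathrm{ML}_0^{\mathcal{PS}\setminus\Phi}$ such that $w\vDash\alpha\Leftrightarrow v\vDash\alpha$ whenever $(w,v)\in R$; scopes are *disjoint* if no world satisfies two of them. For formulas $\mathfrak s_0,\dots,\mathfrak s_k$, $(\mathcal K,T)$ is a *$k$-staircase* if for all $i\le k$ and all $\tau\in\Delta_i$ there is $w\in T_{\mathfrak s_i}$ with $[R^{k-i}w]_i=\{\tau\}$. **Formulas.** Abbreviate the team-wide Boolean disjunction $\varphi\curlyvee \psi={\sim}({\sim}\varphi\land{\sim}\psi)$ (finite iterations are written $\mathop{\curlyvee}_{p}$, the empty one is ${\sim}\top$), $\varphi\Rightarrow \psi={\sim}\varphi\curlyvee \psi$, $\mathsf E\alpha={\sim}\neg\alpha$, $\mathrm{dep}(p)=p\curlyvee \neg p$, $\alpha\hookrightarrow\varphi=\neg\alpha\lor(\alpha\land\varphi)$, $\exists^{\subseteq}_\alpha\varphi=\alpha\lor\varphi$, $\forall^{\subseteq}_\alpha\varphi={\sim}\exists^{\subseteq}_\alpha{\sim}\varphi$,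 $\exists^1_\alpha\varphi=\exists^\subseteq_\alpha[\mathsf E\alpha\land\forall^\subseteq_\alpha(\mathsf E\alpha\Rightarrow \varphi)]$, $\forall^1_\alpha\varphi={\sim}\exists^1_\alpha{\sim}\varphi$. Define $$\chi_0(\alpha,\beta)=(\alpha\lor\beta)\hookrightarrow\bigwedge_{p\in\Phi}\mathrm{dep}(p),\qquad \chi_{k+1}(\alpha,\beta)=\chi_0(\alpha,\beta)\land\Box\chi^*_k(\alpha,\beta),$$ $$\chi^*_k(\alpha,\beta)=(\neg\alpha\land\neg\beta)\curlyvee \Big(\mathsf E\alpha\land\mathsf E\beta\land{\sim}\big[(\alpha\curlyvee \beta)\lor(\mathsf E\alpha\land\mathsf E\beta\land{\sim}\exists^1_\alpha\exists^1_\beta\chi_k(\alpha,\beta))\big]\Big),$$ $$\zeta_0(\alpha,\beta)=\mathop{\curlyvee}_{p\in\Phi}\Big[(\alpha\hookrightarrow\neg p)\land(\beta\hookrightarrow p)\land\bigwedge_{q\in\Phi,\ p<q}\big((\alpha\lor\beta)\hookrightarrow\mathrm{dep}(q)\big)\Big],$$ $$\zeta_{k+1}(\alpha,\beta)=\zeta_0(\alpha,\beta)\curlyvee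 \big(\chi_0(\alpha,\beta)\land\Box\zeta_k^*(\alpha,\beta)\big),$$ $$\zeta^*_k(\alpha,\beta)=\exists^1_{\mathfrak s_k}\Big[\exists^1_\beta\chi_k(\mathfrak s_k,\beta)\land{\sim}\exists^1_\alpha\chi_k(\mathfrak s_k,\alpha)\land\Big(\big(\chi^*_k(\alpha,\beta)\land(\alpha\lor\beta)\big)\lor\forall^1_{\alpha\lor\beta}{\sim}\zeta_k(\mathfrak s_k,\alpha\lor\beta)\Big)\Big].$$ **Theorem.** Let $k\ge0$. 1. If $(\mathcal K,T)$ is a $k$-staircase with disjoint scopes $\alpha,\beta,\mathfrak s_0,\dots,\mathfrak s_k$, then for all $w\in T_\alpha$ and $v\in T_\beta$ $$T^{\alpha,\beta}_{w,v}\vDash\zeta_k(\alpha,\beta)\iff[w]_k\prec_k[v]_k,$$ and $$T\vDash\zeta^*_k(\alpha,\beta)\iff[T_\alpha]_k\prec^*_k[T_\beta]_k.$$ 2. For $\alpha,\beta,\mathfrak s_0,\dots,\mathfrak s_k\in\mathrm{ML}_0$, both $\zeta_k(\alpha,\beta)$ and $\zeta^*_k(\alpha,\beta)$ are $\mathrm{MTL}_k$-formulas.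 3. With the fixed stairs $\mathfrak s_i=\sigma_i$, each of $\zeta_k(\alpha,\beta)$ and $\zeta_k^*(\alpha,\beta)$ is constructed from $(k,\Phi,\alpha,\beta)$ by a single deterministic Turing machine with read-only input tape and write-only output tape that uses $O(\log(k+|\Phi|+|\alpha|+|\beta|))$ cells of its work tapes. Here $\Phi$ is given as a list in increasing order, $k$ in unary, symbols by binary indices and formulas in prefix notation; $|\Phi|$ is the number of symbols in $\Phi$, and $|\alpha|,|\beta|$ are the lengths of the encodings. -/

import Mathlib

universe u

namespace MTLOrder

/-! ### Propositional symbols and formulas -/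

/-- The countably infinite set of propositional symbols. The symbols `stair 0, stair 1, …` are a
fixed enumeration of symbols that can be used as names of the stairs; `letter 0, letter 1, …` are
the other symbols. -/
inductive PSym : Type
  | letter (n : ℕ) : PSym
  | stair (i : ℕ) : PSym
  deriving DecidableEq

/-- Formulas of classical modal logic. -/
inductive ML : Type
  | var (p : PSym) : ML
  | top : ML
  | neg (a : ML) : ML
  | and (a b : ML) : ML
  | or (a b : ML) : ML
  | box (a : ML) : ML
  | dia (a : ML) : ML

/-- Formulas of modal team logic; `tilde` is the Boolean negation, `ml` embeds the
classical modal formulas. -/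
inductive MTL : Type
  | ml (a : ML) : MTL
  | tilde (f : MTL) : MTL
  | and (f g : MTL) : MTL
  | or (f g : MTL) : MTL
  | box (f : MTL) : MTL
  | dia (f : MTL) : MTL

/-- Modal depth of a classical formula. -/
def ML.md : ML → ℕ
  | .var _ => 0
  | .top => 0
  | .neg a => a.md
  | .and a b => max a.md b.md
  | .or a b => max a.md b.md
  | .box a => a.md + 1
  | .dia a => a.md + 1

/-- Modal depth of a team-logical formula. -/
def MTL.md : MTL → ℕ
  | .ml a => a.md
  | .tilde f => f.md
  | .and f g => max f.md g.md
  | .or f g => max f.md g.md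
  | .box f => f.md + 1
  | .dia f => f.md + 1

/-- The set of propositional symbols occurring in a classical formula. -/
def ML.props : ML → Set PSym
  | .var p => {p}
  | .top => ∅
  | .neg a => a.props
  | .and a b => a.props ∪ b.props
  | .or a b => a.props ∪ b.props
  | .box a => a.props
  | .dia a => a.props

/-- The fragment `ML_k^Φ`: modal depth at most `k`, all symbols from `Φ`. -/
def MLfrag (Φ : Set PSym) (k : ℕ) : Set ML :=
  {a | a.md ≤ k ∧ a.props ⊆ Φ}

/-- The fragment `MTL_k`: modal depth at most `k`. -/
def MTLfrag (k : ℕ) : Set MTL :=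
  {f | f.md ≤ k}

/-! ### Kripke structures, teams, semantics -/

/-- A Kripke structure with set of worlds `W`. -/
structure Kripke (W : Type u) where
  R : W → W → Prop
  V : PSym → Set W

variable {W : Type u}

/-- The image `RT` of a team `T`. -/
def Kripke.img (K : Kripke W) (T : Set W) : Set W :=
  {v | ∃ w ∈ T, K.R w v}

/-- `S` is a successor team of `T`. -/
def Kripke.IsSuccTeam (K : Kripke W) (T S : Set W) : Prop :=
  S ⊆ K.img T ∧ ∀ w ∈ T, ∃ v ∈ S, K.R w v

/-- Kripke semantics of classical modal logic. -/
def ML.Sat (K : Kripke W) : W → ML → Prop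
  | w, .var p => w ∈ K.V p
  | _, .top => True
  | w, .neg a => ¬ ML.Sat K w a
  | w, .and a b => ML.Sat K w a ∧ ML.Sat K w b
  | w, .or a b => ML.Sat K w a ∨ ML.Sat K w b
  | w, .box a => ∀ v, K.R w v → ML.Sat K v a
  | w, .dia a => ∃ v, K.R w v ∧ ML.Sat K v a

/-- Team semantics of modal team logic. -/
def MTL.Sat (K : Kripke W) : Set W → MTL → Prop
  | T, .ml a => ∀ w ∈ T, ML.Sat K w a
  | T, .tilde f => ¬ MTL.Sat K T f
  | T, .and f g => MTL.Sat K T f ∧ MTL.Sat K T g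
  | T, .or f g => ∃ S U : Set W, T = S ∪ U ∧ MTL.Sat K S f ∧ MTL.Sat K U g
  | T, .box f => MTL.Sat K (K.img T) f
  | T, .dia f => ∃ S, K.IsSuccTeam T S ∧ MTL.Sat K S f

/-- The conditioned subteam `T_α`. -/
def Kripke.cond (K : Kripke W) (T : Set W) (a : ML) : Set W :=
  {w ∈ T | ML.Sat K w a}

/-- The team `T^α_S = T_{¬α} ∪ (T_α ∩ S)`: the part of `T` inside `α` is shrunk to `S`. -/
def Kripke.sel (K : Kripke W) (T : Set W) (a : ML) (S : Set W) : Set W :=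
  K.cond T (.neg a) ∪ (K.cond T a ∩ S)

/-! ### Scopes -/

/-- `a` is a scope in `K`: a purely propositional formula without symbols from `Φ` whose truth value
is invariant under traversing edges. -/
structure IsScope (K : Kripke W) (Φ : Set PSym) (a : ML) : Prop where
  frag : a ∈ MLfrag Φᶜ 0
  invariant : ∀ w v, K.R w v → (ML.Sat K w a ↔ ML.Sat K v a)

/-- `a` and `b` are disjoint in `K`: no world satisfies both. -/
def DisjointIn (K : Kripke W) (a b : ML) : Prop :=
  ∀ w, ¬ (ML.Sat K w a ∧ ML.Sat K w b)

/-- `α, β, s_0, …, s_k` are (pairwise) disjoint scopes in `K`. -/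
structure DisjointScopes (K : Kripke W) (Φ : Set PSym) (k : ℕ) (s : ℕ → ML) (α β : ML) :
    Prop where
  scope_left : IsScope K Φ α
  scope_right : IsScope K Φ β
  scope_stair : ∀ i ≤ k, IsScope K Φ (s i)
  disj : DisjointIn K α β
  disj_left : ∀ i ≤ k, DisjointIn K α (s i)
  disj_right : ∀ i ≤ k, DisjointIn K β (s i)
  disj_stair : ∀ i ≤ k, ∀ j ≤ k, i ≠ j → DisjointIn K (s i) (s j)

/-! ### Types, canonicity, staircases -/

/-- The `(Φ,k)`-type of a world. -/
def typeOf (K : Kripke W) (Φ : Set PSym) (k : ℕ) (w : W) : Set ML :=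
  {a ∈ MLfrag Φ k | ML.Sat K w a}

/-- The set of `(Φ,k)`-types of the worlds of a team. -/
def typesOf (K : Kripke W) (Φ : Set PSym) (k : ℕ) (T : Set W) : Set (Set ML) :=
  {τ | ∃ w ∈ T, typeOf K Φ k w = τ}

/-- `Δ_k^Φ`, the set of all `(Φ,k)`-types: the satisfiable subsets of `ML_k^Φ` that contain `a` or
its negation, for every `a ∈ ML_k^Φ`. -/
def Types (Φ : Set PSym) (k : ℕ) : Set (Set ML) :=
  {τ | τ ⊆ MLfrag Φ k ∧
    (∃ (W : Type u) (K : Kripke W) (w : W), ∀ a ∈ τ, ML.Sat K w a) ∧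
    ∀ a ∈ MLfrag Φ k, a ∈ τ ∨ ML.neg a ∈ τ}

/-- `T` is `k`-canonical with offset `i`. -/
def CanonicalOffset (K : Kripke W) (Φ : Set PSym) (k i : ℕ) (T : Set W) : Prop :=
  ∀ τ ∈ Types.{u} Φ k, ∃ w ∈ T, typesOf K Φ k (K.img^[i] {w}) = {τ}

/-- `(K,T)` is a `k`-staircase with stairs `s_0, …, s_k`. -/
def IsStaircase (K : Kripke W) (Φ : Set PSym) (s : ℕ → ML) (k : ℕ) (T : Set W) : Prop :=
  ∀ i ≤ k, CanonicalOffset K Φ i (k - i) (K.cond T (s i))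

/-! ### The orders on types and on sets of types

From here on, the finite set `Φ` together with a strict linear order on it is given by a list without
repetitions: `p < q` means that `p` is listed before `q`. -/

/-- The underlying set of the list `Φ`. -/
def symSet (Φ : List PSym) : Set PSym := {p | p ∈ Φ}

/-- The order on `Φ`. -/
def symLT (Φ : List PSym) (p q : PSym) : Prop := Φ.idxOf p < Φ.idxOf q

/-- The lexicographic order on the subsets of `X` that is induced by an order `r` on `X`. -/
def LexLT {A : Type*} (X : Set A) (r : A → A → Prop) (X₁ X₂ : Set A) : Prop :=
  ∃ x ∈ X₂ \ X₁, ∀ x' ∈ X, r x x' → (x' ∈ X₁ ↔ x' ∈ X₂)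

/-- `τ ∩ Φ`. -/
def typeProps (Φ : List PSym) (τ : Set ML) : Set PSym :=
  {p ∈ symSet Φ | ML.var p ∈ τ}

/-- `ℛτ`, the set of `(Φ,k)`-types `τ'` that contain all `a` with `□a ∈ τ`, where `τ` is a
`(Φ,k+1)`-type. -/
def typeImg (Φ : Set PSym) (k : ℕ) (τ : Set ML) : Set (Set ML) :=
  {τ' ∈ Types.{u} Φ k | {a | ML.box a ∈ τ} ⊆ τ'}

/-- The order `≺_k` on `(Φ,k)`-types. -/
def TypeLT (Φ : List PSym) : ℕ → Set ML → Set ML → Prop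
  | 0, τ, τ' => LexLT (symSet Φ) (symLT Φ) (typeProps Φ τ) (typeProps Φ τ')
  | k + 1, τ, τ' =>
      LexLT (symSet Φ) (symLT Φ) (typeProps Φ τ) (typeProps Φ τ') ∨
      (typeProps Φ τ = typeProps Φ τ' ∧
        LexLT (Types.{u} (symSet Φ) k) (TypeLT Φ k)
          (typeImg.{u} (symSet Φ) k τ) (typeImg.{u} (symSet Φ) k τ'))

/-- The lexicographic order `≺*_k` on sets of `(Φ,k)`-types. -/
def TypeSetLT (Φ : List PSym) (k : ℕ) : Set (Set ML) → Set (Set ML) → Prop :=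
  LexLT (Types.{u} (symSet Φ) k) (TypeLT.{u} Φ k)

/-! ### Abbreviations of team logic -/

/-- Team-wide Boolean disjunction `f ⩒ g`. -/
def MTL.ovee (f g : MTL) : MTL := .tilde (.and (.tilde f) (.tilde g))

/-- Team-wide material implication. -/
def MTL.imp (f g : MTL) : MTL := .ovee (.tilde f) g

/-- Finite conjunctions. -/
def MTL.bigAnd (l : List MTL) : MTL := l.foldr .and (.ml .top)

/-- Finite team-wide Boolean disjunctions; the empty one is `∼⊤`, which no team satisfies. -/
def MTL.bigOvee (l : List MTL) : MTL := l.foldr .ovee (.tilde (.ml .top))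

/-- `Eα`: some world of the team satisfies `α`. -/
def MTL.E (a : ML) : MTL := .tilde (.ml (.neg a))

/-- The constancy atom of a propositional symbol. -/
def MTL.dep (p : PSym) : MTL := .ovee (.ml (.var p)) (.ml (.neg (.var p)))

/-- `α ↪ f`, that is, `¬α ∨ (α ∧ f)`. -/
def MTL.hook (a : ML) (f : MTL) : MTL := .or (.ml (.neg a)) (.and (.ml a) f)

/-- `∃⊆_α f`: existential quantifier over subteams of `T_α`. -/
def MTL.exSub (a : ML) (f : MTL) : MTL := .or (.ml a) f

/-- `∀⊆_α f`: universal quantifier over subteams of `T_α`. -/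
def MTL.allSub (a : ML) (f : MTL) : MTL := .tilde (.exSub a (.tilde f))

/-- `∃¹_α f`: existential quantifier over worlds of `T_α`. -/
def MTL.exOne (a : ML) (f : MTL) : MTL :=
  .exSub a (.and (.E a) (.allSub a (.imp (.E a) f)))

/-- `∀¹_α f`: universal quantifier over worlds of `T_α`. -/
def MTL.allOne (a : ML) (f : MTL) : MTL := .tilde (.exOne a (.tilde f))

/-! ### The formulas expressing bisimilarity -/

/-- `χ_0(α,β)`. -/
def chiZero (Φ : List PSym) (α β : ML) : MTL :=
  .hook (.or α β) (.bigAnd (Φ.map .dep))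

/-- `χ*_k(α,β)`, where `c` is `χ_k(α,β)`. -/
def chiStarOf (c : MTL) (α β : ML) : MTL :=
  .ovee (.and (.ml (.neg α)) (.ml (.neg β)))
    (.and (.E α) (.and (.E β) (.tilde
      (.or (.ovee (.ml α) (.ml β))
        (.and (.E α) (.and (.E β) (.tilde (.exOne α (.exOne β c)))))))))

/-- `χ_k(α,β)`. -/
def chi (Φ : List PSym) : ℕ → ML → ML → MTL
  | 0, α, β => chiZero Φ α β
  | k + 1, α, β => .and (chiZero Φ α β) (.box (chiStarOf (chi Φ k α β) α β))

/-- `χ*_k(α,β)`. -/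
def chiStar (Φ : List PSym) (k : ℕ) (α β : ML) : MTL := chiStarOf (chi Φ k α β) α β

/-! ### The formulas expressing the orders -/

/-- `ζ_0(α,β)`: there is `p ∈ Φ` that is false in `α` and true in `β`, such that all symbols
`q > p` are constant on `α ∨ β`. -/
def zetaZero (Φ : List PSym) (α β : ML) : MTL :=
  .bigOvee (Φ.map fun p =>
    .and (.hook α (.ml (.neg (.var p))))
      (.and (.hook β (.ml (.var p)))
        (.bigAnd ((Φ.filter fun q => decide (Φ.idxOf p < Φ.idxOf q)).map fun q =>
          .hook (.or α β) (.dep q)))))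

/-- `ζ*_k(α,β)`, where `s` is the stair `s_k` and `z` is `ζ_k(s_k, α ∨ β)`. -/
def zetaStarOf (Φ : List PSym) (k : ℕ) (s : ML) (z : MTL) (α β : ML) : MTL :=
  .exOne s
    (.and (.exOne β (chi Φ k s β))
      (.and (.tilde (.exOne α (chi Φ k s α)))
        (.or (.and (chiStar Φ k α β) (.ml (.or α β)))
          (.allOne (.or α β) (.tilde z)))))

/-- `ζ_k(α,β)` with stairs `s_0, s_1, …`. -/
def zeta (Φ : List PSym) (s : ℕ → ML) : ℕ → ML → ML → MTL
  | 0, α, β => zetaZero Φ α β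
  | k + 1, α, β =>
      .ovee (zetaZero Φ α β)
        (.and (chiZero Φ α β)
          (.box (zetaStarOf Φ k (s k) (zeta Φ s k (s k) (.or α β)) α β)))

/-- `ζ*_k(α,β)` with stairs `s_0, s_1, …`. -/
def zetaStar (Φ : List PSym) (s : ℕ → ML) (k : ℕ) (α β : ML) : MTL :=
  zetaStarOf Φ k (s k) (zeta Φ s k (s k) (.or α β)) α β

/-- The stairs given by the reserved propositional symbols. -/
def stairVar (i : ℕ) : ML := .var (.stair i)

/-! ### Encoding of formulas as words -/

/-- The finite alphabet. -/
inductive Sym : Type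
  | letter | stair | bit0 | bit1
  | top | neg | and | or | box | dia
  | ml | tilde
  | one | sep
  deriving DecidableEq

/-- Binary representation, least significant bit first. -/
def encNat (n : ℕ) : List Sym := n.bits.map fun b => if b then Sym.bit1 else Sym.bit0

/-- A propositional symbol is its kind followed by its index in binary. -/
def PSym.enc : PSym → List Sym
  | .letter n => Sym.letter :: encNat n
  | .stair i => Sym.stair :: encNat i

/-- Classical formulas in prefix notation. -/
def ML.enc : ML → List Sym
  | .var p => p.enc
  | .top => [Sym.top]
  | .neg a => Sym.neg :: a.enc
  | .and a b => Sym.and :: (a.enc ++ b.enc)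
  | .or a b => Sym.or :: (a.enc ++ b.enc)
  | .box a => Sym.box :: a.enc
  | .dia a => Sym.dia :: a.enc

/-- Formulas of team logic in prefix notation. -/
def MTL.enc : MTL → List Sym
  | .ml a => Sym.ml :: a.enc
  | .tilde f => Sym.tilde :: f.enc
  | .and f g => Sym.and :: (f.enc ++ g.enc)
  | .or f g => Sym.or :: (f.enc ++ g.enc)
  | .box f => Sym.box :: f.enc
  | .dia f => Sym.dia :: f.enc

/-- The encoding of an input `(k, Φ, α, β)`, with `k` in unary. -/
def encInput (k : ℕ) (Φ : List PSym) (α β : ML) : List Sym :=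
  List.replicate k Sym.one ++ Sym.sep :: (Φ.flatMap PSym.enc ++
    Sym.sep :: (α.enc ++ Sym.sep :: β.enc))

/-! ### Space-bounded Turing transducers -/

/-- Head movements. -/
inductive Move : Type
  | left | stay | right

/-- Contents of an input cell: the end markers or a letter. -/
inductive InCell (A : Type) : Type
  | leftEnd : InCell A
  | letter (a : A) : InCell A
  | rightEnd : InCell A

/-- A deterministic Turing machine with a two-way read-only input tape, finitely many
work tapes (infinite to the right) and a one-way write-only output tape. In each step it depends on
the state, the scanned input cell and the scanned work cells whether the machine halts (`none`) or
which state, input head movement, written symbols, work head movements and output letter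
(if any) follow. -/
structure Transducer (A : Type) where
  tapes : ℕ
  State : Type
  Work : Type
  finState : Finite State
  finWork : Finite Work
  blank : Work
  start : State
  trans : State → InCell A → (Fin tapes → Work) →
    Option (State × Move × (Fin tapes → Work × Move) × Option A)

namespace Transducer

variable {A : Type}

/-- Configurations. Input position `0` is the left end marker, the positions `1, …, n` hold the
input word and position `n + 1` is the right end marker. -/
structure Cfg (M : Transducer A) where
  state : M.State
  inPos : ℕ
  cells : Fin M.tapes → ℕ → M.Work
  head : Fin M.tapes → ℕ
  out : List A

/-- The initial configuration. -/
def init (M : Transducer A) : M.Cfg where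
  state := M.start
  inPos := 0
  cells := fun _ _ => M.blank
  head := fun _ => 0
  out := []

/-- The content of the input cell at position `i`. -/
def readInput (x : List A) (i : ℕ) : InCell A :=
  if i = 0 then .leftEnd
  else match x[i - 1]? with
    | some a => .letter a
    | none => .rightEnd

/-- Head movement on a tape with a left end: a left move in cell `0` has no effect. -/
def moveHead : Move → ℕ → ℕ
  | .left, i => i - 1
  | .stay, i => i
  | .right, i => i + 1

/-- One step on input `x`; the result is `none` if the machine halts. The input head does not move
beyond the right end marker. -/
def step (M : Transducer A) (x : List A) (c : M.Cfg) : Option M.Cfg :=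
  (M.trans c.state (readInput x c.inPos) (fun i => c.cells i (c.head i))).map fun r =>
    { state := r.1
      inPos := min (moveHead r.2.1 c.inPos) (x.length + 1)
      cells := fun i => Function.update (c.cells i) (c.head i) (r.2.2.1 i).1
      head := fun i => moveHead (r.2.2.1 i).2 (c.head i)
      out := c.out ++ r.2.2.2.toList }

/-- Configuration `c` occurs in the run of `M` on input `x`. -/
def Occurs (M : Transducer A) (x : List A) (c : M.Cfg) : Prop :=
  Relation.ReflTransGen (fun a b => M.step x a = some b) M.init c

/-- On input `x`, the machine halts with output `y`, and the heads visit at most `m` work tape cells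
in total. -/
def ComputesInSpace (M : Transducer A) (x y : List A) (m : ℕ) : Prop :=
  (∃ c, M.Occurs x c ∧ M.step x c = none ∧ c.out = y) ∧
  ∃ b : Fin M.tapes → ℕ, ∑ i, b i ≤ m ∧ ∀ c, M.Occurs x c → ∀ i, c.head i < b i

end Transducer

/-- The family of formulas `F k Φ α β` is constructible in space `O(log(k + |Φ| + |α| + |β|))`: a single
machine constructs `F k Φ α β` from `(k, Φ, α, β)` within that space. -/
def LogspaceConstructible (F : ℕ → List PSym → ML → ML → MTL) : Prop :=
  ∃ (M : Transducer Sym) (C : ℕ), ∀ (k : ℕ) (Φ : List PSym) (α β : ML), Φ.Nodup →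
    M.ComputesInSpace (encInput k Φ α β) (F k Φ α β).enc
      (C * Nat.log 2 (k + Φ.length + α.enc.length + β.enc.length))

end MTLOrder

/-! The semantic part reads each connective as an operation on teams. `hook` passes to T_α, `exOne`
replaces T_α by one of its singletons, and `box` passes to the image. As scopes are edge-invariant
and disjoint, the part of a team in a scope is carried to its image by `box`, and a selection in one
scope leaves the others untouched (`Kripke.cond_img`, `Kripke.cond_sel_of_disjoint`).

A (k+1)-type is determined by its propositional part and the set of k-types of the successors. Hence
there are finitely many types, each has a characteristic formula, and ℛ[w]_{k+1} = [Rw]_k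
(`typeImg_typeOf`). So the syntactic definition of ≺ becomes a statement about successor teams.

ζ*_k has to say that some type x lies in [T_β] but not in [T_α] and that the two sets agree above x.
A world z of the stair s_k stands for x; the staircase offers a world of every type. Agreement above
x is expressed by splitting off a team S inside α∨β with [S_α] = [S_β], such that the rest has no
world of α∨β above z (`MTL.sat_zetaStarOf`). "Above z" is ζ_k(s_k, α∨β), an instance of the
induction hypothesis for other scopes; it needs only the stairs below k, as s_k itself has been
shrunk to z. Each `box` uses up one step of the offset of the remaining stairs. The argument matches
the definition of the lexicographic order directly; linearity of ≺ plays no role.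

For the space bound, each recursively defined formula contains its recursive call exactly once, and
in prefix notation as a suffix. The output is therefore a concatenation of prefixes, one for each
level, and no stack is needed. In the unfolding of ζ the arguments at level j are σ_j and
σ_{j+1}∨(…∨(α∨β)), which can be recomputed from j and the input. So finitely many counters with
values at most max(|Φ|, k+2) suffice. They are kept in binary as tracks of one work tape and
manipulated by structured programs with Hoare-style rules (`Exec`, `Does`, `Gives`), which are then
converted into a transducer. -/

namespace MTLOrder

section Semantics

variable {W : Type u} {K : Kripke W} {T S U : Set W} {a b : ML} {f g : MTL}

/-! ### Subteams -/

theorem Kripke.mem_cond {w : W} : w ∈ K.cond T a ↔ w ∈ T ∧ ML.Sat K w a := Iff.rfl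

theorem Kripke.mem_sel {w : W} : w ∈ K.sel T a S ↔ w ∈ T ∧ (ML.Sat K w a → w ∈ S) := by
  simp only [Kripke.sel, Kripke.cond, ML.Sat, Set.mem_union, Set.mem_inter_iff, Set.mem_ofPred_eq]
  tauto

theorem Kripke.cond_sel_self : K.cond (K.sel T a S) a = K.cond T a ∩ S := by
  ext w; simp only [mem_cond, mem_sel, Set.mem_inter_iff]; tauto

theorem Kripke.cond_sel_singleton {w : W} (hw : w ∈ K.cond T a) :
    K.cond (K.sel T a {w}) a = {w} := by
  rw [cond_sel_self]; simpa using hw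

/-- Only worlds of `a` are removed, so a scope disjoint from `a` keeps all its worlds. This lets
quantifiers over different scopes act independently on one team. -/
theorem Kripke.cond_sel_of_disjoint (h : DisjointIn K a b) :
    K.cond (K.sel T a S) b = K.cond T b := by
  ext w
  have := h w
  simp only [mem_cond, mem_sel]; tauto

theorem DisjointIn.symm (h : DisjointIn K a b) : DisjointIn K b a := fun w hw => h w hw.symm

theorem DisjointIn.or_right {c : ML} (hb : DisjointIn K a b) (hc : DisjointIn K a c) :
    DisjointIn K a (.or b c) := by
  intro w hw
  have := hb w
  have := hc w
  simp only [ML.Sat] at hw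
  tauto

theorem IsScope.or {Φ : Set PSym} (ha : IsScope K Φ a) (hb : IsScope K Φ b) :
    IsScope K Φ (.or a b) where
  frag := ⟨by simpa [ML.md] using And.intro ha.frag.1 hb.frag.1,
    Set.union_subset ha.frag.2 hb.frag.2⟩
  invariant w v h := by simp only [ML.Sat, ha.invariant w v h, hb.invariant w v h]

/-- Truth of a scope is passed along edges in both directions, so restriction commutes with images.
This is how the parts of a team are traced through `box`. -/
theorem Kripke.cond_img {Φ : Set PSym} (ha : IsScope K Φ a) :
    K.cond (K.img T) a = K.img (K.cond T a) := by
  ext v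
  constructor
  · rintro ⟨⟨w, hw, hwv⟩, hv⟩
    exact ⟨w, ⟨hw, (ha.invariant w v hwv).2 hv⟩, hwv⟩
  · rintro ⟨w, ⟨hw, hwa⟩, hwv⟩
    exact ⟨⟨w, hw, hwv⟩, (ha.invariant w v hwv).1 hwa⟩

theorem Kripke.cond_or : K.cond T (.or a b) = K.cond T a ∪ K.cond T b := by
  ext w; simp only [mem_cond, ML.Sat, Set.mem_union]; tauto

/-! ### Team semantics of the abbreviations -/

theorem MTL.sat_ovee : MTL.Sat K T (.ovee f g) ↔ MTL.Sat K T f ∨ MTL.Sat K T g := by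
  simp only [MTL.ovee, MTL.Sat]; tauto

theorem MTL.sat_imp : MTL.Sat K T (.imp f g) ↔ (MTL.Sat K T f → MTL.Sat K T g) := by
  simp only [MTL.imp, MTL.sat_ovee, MTL.Sat]; tauto

theorem MTL.sat_bigAnd {l : List MTL} : MTL.Sat K T (.bigAnd l) ↔ ∀ f ∈ l, MTL.Sat K T f := by
  induction l with
  | nil => simp [MTL.bigAnd, MTL.Sat, ML.Sat]
  | cons f l ih => simpa [MTL.bigAnd, MTL.Sat] using fun _ => ih

theorem MTL.sat_bigOvee {l : List MTL} : MTL.Sat K T (.bigOvee l) ↔ ∃ f ∈ l, MTL.Sat K T f := by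
  induction l with
  | nil => simp [MTL.bigOvee, MTL.Sat, ML.Sat]
  | cons f l ih =>
    have : MTL.bigOvee (f :: l) = .ovee f (.bigOvee l) := rfl
    simp [this, MTL.sat_ovee, ih]

theorem MTL.sat_E : MTL.Sat K T (.E a) ↔ (K.cond T a).Nonempty := by
  simp [MTL.E, MTL.Sat, ML.Sat, Set.Nonempty, Kripke.mem_cond]

theorem MTL.sat_ml_neg : MTL.Sat K T (.ml (.neg a)) ↔ K.cond T a = ∅ := by
  simp [MTL.Sat, ML.Sat, Set.eq_empty_iff_forall_notMem, Kripke.mem_cond]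

theorem MTL.sat_dep {p : PSym} :
    MTL.Sat K T (.dep p) ↔ ∀ w ∈ T, ∀ v ∈ T, (w ∈ K.V p ↔ v ∈ K.V p) := by
  simp only [MTL.dep, MTL.sat_ovee, MTL.Sat, ML.Sat]
  constructor
  · rintro (h | h) w hw v hv <;> simp [h w hw, h v hv]
  · intro h
    by_cases hT : ∃ w ∈ T, w ∈ K.V p
    · obtain ⟨w, hw, hwp⟩ := hT
      exact .inl fun v hv => (h w hw v hv).1 hwp
    · exact .inr fun w hw hwp => hT ⟨w, hw, hwp⟩

theorem MTL.sat_hook : MTL.Sat K T (.hook a f) ↔ MTL.Sat K (K.cond T a) f := by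
  constructor
  · rintro ⟨S, U, rfl, hS, hU, hf⟩
    have : K.cond (S ∪ U) a = U := by
      ext w
      have := hS w
      have := hU w
      simp only [Kripke.mem_cond, Set.mem_union, ML.Sat] at *
      tauto
    rwa [this]
  · intro h
    refine ⟨K.cond T (.neg a), K.cond T a, ?_, fun w hw => hw.2, fun w hw => hw.2, h⟩
    ext w; simp only [Kripke.mem_cond, Set.mem_union, ML.Sat]; tauto

/-- The disjunct `a` can absorb worlds of T_a only. So the other disjunct retains every world
outside `a` and an arbitrary subset of T_a. -/
theorem MTL.sat_exSub :
    MTL.Sat K T (.exSub a f) ↔ ∃ S ⊆ K.cond T a, MTL.Sat K (K.sel T a S) f := by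
  constructor
  · rintro ⟨S, U, rfl, hS, hf⟩
    refine ⟨K.cond U a, fun w hw => ⟨.inr hw.1, hw.2⟩, ?_⟩
    have : K.sel (S ∪ U) a (K.cond U a) = U := by
      ext w
      have := hS w
      simp only [Kripke.mem_sel, Kripke.mem_cond, Set.mem_union] at *
      tauto
    rwa [this]
  · rintro ⟨S, -, hf⟩
    refine ⟨K.cond T a, K.sel T a S, ?_, fun w hw => hw.2, hf⟩
    ext w; simp only [Kripke.mem_sel, Kripke.mem_cond, Set.mem_union]; tauto

theorem Kripke.sel_sel {S' : Set W} : K.sel (K.sel T a S) a S' = K.sel T a (S ∩ S') := by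
  ext w; simp only [Kripke.mem_sel, Set.mem_inter_iff]; tauto

theorem MTL.sat_allSub :
    MTL.Sat K T (.allSub a f) ↔ ∀ S ⊆ K.cond T a, MTL.Sat K (K.sel T a S) f := by
  simp [MTL.allSub, MTL.Sat, MTL.sat_exSub]

/-- The formula asks for a nonempty part of T_a such that `f` survives every further nonempty
shrinking of it. Any single world of that part is a witness; conversely, a singleton has no other
nonempty part. -/
theorem MTL.sat_exOne :
    MTL.Sat K T (.exOne a f) ↔ ∃ w ∈ K.cond T a, MTL.Sat K (K.sel T a {w}) f := by
  simp only [MTL.exOne, MTL.sat_exSub, MTL.Sat, MTL.sat_E, MTL.sat_allSub, MTL.sat_imp,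
    Kripke.cond_sel_self, Kripke.sel_sel]
  constructor
  · rintro ⟨S, hS, ⟨w, hw⟩, h⟩
    refine ⟨w, hw.1, ?_⟩
    have := h {w} (by simpa using hw) ⟨w, by simpa using hw⟩
    rwa [Set.inter_eq_right.2 (by simpa using hw.2)] at this
  · rintro ⟨w, hw, h⟩
    refine ⟨{w}, by simpa using hw, ⟨w, by simpa using hw⟩, ?_⟩
    rintro S - ⟨v, -, hv, hvS⟩
    obtain rfl : v = w := hv
    rwa [Set.inter_eq_left.2 (by simpa using hvS)]

theorem MTL.sat_allOne :
    MTL.Sat K T (.allOne a f) ↔ ∀ w ∈ K.cond T a, MTL.Sat K (K.sel T a {w}) f := by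
  simp [MTL.allOne, MTL.Sat, MTL.sat_exOne]

end Semantics

/-! ### Types -/

section Types

variable {Φ : Set PSym} {k : ℕ}

theorem neg_mem_MLfrag {a : ML} (h : a ∈ MLfrag Φ k) : ML.neg a ∈ MLfrag Φ k := h

theorem and_mem_MLfrag {a b : ML} (ha : a ∈ MLfrag Φ k) (hb : b ∈ MLfrag Φ k) :
    ML.and a b ∈ MLfrag Φ k :=
  ⟨max_le ha.1 hb.1, Set.union_subset ha.2 hb.2⟩

theorem box_mem_MLfrag_iff {a : ML} : ML.box a ∈ MLfrag Φ (k + 1) ↔ a ∈ MLfrag Φ k := by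
  simp [MLfrag, ML.md, ML.props]

theorem typeOf_mem {W : Type u} (K : Kripke W) (w : W) : typeOf K Φ k w ∈ Types.{u} Φ k := by
  refine ⟨fun a ha => ha.1, ⟨W, K, w, fun a ha => ha.2⟩, fun a ha => ?_⟩
  by_cases h : ML.Sat K w a
  · exact .inl ⟨ha, h⟩
  · exact .inr ⟨(neg_mem_MLfrag ha), h⟩

/-- A world that satisfies τ satisfies nothing else in the fragment, because τ contains the negation
of every formula it lacks. Hence types can be handled as types of worlds. -/
theorem exists_typeOf_eq {τ : Set ML} (h : τ ∈ Types.{u} Φ k) :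
    ∃ (W : Type u) (K : Kripke W) (w : W), typeOf K Φ k w = τ := by
  obtain ⟨hsub, ⟨W, K, w, hw⟩, hc⟩ := h
  refine ⟨W, K, w, Set.Subset.antisymm ?_ fun a ha => ⟨hsub ha, hw a ha⟩⟩
  rintro a ⟨ha, hs⟩
  rcases hc a ha with h | h
  · exact h
  · exact absurd hs (hw _ h)

theorem neg_mem_type_iff {τ : Set ML} (h : τ ∈ Types.{u} Φ k) {a : ML} (ha : a ∈ MLfrag Φ k) :
    ML.neg a ∈ τ ↔ a ∉ τ := by
  obtain ⟨W, K, w, rfl⟩ := exists_typeOf_eq h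
  simp [typeOf, ha, (neg_mem_MLfrag ha), ML.Sat]

theorem and_mem_type_iff {τ : Set ML} (h : τ ∈ Types.{u} Φ k) {a b : ML} (ha : a ∈ MLfrag Φ k)
    (hb : b ∈ MLfrag Φ k) : ML.and a b ∈ τ ↔ a ∈ τ ∧ b ∈ τ := by
  obtain ⟨W, K, w, rfl⟩ := exists_typeOf_eq h
  simp [typeOf, ha, hb, and_mem_MLfrag ha hb, ML.Sat]

theorem top_mem_type {τ : Set ML} (h : τ ∈ Types.{u} Φ k) : ML.top ∈ τ := by
  obtain ⟨W, K, w, rfl⟩ := exists_typeOf_eq h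
  simp [typeOf, MLfrag, ML.md, ML.props, ML.Sat]

theorem type_eq_of_subset {τ τ' : Set ML} (h : τ ∈ Types.{u} Φ k) (h' : τ' ∈ Types.{u} Φ k)
    (hs : τ ⊆ τ') : τ = τ' := by
  refine hs.antisymm fun a ha => ?_
  by_contra hn
  exact (neg_mem_type_iff h' (h'.1 ha)).1 (hs ((neg_mem_type_iff h (h'.1 ha)).2 hn)) ha

section TwoWorlds

variable {W W' : Type u} {K : Kripke W} {K' : Kripke W'} {w : W} {w' : W'}

theorem sat_iff_of_typeOf_eq (h : typeOf K Φ k w = typeOf K' Φ k w') {a : ML}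
    (ha : a ∈ MLfrag Φ k) : ML.Sat K w a ↔ ML.Sat K' w' a := by
  have := Set.ext_iff.1 h a
  simpa [typeOf, ha] using this

theorem typeOf_eq_iff : typeOf K Φ k w = typeOf K' Φ k w' ↔
    ∀ a ∈ MLfrag Φ k, (ML.Sat K w a ↔ ML.Sat K' w' a) := by
  refine ⟨fun h a => sat_iff_of_typeOf_eq h, fun h => Set.ext fun a => ?_⟩
  simp only [typeOf, Set.mem_ofPred_eq]
  exact and_congr_right (h a)

theorem exists_sat_of_typesOf_subset (h : typesOf K Φ k (K.img {w}) ⊆ typesOf K' Φ k (K'.img {w'}))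
    {a : ML} (ha : a ∈ MLfrag Φ k) (hs : ∃ v, K.R w v ∧ ML.Sat K v a) :
    ∃ v, K'.R w' v ∧ ML.Sat K' v a := by
  obtain ⟨v, hv, hva⟩ := hs
  obtain ⟨v', ⟨_, rfl, hv'⟩, he⟩ := h ⟨v, ⟨w, rfl, hv⟩, rfl⟩
  exact ⟨v', hv', (sat_iff_of_typeOf_eq he ha).2 hva⟩

/-- Outside the Boolean connectives, a formula of depth k+1 consists of symbols and of modalities
over formulas of depth k, and the latter see only the types of the successors. -/
theorem typeOf_succ_eq (hp : ∀ p ∈ Φ, (w ∈ K.V p ↔ w' ∈ K'.V p))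
    (h : typesOf K Φ k (K.img {w}) = typesOf K' Φ k (K'.img {w'})) :
    typeOf K Φ (k + 1) w = typeOf K' Φ (k + 1) w' := by
  rw [typeOf_eq_iff]
  intro a
  have key : ∀ a ∈ MLfrag Φ k,
      (∃ v, K.R w v ∧ ML.Sat K v a) ↔ ∃ v, K'.R w' v ∧ ML.Sat K' v a := fun a ha =>
    ⟨exists_sat_of_typesOf_subset h.le ha, exists_sat_of_typesOf_subset h.ge ha⟩
  induction a with
  | var p => intro ha; exact hp p (ha.2 rfl)
  | top => intro _; simp [ML.Sat]
  | neg a ih => intro ha; simp only [ML.Sat, ih ha]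
  | and a b iha ihb =>
    intro ha
    simp only [MLfrag, Set.mem_ofPred_eq, ML.md, ML.props, max_le_iff, Set.union_subset_iff] at ha
    simp only [ML.Sat, iha ⟨ha.1.1, ha.2.1⟩, ihb ⟨ha.1.2, ha.2.2⟩]
  | or a b iha ihb =>
    intro ha
    simp only [MLfrag, Set.mem_ofPred_eq, ML.md, ML.props, max_le_iff, Set.union_subset_iff] at ha
    simp only [ML.Sat, iha ⟨ha.1.1, ha.2.1⟩, ihb ⟨ha.1.2, ha.2.2⟩]
  | box a _ =>
    intro ha
    -- The box case is the diamond case for the negated formula.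
    have := key (.neg a) (neg_mem_MLfrag (box_mem_MLfrag_iff.1 ha))
    simp only [ML.Sat] at this ⊢
    simpa using not_congr this
  | dia a _ => intro ha; exact key a (box_mem_MLfrag_iff.1 ha)

theorem typeOf_zero_eq (hp : ∀ p ∈ Φ, (w ∈ K.V p ↔ w' ∈ K'.V p)) :
    typeOf K Φ 0 w = typeOf K' Φ 0 w' := by
  rw [typeOf_eq_iff]
  intro a
  induction a with
  | var p => intro ha; exact hp p (ha.2 rfl)
  | top => intro _; simp [ML.Sat]
  | neg a ih => intro ha; simp only [ML.Sat, ih ha]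
  | and a b iha ihb =>
    intro ha
    simp only [MLfrag, Set.mem_ofPred_eq, ML.md, ML.props, max_le_iff, Set.union_subset_iff] at ha
    simp only [ML.Sat, iha ⟨ha.1.1, ha.2.1⟩, ihb ⟨ha.1.2, ha.2.2⟩]
  | or a b iha ihb =>
    intro ha
    simp only [MLfrag, Set.mem_ofPred_eq, ML.md, ML.props, max_le_iff, Set.union_subset_iff] at ha
    simp only [ML.Sat, iha ⟨ha.1.1, ha.2.1⟩, ihb ⟨ha.1.2, ha.2.2⟩]
  | box a _ => intro ha; simp [MLfrag, ML.md] at ha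
  | dia a _ => intro ha; simp [MLfrag, ML.md] at ha

end TwoWorlds

/-! ### Finiteness of the set of types and characteristic formulas -/

theorem finite_types (hΦ : Φ.Finite) (k : ℕ) : (Types.{u} Φ k).Finite := by
  have key : ∀ k, ∀ τ : Types.{u} Φ k,
      ∃ (W : Type u) (K : Kripke W) (w : W), typeOf K Φ k w = τ.1 := fun k τ => exists_typeOf_eq τ.2
  choose W K w hw using key
  have := hΦ.to_subtype
  induction k with
  | zero =>
    let F : Types.{u} Φ 0 → Set Φ := fun τ => {p | w 0 τ ∈ (K 0 τ).V p}
    refine Set.finite_coe_iff.1 (Finite.of_injective F fun τ τ' h => Subtype.ext ?_)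
    rw [← hw 0 τ, ← hw 0 τ']
    exact typeOf_zero_eq fun p hp => Set.ext_iff.1 h ⟨p, hp⟩
  | succ k ih =>
    have := ih.to_subtype
    -- A type is sent to its propositional part and its set of successor types. The target is finite
    -- by induction, and the map is injective by `typeOf_succ_eq`.
    let F : Types.{u} Φ (k + 1) → Set Φ × Set (Types.{u} Φ k) := fun τ =>
      ({p | w _ τ ∈ (K _ τ).V p}, {t | t.1 ∈ typesOf (K _ τ) Φ k ((K _ τ).img {w _ τ})})
    refine Set.finite_coe_iff.1 (Finite.of_injective F fun τ τ' h => Subtype.ext ?_)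
    rw [← hw _ τ, ← hw _ τ']
    refine typeOf_succ_eq (fun p hp => Set.ext_iff.1 (congrArg Prod.fst h) ⟨p, hp⟩) ?_
    have h2 := fun t => Set.ext_iff.1 (congrArg Prod.snd h) t
    ext t
    constructor
    · rintro ⟨v, hv, rfl⟩
      exact (h2 ⟨_, typeOf_mem _ v⟩).1 ⟨v, hv, rfl⟩
    · rintro ⟨v, hv, rfl⟩
      exact (h2 ⟨_, typeOf_mem _ v⟩).2 ⟨v, hv, rfl⟩

/-- Distinct types are incomparable under inclusion, so τ has a formula that a given other type
lacks. As there are finitely many types, the conjunction of such formulas isolates τ. -/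
theorem exists_characteristic_formula (hΦ : Φ.Finite) {τ : Set ML} (hτ : τ ∈ Types.{u} Φ k) :
    ∃ a ∈ MLfrag Φ k, ∀ τ' ∈ Types.{u} Φ k, (a ∈ τ' ↔ τ' = τ) := by
  have sep : ∀ D : Set (Set ML), D.Finite → D ⊆ Types.{u} Φ k →
      ∃ a ∈ MLfrag Φ k, a ∈ τ ∧ ∀ τ' ∈ D, τ' ≠ τ → a ∉ τ' := by
    intro D hD
    induction D, hD using Set.Finite.induction_on with
    | empty => exact fun _ => ⟨.top, hτ.1 (top_mem_type hτ), top_mem_type hτ, by simp⟩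
    | @insert τ₁ D _ _ ih =>
      intro hs
      obtain ⟨a, ha, haτ, hD⟩ := ih ((Set.subset_insert _ _).trans hs)
      have h₁ := hs (Set.mem_insert _ _)
      by_cases he : τ₁ = τ
      · refine ⟨a, ha, haτ, fun τ' h' hne => ?_⟩
        rcases h' with rfl | h'
        · exact absurd he hne
        · exact hD τ' h' hne
      · obtain ⟨b, hb, hb₁⟩ : ∃ b ∈ τ, b ∉ τ₁ := by
          by_contra! hn
          exact he (type_eq_of_subset hτ h₁ hn).symm
        refine ⟨.and a b, and_mem_MLfrag ha (hτ.1 hb),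
          (and_mem_type_iff hτ ha (hτ.1 hb)).2 ⟨haτ, hb⟩, fun τ' h' hne hab => ?_⟩
        have := (and_mem_type_iff (hs h') ha (hτ.1 hb)).1 hab
        rcases h' with rfl | h'
        · exact hb₁ this.2
        · exact hD τ' h' hne this.1
  obtain ⟨a, ha, haτ, h⟩ := sep _ (finite_types hΦ k) subset_rfl
  refine ⟨a, ha, fun τ' h' => ⟨fun haτ' => ?_, fun he => he ▸ haτ⟩⟩
  by_contra hne
  exact h τ' h' hne haτ'

/-- Only the inclusion from right to left is immediate. If no successor realises τ, with
characteristic formula a, then □¬a belongs to the type of w, which forces ¬a ∈ τ, a contradiction.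
-/
theorem typeImg_typeOf {W : Type u} {K : Kripke W} (hΦ : Φ.Finite) (w : W) :
    typeImg.{u} Φ k (typeOf K Φ (k + 1) w) = typesOf K Φ k (K.img {w}) := by
  ext τ
  constructor
  · rintro ⟨hτ, hsub⟩
    obtain ⟨a, ha, hchar⟩ := exists_characteristic_formula hΦ hτ
    by_contra hn
    have : ML.neg a ∈ τ := by
      refine hsub ⟨box_mem_MLfrag_iff.2 (neg_mem_MLfrag ha), fun v hv hva => hn ⟨v, ⟨w, rfl, hv⟩, ?_⟩⟩
      exact (hchar _ (typeOf_mem K v)).1 ⟨ha, hva⟩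
    exact (neg_mem_type_iff hτ ha).1 this ((hchar τ hτ).2 rfl)
  · rintro ⟨v, ⟨_, rfl, hv⟩, rfl⟩
    exact ⟨typeOf_mem K v, fun a ha => ⟨box_mem_MLfrag_iff.1 ha.1, ha.2 v hv⟩⟩

theorem typeOf_succ_eq_iff {W : Type u} {K : Kripke W} (hΦ : Φ.Finite) {w v : W} :
    typeOf K Φ (k + 1) w = typeOf K Φ (k + 1) v ↔ (∀ p ∈ Φ, (w ∈ K.V p ↔ v ∈ K.V p)) ∧
      typesOf K Φ k (K.img {w}) = typesOf K Φ k (K.img {v}) := by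
  refine ⟨fun h => ⟨fun p hp => ?_, ?_⟩, fun h => typeOf_succ_eq h.1 h.2⟩
  · exact sat_iff_of_typeOf_eq h (a := .var p) ⟨by simp [ML.md], by simpa [ML.props] using hp⟩
  · rw [← typeImg_typeOf hΦ, h, typeImg_typeOf hΦ]

theorem typeOf_zero_eq_iff {W : Type u} {K : Kripke W} {w v : W} :
    typeOf K Φ 0 w = typeOf K Φ 0 v ↔ ∀ p ∈ Φ, (w ∈ K.V p ↔ v ∈ K.V p) :=
  ⟨fun h p hp => sat_iff_of_typeOf_eq h (a := .var p)
    ⟨by simp [ML.md], by simpa [ML.props] using hp⟩, typeOf_zero_eq⟩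

theorem typeProps_typeOf {W : Type u} {K : Kripke W} {L : List PSym} {w : W} :
    typeProps L (typeOf K (symSet L) k w) = {p ∈ symSet L | w ∈ K.V p} := by
  ext p
  refine and_congr_right fun hp => ?_
  have : ML.var p ∈ MLfrag (symSet L) k := ⟨by simp [ML.md], by simpa [ML.props] using hp⟩
  simp [typeOf, this, ML.Sat]

end Types

/-! ### Correctness of the formulas for bisimilarity and for the orders -/

section Correctness

variable {W : Type u} {K : Kripke W} {T : Set W} {Φ : List PSym} {α β : ML} {k : ℕ}

theorem symSet_finite (Φ : List PSym) : (symSet Φ).Finite := Φ.finite_toSet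

theorem typesOf_singleton {X : Set PSym} {w : W} : typesOf K X k {w} = {typeOf K X k w} := by
  ext τ; simp [typesOf, eq_comm]

theorem typesOf_mono {X : Set PSym} {S : Set W} (h : S ⊆ T) : typesOf K X k S ⊆ typesOf K X k T :=
  fun _ ⟨w, hw, he⟩ => ⟨w, h hw, he⟩

theorem Kripke.cond_mono {S : Set W} (h : S ⊆ T) : K.cond S α ⊆ K.cond T α :=
  fun _ hw => ⟨h hw.1, hw.2⟩

theorem MTL.sat_chiZero {w v : W} (hα : K.cond T α = {w}) (hβ : K.cond T β = {v}) :
    MTL.Sat K T (chiZero Φ α β) ↔ ∀ p ∈ symSet Φ, (w ∈ K.V p ↔ v ∈ K.V p) := by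
  simp only [chiZero, MTL.sat_hook, Kripke.cond_or, hα, hβ, MTL.sat_bigAnd, List.mem_map,
    forall_exists_index, and_imp, forall_apply_eq_imp_iff₂, MTL.sat_dep]
  refine forall₂_congr fun p _ => ⟨fun h => h w (by simp) v (by simp), fun h => ?_⟩
  simp only [Set.singleton_union, Set.mem_insert_iff, Set.mem_singleton_iff]
  rintro _ (rfl | rfl) _ (rfl | rfl) <;> simp [h]

/-- The formula rules out that worlds of one scope can be deleted so that both scopes stay nonempty
but no pair of equal type remains. Such a deletion is possible exactly if some type occurs in only
one of two nonempty scopes. -/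
theorem MTL.sat_chiStarOf {c : MTL} {X : Set PSym} (hαβ : DisjointIn K α β)
    (hc : ∀ (S : Set W) (w v : W), K.cond S α = {w} → K.cond S β = {v} →
      (MTL.Sat K S c ↔ typeOf K X k w = typeOf K X k v)) :
    MTL.Sat K T (chiStarOf c α β) ↔
      typesOf K X k (K.cond T α) = typesOf K X k (K.cond T β) := by
  have hone : ∀ U : Set W, MTL.Sat K U (.exOne α (.exOne β c)) ↔
      ∃ w ∈ K.cond U α, ∃ v ∈ K.cond U β, typeOf K X k w = typeOf K X k v := by
    intro U
    simp only [MTL.sat_exOne, Kripke.cond_sel_of_disjoint hαβ]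
    refine exists_congr fun w => and_congr_right fun hw => exists_congr fun v =>
      and_congr_right fun hv => hc _ w v ?_ ?_
    · rw [Kripke.cond_sel_of_disjoint hαβ.symm, Kripke.cond_sel_singleton hw]
    · exact Kripke.cond_sel_singleton (by rwa [Kripke.cond_sel_of_disjoint hαβ])
  simp only [chiStarOf, MTL.sat_ovee, MTL.Sat.eq_3, MTL.Sat.eq_2, MTL.Sat.eq_4, MTL.sat_E,
    MTL.sat_ml_neg, hone]
  constructor
  · rintro (⟨h₁, h₂⟩ | ⟨⟨w₀, h₁⟩, ⟨v₀, h₂⟩, h⟩)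
    · rw [h₁, h₂]
    · by_contra hne
      have split : ∀ x ∈ T, MTL.Sat K {w ∈ T | ML.Sat K w α ∧ w ≠ x} (.ml α) := fun x _ w hw => hw.2.1
      have split' : ∀ x ∈ T, MTL.Sat K {w ∈ T | ML.Sat K w β ∧ w ≠ x} (.ml β) := fun x _ w hw => hw.2.1
      by_cases hs : typesOf K X k (K.cond T α) ⊆ typesOf K X k (K.cond T β)
      · obtain ⟨τ, ⟨v, hv, rfl⟩, hn⟩ :=
          Set.not_subset.1 fun hs' => hne (hs.antisymm hs')
        -- The type of v does not occur in α: delete all worlds of β except v. The world w₀ of α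
        -- survives because it is not in β.
        refine h ⟨_, {w ∈ T | ML.Sat K w β → w = v}, ?_, .inr (split' v hv.1),
          ⟨w₀, ⟨h₁.1, fun hb => absurd ⟨h₁.2, hb⟩ (hαβ w₀)⟩, h₁.2⟩, ⟨v, ⟨hv.1, fun _ => rfl⟩, hv.2⟩, ?_⟩
        · ext w; simp only [Set.mem_union, Set.mem_ofPred_eq]; tauto
        · rintro ⟨w, ⟨⟨hw, -⟩, hwa⟩, v', ⟨⟨hv', he⟩, hvb⟩, heq⟩
          obtain rfl := he hvb
          exact hn ⟨w, ⟨hw, hwa⟩, heq⟩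
      · obtain ⟨τ, ⟨v, hv, rfl⟩, hn⟩ := Set.not_subset.1 hs
        refine h ⟨_, {w ∈ T | ML.Sat K w α → w = v}, ?_, .inl (split v hv.1),
          ⟨v, ⟨hv.1, fun _ => rfl⟩, hv.2⟩, ⟨v₀, ⟨h₂.1, fun hb => absurd ⟨hb, h₂.2⟩ (hαβ v₀)⟩, h₂.2⟩, ?_⟩
        · ext w; simp only [Set.mem_union, Set.mem_ofPred_eq]; tauto
        · rintro ⟨v', ⟨⟨hv', he⟩, hvb⟩, w, ⟨⟨hw, -⟩, hwa⟩, heq⟩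
          obtain rfl := he hvb
          exact hn ⟨w, ⟨hw, hwa⟩, heq.symm⟩
  · intro he
    rcases (K.cond T α).eq_empty_or_nonempty with h₁ | h₁
    · left
      refine ⟨h₁, Set.eq_empty_iff_forall_notMem.2 fun v hv => ?_⟩
      obtain ⟨w, hw, -⟩ := he.ge ⟨v, hv, rfl⟩
      exact (Set.eq_empty_iff_forall_notMem.1 h₁ w) hw
    · right
      have h₂ : (K.cond T β).Nonempty := by
        obtain ⟨w, hw⟩ := h₁
        obtain ⟨v, hv, -⟩ := he.le ⟨w, hw, rfl⟩
        exact ⟨v, hv⟩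
      refine ⟨h₁, h₂, ?_⟩
      -- S lies in one scope, so the other scope is untouched in U. The partner there of a surviving
      -- world of the first scope is therefore still present.
      rintro ⟨S, U, rfl, hS | hS, ⟨w, hw⟩, ⟨v, hv⟩, hn⟩
      · obtain ⟨v', ⟨hv', hvb⟩, heq⟩ := he.le ⟨w, ⟨.inr hw.1, hw.2⟩, rfl⟩
        rcases hv' with hv' | hv'
        · exact hαβ v' ⟨hS v' hv', hvb⟩
        · exact hn ⟨w, hw, v', ⟨hv', hvb⟩, heq.symm⟩
      · obtain ⟨w', ⟨hw', hwa⟩, heq⟩ := he.ge ⟨v, ⟨.inr hv.1, hv.2⟩, rfl⟩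
        rcases hw' with hw' | hw'
        · exact hαβ w' ⟨hwa, hS w' hw'⟩
        · exact hn ⟨w', ⟨hw', hwa⟩, v, hv, heq⟩

/-- At depth k+1 the box turns the singletons {w} and {v} into Rw and Rv, whose sets of k-types are
compared by χ*_k. -/
theorem MTL.sat_chi (sα : IsScope K (symSet Φ) α) (sβ : IsScope K (symSet Φ) β)
    (hαβ : DisjointIn K α β) (k : ℕ) (T : Set W) (w v : W) (hα : K.cond T α = {w})
    (hβ : K.cond T β = {v}) : MTL.Sat K T (chi Φ k α β) ↔
      typeOf K (symSet Φ) k w = typeOf K (symSet Φ) k v := by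
  induction k generalizing T w v with
  | zero => rw [chi, MTL.sat_chiZero hα hβ, typeOf_zero_eq_iff]
  | succ k ih =>
    rw [chi, MTL.Sat, MTL.sat_chiZero hα hβ, MTL.Sat, MTL.sat_chiStarOf hαβ ih,
      typeOf_succ_eq_iff (symSet_finite Φ), Kripke.cond_img sα, Kripke.cond_img sβ, hα, hβ]

theorem MTL.sat_chiStar (sα : IsScope K (symSet Φ) α) (sβ : IsScope K (symSet Φ) β)
    (hαβ : DisjointIn K α β) : MTL.Sat K T (chiStar Φ k α β) ↔
      typesOf K (symSet Φ) k (K.cond T α) = typesOf K (symSet Φ) k (K.cond T β) :=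
  MTL.sat_chiStarOf hαβ (MTL.sat_chi sα sβ hαβ k)

/-- A single world of `β` has the same type as some world of `α`. -/
theorem MTL.sat_exOne_chi {s : ML} {z : W} (ss : IsScope K (symSet Φ) s)
    (sβ : IsScope K (symSet Φ) β) (h : DisjointIn K β s) (hz : K.cond T s = {z}) :
    MTL.Sat K T (.exOne β (chi Φ k s β)) ↔
      typeOf K (symSet Φ) k z ∈ typesOf K (symSet Φ) k (K.cond T β) := by
  rw [MTL.sat_exOne]
  refine exists_congr fun v => and_congr_right fun hv => ?_
  rw [MTL.sat_chi ss sβ h.symm k _ z v (by rwa [Kripke.cond_sel_of_disjoint h])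
    (Kripke.cond_sel_singleton hv), eq_comm]

theorem MTL.sat_bigAnd_map {A : Type*} {l : List A} {h : A → MTL} :
    MTL.Sat K T (.bigAnd (l.map h)) ↔ ∀ x ∈ l, MTL.Sat K T (h x) := by
  simp only [MTL.sat_bigAnd, List.forall_mem_map]

/-- The depths `i` and `j` are free because the propositional part of a type does not depend on the
depth; ζ_0 recurs as a disjunct at every level. -/
theorem MTL.sat_zetaZero {w v : W} (hα : K.cond T α = {w}) (hβ : K.cond T β = {v}) (i j : ℕ) :
    MTL.Sat K T (zetaZero Φ α β) ↔ LexLT (symSet Φ) (symLT Φ)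
      (typeProps Φ (typeOf K (symSet Φ) i w)) (typeProps Φ (typeOf K (symSet Φ) j v)) := by
  simp only [zetaZero, MTL.sat_bigOvee, List.mem_map, exists_exists_and_eq_and, MTL.Sat, MTL.sat_hook, hα, hβ, ML.Sat,
    MTL.sat_bigAnd_map, Kripke.cond_or, typeProps_typeOf, LexLT, MTL.sat_dep]
  refine exists_congr fun p => ?_
  simp only [Set.mem_singleton_iff, forall_eq, List.mem_filter, decide_eq_true_eq,
    Set.singleton_union, Set.mem_insert_iff, Set.mem_sdiff, Set.mem_ofPred_eq, symLT]
  constructor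
  · rintro ⟨hp, hw, hv, h⟩
    exact ⟨⟨⟨hp, hv⟩, fun h' => hw h'.2⟩, fun q hq hpq =>
      and_congr_right fun _ => h q ⟨hq, hpq⟩ w (.inl rfl) v (.inr rfl)⟩
  · rintro ⟨⟨⟨hp, hv⟩, hw⟩, h⟩
    refine ⟨hp, fun h' => hw ⟨hp, h'⟩, hv, fun q hq => ?_⟩
    have hq' : q ∈ symSet Φ := hq.1
    have := h q hq' hq.2
    simp only [hq', true_and] at this
    rintro _ (rfl | rfl) _ (rfl | rfl) <;> simp [this]

/-! ### Staircases and successor teams -/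

theorem Kripke.iterate_img_mono {S : Set W} (h : S ⊆ T) (i : ℕ) : K.img^[i] S ⊆ K.img^[i] T := by
  induction i generalizing S T with
  | zero => exact h
  | succ i ih => exact ih fun v ⟨w, hw, hwv⟩ => ⟨w, h hw, hwv⟩

theorem Kripke.mem_iterate_img {i : ℕ} {v : W} :
    v ∈ K.img^[i] T ↔ ∃ w ∈ T, v ∈ K.img^[i] {w} := by
  induction i generalizing T with
  | zero => simp
  | succ i ih =>
    simp only [Function.iterate_succ_apply]
    rw [ih]
    constructor
    · rintro ⟨u, ⟨w, hw, hwu⟩, hv⟩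
      exact ⟨w, hw, ih.2 ⟨u, ⟨w, rfl, hwu⟩, hv⟩⟩
    · rintro ⟨w, hw, hv⟩
      obtain ⟨u, ⟨w', rfl, hwu⟩, hv'⟩ := ih.1 hv
      exact ⟨u, ⟨w', hw, hwu⟩, hv'⟩

/-- Among the successors of w choose u with a world j steps ahead. The j-step image of u is then a
nonempty part of the (j+1)-step image of w, so it too has τ as its only type. -/
theorem CanonicalOffset.img {X : Set PSym} {i j : ℕ} (h : CanonicalOffset K X i (j + 1) T) :
    CanonicalOffset K X i j (K.img T) := by
  intro τ hτ
  obtain ⟨w, hw, he⟩ := h τ hτ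
  rw [Function.iterate_succ_apply] at he
  obtain ⟨x, hx, hxτ⟩ : τ ∈ typesOf K X i (K.img^[j] (K.img {w})) := he.ge rfl
  obtain ⟨u, hu, hxu⟩ := Kripke.mem_iterate_img.1 hx
  refine ⟨u, ?_, Set.Subset.antisymm ?_ ?_⟩
  · obtain ⟨_, rfl, hwu⟩ := hu
    exact ⟨_, hw, hwu⟩
  · exact (typesOf_mono (Kripke.iterate_img_mono (by simpa using hu) j)).trans he.le
  · rintro _ rfl
    exact ⟨x, hxu, hxτ⟩

/-- The premises on scopes and stairs under which `ζ_k(α,β)` is correct; only the stairs below `k`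
matter. -/
structure StairsBelow (K : Kripke W) (Φ : Set PSym) (k : ℕ) (s : ℕ → ML) (α β : ML) (T : Set W) :
    Prop where
  scope_left : IsScope K Φ α
  scope_right : IsScope K Φ β
  scope_stair : ∀ i < k, IsScope K Φ (s i)
  disj : DisjointIn K α β
  disj_left : ∀ i < k, DisjointIn K α (s i)
  disj_right : ∀ i < k, DisjointIn K β (s i)
  disj_stair : ∀ i < k, ∀ j < k, i ≠ j → DisjointIn K (s i) (s j)
  canonical : ∀ i < k, CanonicalOffset K Φ i (k - i) (K.cond T (s i))

/-- The probe z in the stair s_k plays the role of the deciding type in the lexicographic order. The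
three conjuncts say that its type occurs in β, does not occur in α, and that above it α and β have
the same types. -/
theorem MTL.sat_zetaStarOf {s : ℕ → ML} (hd : DisjointScopes K (symSet Φ) k s α β)
    (hT : IsStaircase K (symSet Φ) s k T)
    (ih : ∀ (U : Set W) (w v : W), StairsBelow K (symSet Φ) k s (s k) (.or α β) U →
      K.cond U (s k) = {w} → K.cond U (.or α β) = {v} →
      (MTL.Sat K U (zeta Φ s k (s k) (.or α β)) ↔
        TypeLT.{u} Φ k (typeOf K (symSet Φ) k w) (typeOf K (symSet Φ) k v))) :
    MTL.Sat K T (zetaStar Φ s k α β) ↔ TypeSetLT.{u} Φ k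
      (typesOf K (symSet Φ) k (K.cond T α)) (typesOf K (symSet Φ) k (K.cond T β)) := by
  have hsα := (hd.disj_left k le_rfl).symm
  have hsβ := (hd.disj_right k le_rfl).symm
  have hss := hd.scope_stair k le_rfl
  have hsαβ := hsα.or_right hsβ
  rw [zetaStar, zetaStarOf, MTL.sat_exOne]
  -- For a fixed probe z, the last conjunct expresses agreement above the type of z.
  have key : ∀ z ∈ K.cond T (s k), (MTL.Sat K (K.sel T (s k) {z})
      (.or (.and (chiStar Φ k α β) (.ml (.or α β)))
        (.allOne (.or α β) (.tilde (zeta Φ s k (s k) (.or α β))))) ↔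
      ∀ τ ∈ Types.{u} (symSet Φ) k, TypeLT.{u} Φ k (typeOf K (symSet Φ) k z) τ →
        (τ ∈ typesOf K (symSet Φ) k (K.cond T α) ↔ τ ∈ typesOf K (symSet Φ) k (K.cond T β))) := by
    intro z hz
    -- A team S inside α∨β contains no world of the stairs, so U retains z and all stairs below k.
    -- Shrinking α∨β to a single world v then puts the pair s_k, α∨β under the induction hypothesis.
    have hall : ∀ S U : Set W, K.sel T (s k) {z} = S ∪ U → MTL.Sat K S (.ml (.or α β)) →
        (MTL.Sat K U (.allOne (.or α β) (.tilde (zeta Φ s k (s k) (.or α β)))) ↔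
          ∀ v ∈ K.cond U (.or α β), ¬ TypeLT.{u} Φ k (typeOf K (symSet Φ) k z)
            (typeOf K (symSet Φ) k v)) := by
      intro S U hSU hS
      rw [MTL.sat_allOne]
      refine forall₂_congr fun v hv => not_congr (ih _ z v ?_ ?_ (Kripke.cond_sel_singleton hv))
      · refine ⟨hss, hd.scope_left.or hd.scope_right, fun i hi => hd.scope_stair i hi.le, hsαβ,
          fun i hi => hd.disj_stair k le_rfl i hi.le hi.ne', fun i hi => ?_,
          fun i hi j hj => hd.disj_stair i hi.le j hj.le, fun i hi => ?_⟩
        · exact ((hd.disj_left i hi.le).symm.or_right (hd.disj_right i hi.le).symm).symm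
        · have h₁ : DisjointIn K (.or α β) (s i) :=
            ((hd.disj_left i hi.le).symm.or_right (hd.disj_right i hi.le).symm).symm
          have h₂ : K.cond (K.sel U (.or α β) {v}) (s i) = K.cond T (s i) := by
            rw [Kripke.cond_sel_of_disjoint h₁]
            have h₃ : K.cond (K.sel T (s k) {z}) (s i) = K.cond T (s i) :=
              Kripke.cond_sel_of_disjoint (hd.disj_stair k le_rfl i hi.le hi.ne')
            rw [← h₃, hSU]
            ext x
            have := hS x
            have := h₁ x
            simp only [Kripke.mem_cond, Set.mem_union]
            tauto
          rw [h₂]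
          exact hT i hi.le
      · rw [Kripke.cond_sel_of_disjoint hsαβ.symm, ← Kripke.cond_sel_singleton hz, hSU]
        ext x
        have := hS x
        have := hsαβ x
        simp only [Kripke.mem_cond, Set.mem_union]
        tauto
    have hcα : K.cond (K.sel T (s k) {z}) α = K.cond T α := Kripke.cond_sel_of_disjoint hsα
    have hcβ : K.cond (K.sel T (s k) {z}) β = K.cond T β := Kripke.cond_sel_of_disjoint hsβ
    constructor
    -- A world of α or β above z cannot be in U. It is in S, where it has a partner in the other
    -- scope.
    · rintro ⟨S, U, hSU, ⟨hχ, hS⟩, hU⟩ τ hτ hlt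
      rw [hall S U hSU hS] at hU
      rw [MTL.sat_chiStar hd.scope_left hd.scope_right hd.disj] at hχ
      rw [← hcα, ← hcβ, hSU]
      constructor
      · rintro ⟨w, ⟨hw, hwa⟩, rfl⟩
        have hwS : w ∈ S := hw.resolve_right fun h : w ∈ U => hU w ⟨h, .inl hwa⟩ hlt
        have hm := hχ.le ⟨w, ⟨hwS, hwa⟩, rfl⟩
        exact typesOf_mono (Kripke.cond_mono Set.subset_union_left) hm
      · rintro ⟨w, ⟨hw, hwb⟩, rfl⟩
        have hwS : w ∈ S := hw.resolve_right fun h : w ∈ U => hU w ⟨h, .inr hwb⟩ hlt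
        have hm := hχ.ge ⟨w, ⟨hwS, hwb⟩, rfl⟩
        exact typesOf_mono (Kripke.cond_mono Set.subset_union_left) hm
    · intro h
      -- Split off exactly the worlds of α∨β above z. A partner of such a world has the same type,
      -- hence is above z and split off as well.
      let P : W → Prop := fun x => ML.Sat K x (.or α β) ∧
        TypeLT.{u} Φ k (typeOf K (symSet Φ) k z) (typeOf K (symSet Φ) k x)
      have hSU : K.sel T (s k) {z} =
          {x ∈ K.sel T (s k) {z} | P x} ∪ {x ∈ K.sel T (s k) {z} | ¬ P x} := by
        ext x
        by_cases hx : P x <;> simp [hx]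
      have hS : MTL.Sat K {x ∈ K.sel T (s k) {z} | P x} (.ml (.or α β)) := fun x hx => hx.2.1
      refine ⟨_, _, hSU, ⟨?_, hS⟩, (hall _ _ hSU hS).2 fun v hv hlt => hv.1.2 ⟨hv.2, hlt⟩⟩
      rw [MTL.sat_chiStar hd.scope_left hd.scope_right hd.disj]
      rw [← hcα, ← hcβ] at h
      ext τ
      constructor
      · rintro ⟨w, ⟨⟨hw, hP⟩, hwa⟩, rfl⟩
        obtain ⟨v, hv, he⟩ := (h _ (typeOf_mem K w) hP.2).1 ⟨w, ⟨hw, hwa⟩, rfl⟩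
        exact ⟨v, ⟨⟨hv.1, .inr hv.2, he ▸ hP.2⟩, hv.2⟩, he⟩
      · rintro ⟨w, ⟨⟨hw, hP⟩, hwb⟩, rfl⟩
        obtain ⟨v, hv, he⟩ := (h _ (typeOf_mem K w) hP.2).2 ⟨w, ⟨hw, hwb⟩, rfl⟩
        exact ⟨v, ⟨⟨hv.1, .inl hv.2, he ▸ hP.2⟩, hv.2⟩, he⟩
  have key' : ∀ z ∈ K.cond T (s k), (MTL.Sat K (K.sel T (s k) {z})
      (.and (.exOne β (chi Φ k (s k) β)) (.and (.tilde (.exOne α (chi Φ k (s k) α)))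
        (.or (.and (chiStar Φ k α β) (.ml (.or α β)))
          (.allOne (.or α β) (.tilde (zeta Φ s k (s k) (.or α β))))))) ↔
      typeOf K (symSet Φ) k z ∈ typesOf K (symSet Φ) k (K.cond T β) \
        typesOf K (symSet Φ) k (K.cond T α) ∧
      ∀ τ ∈ Types.{u} (symSet Φ) k, TypeLT.{u} Φ k (typeOf K (symSet Φ) k z) τ →
        (τ ∈ typesOf K (symSet Φ) k (K.cond T α) ↔
          τ ∈ typesOf K (symSet Φ) k (K.cond T β))) := by
    intro z hz
    have hc := Kripke.cond_sel_singleton hz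
    rw [MTL.Sat, MTL.Sat, MTL.Sat, key z hz, MTL.sat_exOne_chi hss hd.scope_right hsβ.symm hc,
      MTL.sat_exOne_chi hss hd.scope_left hsα.symm hc, Kripke.cond_sel_of_disjoint hsα,
      Kripke.cond_sel_of_disjoint hsβ, Set.mem_sdiff, and_assoc]
  constructor
  · rintro ⟨z, hz, h⟩
    exact ⟨_, (key' z hz).1 h⟩
  · rintro ⟨τ, hτ, h⟩
    obtain ⟨v, -, rfl⟩ := hτ.1
    -- The top stair has offset 0, so it contains a world of the deciding type.
    obtain ⟨z, hz, he⟩ := hT k le_rfl _ (typeOf_mem K v)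
    rw [Nat.sub_self, Function.iterate_zero, id, typesOf_singleton, Set.singleton_eq_singleton_iff]
      at he
    rw [← he] at hτ h
    exact ⟨z, hz, (key' z hz).2 ⟨hτ, h⟩⟩

theorem StairsBelow.disjointScopes {X : Set PSym} {s : ℕ → ML}
    (h : StairsBelow K X (k + 1) s α β T) : DisjointScopes K X k s α β where
  scope_left := h.scope_left
  scope_right := h.scope_right
  scope_stair i hi := h.scope_stair i (Nat.lt_succ_of_le hi)
  disj := h.disj
  disj_left i hi := h.disj_left i (Nat.lt_succ_of_le hi)
  disj_right i hi := h.disj_right i (Nat.lt_succ_of_le hi)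
  disj_stair i hi j hj := h.disj_stair i (Nat.lt_succ_of_le hi) j (Nat.lt_succ_of_le hj)

/-- Passing to successors lowers the offset of stair i from k+1-i to k-i, which is what a
k-staircase demands of it. -/
theorem StairsBelow.isStaircase_img {X : Set PSym} {s : ℕ → ML}
    (h : StairsBelow K X (k + 1) s α β T) : IsStaircase K X s k (K.img T) := by
  intro i hi
  rw [Kripke.cond_img (h.scope_stair i (Nat.lt_succ_of_le hi))]
  have := h.canonical i (Nat.lt_succ_of_le hi)
  rw [Nat.succ_sub hi] at this
  exact this.img

theorem typeProps_typeOf_eq_iff {i j : ℕ} {w v : W} :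
    typeProps Φ (typeOf K (symSet Φ) i w) = typeProps Φ (typeOf K (symSet Φ) j v) ↔
      ∀ p ∈ symSet Φ, (w ∈ K.V p ↔ v ∈ K.V p) := by
  simp only [typeProps_typeOf, Set.ext_iff, Set.mem_ofPred_eq, and_congr_right_iff]

/-- In RT the two scopes hold Rw and Rv, and by `typeImg_typeOf` their sets of types are ℛ[w] and
ℛ[v]. The scopes and the team vary in the induction because the recursive call concerns the pair
s_k, α∨β. -/
theorem MTL.sat_zeta {s : ℕ → ML} {w v : W} (h : StairsBelow K (symSet Φ) k s α β T)
    (hα : K.cond T α = {w}) (hβ : K.cond T β = {v}) :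
    MTL.Sat K T (zeta Φ s k α β) ↔
      TypeLT.{u} Φ k (typeOf K (symSet Φ) k w) (typeOf K (symSet Φ) k v) := by
  induction k generalizing α β T w v with
  | zero => rw [zeta, TypeLT, MTL.sat_zetaZero hα hβ]
  | succ k ih =>
    have := MTL.sat_zetaStarOf h.disjointScopes h.isStaircase_img
      fun U w v hU hw hv => ih hU hw hv
    rw [zetaStar, Kripke.cond_img h.scope_left, Kripke.cond_img h.scope_right, hα, hβ] at this
    rw [zeta, TypeLT, MTL.sat_ovee, MTL.sat_zetaZero hα hβ (k + 1) (k + 1), MTL.Sat,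
      MTL.sat_chiZero hα hβ, MTL.Sat, this, typeProps_typeOf_eq_iff,
      typeImg_typeOf (symSet_finite Φ), typeImg_typeOf (symSet_finite Φ), TypeSetLT]

theorem DisjointScopes.stairsBelow {s : ℕ → ML} {X : Set PSym}
    (h : DisjointScopes K X k s α β) (hT : IsStaircase K X s k T) (S S' : Set W) :
    StairsBelow K X k s α β (K.sel (K.sel T α S) β S') where
  scope_left := h.scope_left
  scope_right := h.scope_right
  scope_stair i hi := h.scope_stair i hi.le
  disj := h.disj
  disj_left i hi := h.disj_left i hi.le
  disj_right i hi := h.disj_right i hi.le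
  disj_stair i hi j hj := h.disj_stair i hi.le j hj.le
  canonical i hi := by
    rw [Kripke.cond_sel_of_disjoint (h.disj_right i hi.le),
      Kripke.cond_sel_of_disjoint (h.disj_left i hi.le)]
    exact hT i hi.le

theorem MTL.sat_zeta_sel {s : ℕ → ML} (h : DisjointScopes K (symSet Φ) k s α β)
    (hT : IsStaircase K (symSet Φ) s k T) {w v : W} (hw : w ∈ K.cond T α) (hv : v ∈ K.cond T β) :
    MTL.Sat K (K.sel (K.sel T α {w}) β {v}) (zeta Φ s k α β) ↔
      TypeLT.{u} Φ k (typeOf K (symSet Φ) k w) (typeOf K (symSet Φ) k v) := by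
  refine MTL.sat_zeta (h.stairsBelow hT _ _) ?_ ?_
  · rw [Kripke.cond_sel_of_disjoint h.disj.symm, Kripke.cond_sel_singleton hw]
  · exact Kripke.cond_sel_singleton (by rwa [Kripke.cond_sel_of_disjoint h.disj])

theorem MTL.sat_zetaStar {s : ℕ → ML} (h : DisjointScopes K (symSet Φ) k s α β)
    (hT : IsStaircase K (symSet Φ) s k T) :
    MTL.Sat K T (zetaStar Φ s k α β) ↔ TypeSetLT.{u} Φ k
      (typesOf K (symSet Φ) k (K.cond T α)) (typesOf K (symSet Φ) k (K.cond T β)) :=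
  MTL.sat_zetaStarOf h hT fun _ _ _ hU hw hv => MTL.sat_zeta hU hw hv

end Correctness

/-! ### Modal depth -/

section Depth

variable {Φ : List PSym} {α β : ML}

theorem MTL.md_bigAnd_le {l : List MTL} {n : ℕ} (h : ∀ f ∈ l, f.md ≤ n) : (MTL.bigAnd l).md ≤ n := by
  induction l with
  | nil => simp [MTL.bigAnd, MTL.md, ML.md]
  | cons f l ih =>
    simp only [List.forall_mem_cons] at h
    exact max_le h.1 (ih h.2)

theorem MTL.md_bigOvee_le {l : List MTL} {n : ℕ} (h : ∀ f ∈ l, f.md ≤ n) :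
    (MTL.bigOvee l).md ≤ n := by
  induction l with
  | nil => simp [MTL.bigOvee, MTL.md, ML.md]
  | cons f l ih =>
    simp only [List.forall_mem_cons] at h
    exact max_le h.1 (ih h.2)

theorem md_chiZero (hα : α.md = 0) (hβ : β.md = 0) : (chiZero Φ α β).md = 0 := by
  have : (MTL.bigAnd (Φ.map .dep)).md ≤ 0 := MTL.md_bigAnd_le (by simp [MTL.dep, MTL.ovee, MTL.md, ML.md])
  simp [chiZero, MTL.hook, MTL.md, ML.md, hα, hβ, Nat.le_zero.1 this]

theorem md_exOne {f : MTL} (hα : α.md = 0) : (MTL.exOne α f).md = f.md := by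
  simp [MTL.exOne, MTL.exSub, MTL.allSub, MTL.imp, MTL.ovee, MTL.E, MTL.md, ML.md, hα]

theorem md_chiStarOf {c : MTL} (hα : α.md = 0) (hβ : β.md = 0) :
    (chiStarOf c α β).md = c.md := by
  simp [chiStarOf, MTL.ovee, MTL.E, MTL.md, ML.md, md_exOne, hα, hβ]

theorem md_chi (hα : α.md = 0) (hβ : β.md = 0) (k : ℕ) : (chi Φ k α β).md = k := by
  induction k with
  | zero => exact md_chiZero hα hβ
  | succ k ih => simp [chi, MTL.md, md_chiZero hα hβ, md_chiStarOf hα hβ, ih]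

theorem md_zetaZero (hα : α.md = 0) (hβ : β.md = 0) : (zetaZero Φ α β).md = 0 := by
  refine Nat.le_zero.1 (MTL.md_bigOvee_le ?_)
  simp only [List.forall_mem_map]
  intro p _
  refine max_le (by simp [MTL.hook, MTL.md, ML.md, hα])
    (max_le (by simp [MTL.hook, MTL.md, ML.md, hβ]) (MTL.md_bigAnd_le ?_))
  simp only [List.forall_mem_map]
  intro q _
  simp [MTL.hook, MTL.dep, MTL.ovee, MTL.md, ML.md, hα, hβ]

/-- Scopes and quantifiers contribute depth 0, so only the χ_k inside and the recursive call `z`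
count. -/
theorem md_zetaStarOf {s : ML} {z : MTL} {k : ℕ} (hs : s.md = 0) (hα : α.md = 0) (hβ : β.md = 0) :
    (zetaStarOf Φ k s z α β).md = max k z.md := by
  simp [zetaStarOf, chiStar, MTL.allOne, MTL.md, ML.md, md_exOne, md_chiStarOf, md_chi, hs, hα, hβ]

theorem md_zeta {s : ℕ → ML} {k : ℕ} (hs : ∀ i ≤ k, (s i).md = 0) (hα : α.md = 0)
    (hβ : β.md = 0) : (zeta Φ s k α β).md = k := by
  induction k generalizing α β with
  | zero => exact md_zetaZero hα hβ
  | succ k ih =>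
    have hk := hs k k.le_succ
    have hor : (ML.or α β).md = 0 := by simp [ML.md, hα, hβ]
    simp [zeta, MTL.ovee, MTL.md, md_zetaZero, md_chiZero, md_zetaStarOf, hα, hβ, hk,
      ih (fun i hi => hs i (hi.trans k.le_succ)) hk hor]

theorem md_zetaStar {s : ℕ → ML} {k : ℕ} (hs : ∀ i ≤ k, (s i).md = 0) (hα : α.md = 0)
    (hβ : β.md = 0) : (zetaStar Φ s k α β).md = k := by
  have hor : (ML.or α β).md = 0 := by simp [ML.md, hα, hβ]
  rw [zetaStar, md_zetaStarOf (hs k le_rfl) hα hβ, md_zeta hs (hs k le_rfl) hor, max_self]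

end Depth

/-! ### Machines with registers

The machines below keep finitely many natural numbers, indexed by `ι`, in binary on a single work
tape: cell `0` holds a left end marker, and cell `j + 1` holds the `j`-th bits of all registers. -/

/-- Work tape cells: `none` is the left end marker; in `some (m, c)`, the flag `m` tells whether the
cell is in use, and `c` is the column of bits. -/
abbrev Cell (ι : Type) := Option (Bool × (ι → Bool))

/-- A machine component that exits with a value in `E`. -/
structure Mach (ι E : Type) where
  State : Type
  finState : Finite State
  start : State
  trans : State → InCell Sym → Cell ι → (State × Move × (Cell ι × Move) × Option Sym) ⊕ E

/-- A configuration without the state. -/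
structure Data (ι : Type) where
  inPos : ℕ
  tape : ℕ → Cell ι
  head : ℕ
  out : List Sym

section Machines

variable {ι E F : Type} {x : List Sym} {B : ℕ}

def Data.act (x : List Sym) (d : Data ι) (a : Move × (Cell ι × Move) × Option Sym) : Data ι where
  inPos := min (Transducer.moveHead a.1 d.inPos) (x.length + 1)
  tape := Function.update d.tape d.head a.2.1.1
  head := Transducer.moveHead a.2.1.2 d.head
  out := d.out ++ a.2.2.toList

/-- `Run M x B s d e d'`: started in state `s` with data `d` on input `x`, the machine exits with
value `e` and data `d'`, and the work head stays below `B`. -/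
inductive Run (M : Mach ι E) (x : List Sym) (B : ℕ) : M.State → Data ι → E → Data ι → Prop
  | halt {s d e} (h : M.trans s (Transducer.readInput x d.inPos) (d.tape d.head) = .inr e)
      (hB : d.head < B) : Run M x B s d e d
  | step {s d s' a e d'}
      (h : M.trans s (Transducer.readInput x d.inPos) (d.tape d.head) = .inl (s', a))
      (hB : d.head < B) (hr : Run M x B s' (d.act x a) e d') : Run M x B s d e d'

theorem Run.inPos_le {M : Mach ι E} {s : M.State} {d d' : Data ι} {e : E}
    (h : Run M x B s d e d') (hd : d.inPos ≤ x.length + 1) : d'.inPos ≤ x.length + 1 := by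
  induction h with
  | halt => exact hd
  | step _ _ _ ih => exact ih (min_le_right _ _)

/-- The action that changes nothing. -/
def idle (c : Cell ι) : Move × (Cell ι × Move) × Option Sym := (.stay, (c, .stay), none)

/-- Input positions are clamped to the right end marker in each step, so idling is neutral only
within that bound. This is the source of the position hypotheses in the composition rules. -/
theorem Data.act_idle {d : Data ι} (hd : d.inPos ≤ x.length + 1) :
    d.act x (idle (d.tape d.head)) = d := by
  cases d
  simpa [Data.act, idle, Transducer.moveHead] using hd

/-- Sequential composition. -/
def Mach.bind [Finite E] (M : Mach ι E) (f : E → Mach ι F) : Mach ι F where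
  State := M.State ⊕ Σ e, (f e).State
  finState := by
    have := M.finState
    have := fun e => (f e).finState
    infer_instance
  start := .inl M.start
  trans
    | .inl s, i, c => match M.trans s i c with
      | .inl (s', a) => .inl (.inl s', a)
      | .inr e => .inl (.inr ⟨e, (f e).start⟩, idle c)
    | .inr ⟨e, s⟩, i, c => match (f e).trans s i c with
      | .inl (s', a) => .inl (.inr ⟨e, s'⟩, a)
      | .inr e' => .inr e'

theorem Run.bind_right [Finite E] {M : Mach ι E} {f : E → Mach ι F} {e : E} {s : (f e).State}
    {d d' : Data ι} {e' : F} (h : Run (f e) x B s d e' d') :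
    Run (M.bind f) x B (.inr ⟨e, s⟩) d e' d' := by
  induction h with
  | halt h hB => exact .halt (by simp only [Mach.bind, h]) hB
  | step h hB _ ih => exact .step (by simp only [Mach.bind, h]) hB ih

theorem Run.bind [Finite E] {M : Mach ι E} {f : E → Mach ι F} {s : M.State} {e : E}
    {d d' d'' : Data ι} {e' : F} (h : Run M x B s d e d') (hd : d.inPos ≤ x.length + 1)
    (h' : Run (f e) x B (f e).start d' e' d'') : Run (M.bind f) x B (.inl s) d e' d'' := by
  induction h with
  | halt h hB =>
    refine .step (s' := Sum.inr ⟨_, (f _).start⟩) (a := idle _) (by simp only [Mach.bind, h]; rfl) hB ?_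
    rw [Data.act_idle hd]
    exact h'.bind_right
  | step h hB _ ih =>
    exact .step (by simp only [Mach.bind, h]) hB (ih (min_le_right _ _) h')

/-- Repetition until the exit value is `false`. -/
def Mach.loop (M : Mach ι Bool) : Mach ι Unit where
  State := M.State
  finState := M.finState
  start := M.start
  trans s i c := match M.trans s i c with
    | .inl a => .inl a
    | .inr true => .inl (M.start, idle c)
    | .inr false => .inr ()

theorem Run.loop_false {M : Mach ι Bool} {s : M.State} {d d' : Data ι}
    (h : Run M x B s d false d') : Run M.loop x B s d () d' := by
  generalize he : false = e at h
  induction h with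
  | halt h hB =>
    subst he
    exact .halt (by simp [Mach.loop, h]) hB
  | step h hB _ ih =>
    refine .step ?_ hB (ih he)
    simp only [Mach.loop, h]

theorem Run.loop_true {M : Mach ι Bool} {s : M.State} {d d' d'' : Data ι}
    (h : Run M x B s d true d') (hd : d.inPos ≤ x.length + 1)
    (h' : Run M.loop x B M.start d' () d'') : Run M.loop x B s d () d'' := by
  generalize he : true = e at h
  induction h with
  | @halt s d e h hB =>
    subst he
    refine .step (M := M.loop) (s' := M.start) (a := idle (d.tape d.head)) ?_ hB ?_
    · simp only [Mach.loop, h]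
    · rwa [Data.act_idle hd]
  | step h hB _ ih =>
    refine .step ?_ hB (ih (min_le_right _ _) h' he)
    simp only [Mach.loop, h]

/-- The work tape with the registers `r` of bit width `L`. -/
def tapeOf (L : ℕ) (r : ι → ℕ) : ℕ → Cell ι
  | 0 => none
  | j + 1 => some (decide (j < L), fun i => (r i).testBit j)

/-- `Exec M x B i r e w i' r'`: from input position `i` and registers `r`, the machine outputs `w`
and exits with value `e` at input position `i'` with registers `r'`, using bit widths up to `B`. -/
def Exec (M : Mach ι E) (x : List Sym) (B i : ℕ) (r : ι → ℕ) (e : E) (w : List Sym) (i' : ℕ)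
    (r' : ι → ℕ) : Prop :=
  i ≤ x.length + 1 → ∀ L ≤ B, (∀ j, r j < 2 ^ L) → ∀ out, ∃ L' ≤ B, (∀ j, r' j < 2 ^ L') ∧
    Run M x (B + 2) M.start ⟨i, tapeOf L r, 0, out⟩ e ⟨i', tapeOf L' r', 0, out ++ w⟩

variable {i i' i'' : ℕ} {r r' r'' : ι → ℕ} {w w' : List Sym}

theorem Exec.bind [Finite E] {M : Mach ι E} {f : E → Mach ι F} {e : E} {e' : F}
    (h : Exec M x B i r e w i' r') (h' : Exec (f e) x B i' r' e' w' i'' r'') :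
    Exec (M.bind f) x B i r e' (w ++ w') i'' r'' := by
  intro hi L hL hr out
  obtain ⟨L', hL', hr', hrun⟩ := h hi L hL hr out
  obtain ⟨L'', hL'', hr'', hrun'⟩ := h' (hrun.inPos_le hi) L' hL' hr' (out ++ w)
  rw [← List.append_assoc]
  exact ⟨L'', hL'', hr'', hrun.bind hi hrun'⟩

theorem Exec.loop_false {M : Mach ι Bool} (h : Exec M x B i r false w i' r') :
    Exec M.loop x B i r () w i' r' := by
  intro hi L hL hr out
  obtain ⟨L', hL', hr', hrun⟩ := h hi L hL hr out
  exact ⟨L', hL', hr', hrun.loop_false⟩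

theorem Exec.loop_true {M : Mach ι Bool} (h : Exec M x B i r true w i' r')
    (h' : Exec M.loop x B i' r' () w' i'' r'') : Exec M.loop x B i r () (w ++ w') i'' r'' := by
  intro hi L hL hr out
  obtain ⟨L', hL', hr', hrun⟩ := h hi L hL hr out
  obtain ⟨L'', hL'', hr'', hrun'⟩ := h' (hrun.inPos_le hi) L' hL' hr' (out ++ w)
  rw [← List.append_assoc]
  exact ⟨L'', hL'', hr'', hrun.loop_true hi hrun'⟩

/-- One step that depends on the scanned input cell. -/
def Mach.prim [Finite E] (f : InCell Sym → Move × Option Sym × E) : Mach ι E where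
  State := Option E
  finState := inferInstance
  start := none
  trans
    | none, i, c => .inl (some (f i).2.2, (f i).1, (c, .stay), (f i).2.1)
    | some e, _, _ => .inr e

theorem Exec.prim [Finite E] (f : InCell Sym → Move × Option Sym × E) {c : InCell Sym}
    (hc : Transducer.readInput x i = c) : Exec (Mach.prim f) x B i r (f c).2.2
      (f c).2.1.toList (min (Transducer.moveHead (f c).1 i) (x.length + 1)) r := by
  subst hc
  intro hi L hL hr out
  refine ⟨L, hL, hr, .step rfl (by simp) ?_⟩
  simp only [Data.act, Function.update_eq_self]
  exact .halt (M := Mach.prim f) (s := some (f _).2.2) rfl (by simp [Transducer.moveHead])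

/-! ### Passes over the work tape -/

/-- A pass to the right end of the used part of the work tape, possibly with an extension by one
cell, and back. -/
def Mach.pass {Q : Type} [Finite Q] (q₀ : Q) (δ γ : Q → (ι → Bool) → Q × (ι → Bool))
    (ext : Q → Option (ι → Bool)) (fin : Q → E) : Mach ι E where
  State := Q × Bool
  finState := inferInstance
  start := (q₀, false)
  trans
    | (q, false), _, none => .inl ((q, false), .stay, (none, .right), none)
    | (q, false), _, some (true, c) =>
        .inl (((δ q c).1, false), .stay, (some (true, (δ q c).2), .right), none)
    | (q, false), _, some (false, c) => .inl ((q, true), .stay,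
        (match ext q with | some c' => some (true, c') | none => some (false, c), .left), none)
    | (q, true), _, none => .inr (fin q)
    | (q, true), _, some (m, c) =>
        .inl (((γ q c).1, true), .stay, (some (m, (γ q c).2), .left), none)

/-- The tape that agrees with `t` up to cell `j` and with `t'` beyond. -/
def mixTape (t t' : ℕ → Cell ι) (j m : ℕ) : Cell ι := if m ≤ j then t m else t' m

theorem mixTape_update (t t' : ℕ → Cell ι) (j : ℕ) :
    Function.update (mixTape t t' j) (j + 1) (t (j + 1)) = mixTape t t' (j + 1) := by
  funext m
  rcases lt_trichotomy m (j + 1) with h | rfl | h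
  · rw [Function.update_of_ne h.ne, mixTape, mixTape, if_pos (by omega), if_pos (by omega)]
  · simp [mixTape]
  · rw [Function.update_of_ne h.ne', mixTape, mixTape, if_neg (by omega), if_neg (by omega)]

theorem mixTape_update' (t t' : ℕ → Cell ι) (j : ℕ) :
    Function.update (mixTape t t' (j + 1)) (j + 1) (t' (j + 1)) = mixTape t t' j := by
  funext m
  rcases lt_trichotomy m (j + 1) with h | rfl | h
  · rw [Function.update_of_ne h.ne, mixTape, mixTape, if_pos (by omega), if_pos (by omega)]
  · simp [mixTape]
  · rw [Function.update_of_ne h.ne', mixTape, mixTape, if_neg (by omega), if_neg (by omega)]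

section Pass

variable {Q : Type} [Finite Q] {q₀ : Q} {δ γ : Q → (ι → Bool) → Q × (ι → Bool)}
  {ext : Q → Option (ι → Bool)} {fin : Q → E} {t t' : ℕ → Cell ι} {out : List Sym} {L : ℕ}

/-- Stated in continuation form: a run from the configuration in which the first j columns are
rewritten extends backwards to one from the left end. The state on arrival at column j is `qs j`. -/
theorem Run.pass_forward {e : E} {d : Data ι} (hi : i ≤ x.length + 1) (qs : ℕ → Q) (hq : qs 0 = q₀)
    (h₀ : t 0 = none) (h₀' : t' 0 = none)
    (h : ∀ j < L, ∃ c c', t (j + 1) = some (true, c) ∧ t' (j + 1) = some (true, c') ∧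
      δ (qs j) c = (qs (j + 1), c'))
    (hB : L < B) {j : ℕ} (hj : j ≤ L)
    (hr : Run (Mach.pass q₀ δ γ ext fin) x B (qs j, false) ⟨i, mixTape t' t j, j + 1, out⟩ e d) :
    Run (Mach.pass q₀ δ γ ext fin) x B (q₀, false) ⟨i, t, 0, out⟩ e d := by
  induction j with
  | zero =>
    refine .step (s' := (q₀, false)) (a := (.stay, (none, .right), none))
      (by simp [Mach.pass, h₀]) (by simp; omega) ?_
    rw [hq] at hr
    convert hr using 1
    · simp only [Data.act, Transducer.moveHead, Option.toList, List.append_nil, Data.mk.injEq,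
        and_true, zero_add, min_eq_left hi, true_and]
      funext m
      rcases m with _ | m <;> simp [mixTape, h₀']
  | succ j ih =>
    obtain ⟨c, c', hc, hc', hδ⟩ := h j (by omega)
    refine ih (by omega) (.step (s' := (qs (j + 1), false))
      (a := (.stay, (some (true, c'), .right), none)) ?_ (by simp; omega) ?_)
    · simp [Mach.pass, mixTape, hc, hδ]
    · convert hr using 1
      simp only [Data.act, Transducer.moveHead, Option.toList, List.append_nil, Data.mk.injEq,
        and_true, min_eq_left hi, true_and]
      rw [← hc', mixTape_update]

/-- On the way back, the cells up to the head still agree with `t`, and those to its right already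
with `t'`. -/
theorem Run.pass_backward (hi : i ≤ x.length + 1) (ps : ℕ → Q)
    (h₀ : t 0 = none) (h₀' : t' 0 = none)
    (h : ∀ j < L, ∃ m c c', t (j + 1) = some (m, c) ∧ t' (j + 1) = some (m, c') ∧
      γ (ps (j + 1)) c = (ps j, c'))
    (hB : L < B) {j : ℕ} (hj : j ≤ L) :
    Run (Mach.pass q₀ δ γ ext fin) x B (ps j, true) ⟨i, mixTape t t' j, j, out⟩ (fin (ps 0))
      ⟨i, t', 0, out⟩ := by
  induction j with
  | zero =>
    have : mixTape t t' 0 = t' := by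
      funext m
      rcases m with _ | m <;> simp [mixTape, h₀, h₀']
    rw [this]
    exact .halt (by simp [Mach.pass, h₀']) (by simp; omega)
  | succ j ih =>
    obtain ⟨m, c, c', hc, hc', hγ⟩ := h j (by omega)
    refine .step (s' := (ps j, true)) (a := (.stay, (some (m, c'), .left), none)) ?_
      (by simp; omega) ?_
    · simp [Mach.pass, mixTape, hc, hγ]
    · convert ih (by omega) using 1
      simp only [Data.act, Transducer.moveHead, Option.toList, List.append_nil, Data.mk.injEq,
        and_true, min_eq_left hi, true_and, Nat.add_sub_cancel]
      rw [← hc', mixTape_update']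

/-- The column of the `j`-th bits. -/
def col (r : ι → ℕ) (j : ℕ) (i : ι) : Bool := (r i).testBit j

theorem tapeOf_succ (j : ℕ) : tapeOf L r (j + 1) = some (decide (j < L), col r j) := rfl

theorem col_eq_false (hr : ∀ a, r a < 2 ^ L) {j : ℕ} (hj : L ≤ j) : col r j = fun _ => false := by
  funext a
  exact Nat.testBit_lt_two_pow ((hr a).trans_le (Nat.pow_le_pow_right two_pos hj))

/-- Reduces a pass to recurrences on columns: `qs` and `ps` are the states on the way out and back,
`r₁` holds the registers at the turn, and `L₁` is the new width. Column L is not visited on the way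
back, hence the last condition. The head reaches cell L+1 ≤ B+1, which explains the bound B+2 in
`Exec`. -/
theorem Exec.pass {r₁ r₂ : ι → ℕ} {e : E}
    (h : ∀ L ≤ B, (∀ a, r a < 2 ^ L) → ∃ (L₁ : ℕ) (qs ps : ℕ → Q), L₁ ≤ B ∧
      (∀ a, r₁ a < 2 ^ L₁) ∧ (∀ a, r₂ a < 2 ^ L₁) ∧ qs 0 = q₀ ∧ ps L = qs L ∧ fin (ps 0) = e ∧
      (∀ j < L, δ (qs j) (col r j) = (qs (j + 1), col r₁ j)) ∧
      (ext (qs L) = none ∧ L₁ = L ∨ ext (qs L) = some (col r₁ L) ∧ L₁ = L + 1) ∧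
      (∀ j < L, γ (ps (j + 1)) (col r₁ j) = (ps j, col r₂ j)) ∧
      col r₁ L = col r₂ L) :
    Exec (Mach.pass q₀ δ γ ext fin) x B i r e [] i r₂ := by
  intro hi L hL hr out
  obtain ⟨L₁, qs, ps, hL₁, hr₁, hr₂, hq, hpq, hp, hδ, hext, hγ, hlast⟩ := h L hL hr
  refine ⟨L₁, hL₁, hr₂, ?_⟩
  have hle : L ≤ L₁ := by omega
  refine Run.pass_forward (t' := tapeOf L₁ r₁) hi qs hq rfl rfl (L := L) (fun j hj => ?_) (by omega)
    le_rfl ?_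
  · refine ⟨_, _, ?_, ?_, hδ j hj⟩
    · rw [tapeOf_succ, decide_eq_true hj]
    · rw [tapeOf_succ, decide_eq_true (hj.trans_le hle)]
  -- The head turns at cell L+1, the first unused one, which becomes a used column if `ext` supplies
  -- one.
  refine .step (s' := (qs L, true)) (a := (.stay, (tapeOf L₁ r₁ (L + 1), .left), none)) ?_ (by simp; omega) ?_
  · have hm : mixTape (tapeOf L₁ r₁) (tapeOf L r) L (L + 1) = some (false, col r L) := by
      simp [mixTape, tapeOf_succ]
    simp only [Mach.pass, hm, tapeOf_succ]
    rcases hext with ⟨he, rfl⟩ | ⟨he, rfl⟩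
    · simp [he, col_eq_false hr le_rfl, col_eq_false hr₁ le_rfl]
    · simp [he]
  · have := Run.pass_backward (q₀ := q₀) (δ := δ) (γ := γ) (ext := ext) (fin := fin) (x := x) (B := B + 2)
      (t := tapeOf L₁ r₁) (t' := tapeOf L₁ r₂) (out := out) hi ps rfl rfl (L := L)
      (fun j hj => ⟨_, _, _, tapeOf_succ j, tapeOf_succ j, hγ j hj⟩) (by omega) le_rfl
    rw [hp, hpq] at this
    convert this using 1
    · simp only [Data.act, Transducer.moveHead, Option.toList, List.append_nil, Data.mk.injEq,
        and_true, min_eq_left hi, true_and, Nat.add_sub_cancel]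
      rw [mixTape_update]
      funext m
      rcases m with _ | m
      · simp [mixTape]
      rcases lt_trichotomy m L with hm | rfl | hm
      · simp [mixTape, hm.le, hm]
      · simp [mixTape, tapeOf_succ, hlast]
      · have h1 : ¬ m < L := by omega
        have h2 : ¬ m < L₁ := by omega
        have h3 : ¬ m ≤ L := by omega
        have h4 : L₁ ≤ m := by omega
        simp [mixTape, h1, h2, h3, tapeOf_succ, col_eq_false hr hm.le, col_eq_false hr₂ h4]
    · simp

end Pass

end Machines

/-! ### Binary arithmetic -/

/-- The carry reaches position j exactly if all lower bits are 1. -/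
theorem testBit_add_one (n j : ℕ) :
    (n + 1).testBit j = (n.testBit j ^^ decide (∀ m < j, n.testBit m = true)) := by
  induction j generalizing n with
  | zero =>
    simp only [Nat.testBit_zero, Nat.not_lt_zero, false_imp_iff, implies_true, decide_true,
      Bool.xor_true]
    rcases Nat.mod_two_eq_zero_or_one n with h | h <;> simp [h, Nat.add_mod]
  | succ j ih =>
    rw [Nat.testBit_succ, Nat.testBit_succ]
    rcases Nat.mod_two_eq_zero_or_one n with h | h
    · have h₁ : (n + 1) / 2 = n / 2 := by omega
      have h₂ : ¬ ∀ m < j + 1, n.testBit m = true := fun hm => by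
        have := hm 0 j.succ_pos
        simp [Nat.testBit_zero, h] at this
      simp only [h₁, h₂, decide_false, Bool.xor_false]
    · have h₁ : (n + 1) / 2 = n / 2 + 1 := by omega
      have h₂ : (∀ m < j + 1, n.testBit m = true) ↔ ∀ m < j, (n / 2).testBit m = true := by
        simp only [← Nat.testBit_succ]
        refine ⟨fun hm m h => hm _ (by omega), fun hm m h => ?_⟩
        rcases m with _ | m
        · simp [Nat.testBit_zero, *]
        · exact hm m (by omega)
      rw [h₁, ih]
      simp only [h₂]

/-- The borrow reaches position j exactly if all lower bits are 0. -/
theorem testBit_pred (n j : ℕ) (hn : n ≠ 0) :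
    (n - 1).testBit j = (n.testBit j ^^ decide (∀ m < j, n.testBit m = false)) := by
  induction j generalizing n with
  | zero =>
    simp only [Nat.testBit_zero, Nat.not_lt_zero, false_imp_iff, implies_true, decide_true,
      Bool.xor_true]
    rcases Nat.mod_two_eq_zero_or_one n with h | h
    · have : (n - 1) % 2 = 1 := by omega
      simp [h, this]
    · have : (n - 1) % 2 = 0 := by omega
      simp [h, this]
  | succ j ih =>
    rw [Nat.testBit_succ, Nat.testBit_succ]
    rcases Nat.mod_two_eq_zero_or_one n with h | h
    · have h₁ : (n - 1) / 2 = n / 2 - 1 := by omega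
      have h₂ : (∀ m < j + 1, n.testBit m = false) ↔ ∀ m < j, (n / 2).testBit m = false := by
        simp only [← Nat.testBit_succ]
        refine ⟨fun hm m h => hm _ (by omega), fun hm m h => ?_⟩
        rcases m with _ | m
        · simp [Nat.testBit_zero, *]
        · exact hm m (by omega)
      rw [h₁, ih _ (by omega)]
      simp only [h₂]
    · have h₁ : (n - 1) / 2 = n / 2 := by omega
      have h₂ : ¬ ∀ m < j + 1, n.testBit m = false := fun hm => by
        have := hm 0 j.succ_pos
        simp [Nat.testBit_zero, h] at this
      simp only [h₁, h₂, decide_false, Bool.xor_false]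

theorem forall_lt_succ_decide (p : ℕ → Prop) [DecidablePred p] (j : ℕ) :
    decide (∀ m < j + 1, p m) = (decide (∀ m < j, p m) && decide (p j)) := by
  rw [← Bool.decide_and, decide_eq_decide]
  exact Nat.forall_lt_succ_right

/-! ### Register instructions -/

section Registers

variable {ι : Type} {x : List Sym} {B i : ℕ} {r : ι → ℕ}

/-- `a = b` -/
def Mach.eq (a b : ι) : Mach ι Bool :=
  Mach.pass true (fun q c => (q && (c a == c b), c)) Prod.mk (fun _ => none) id

theorem Exec.eq (a b : ι) : Exec (Mach.eq a b) x B i r (decide (r a = r b)) [] i r := by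
  refine Exec.pass (r₁ := r) fun L hL hr => ?_
  have he : (∀ m < L, (r a).testBit m = (r b).testBit m) ↔ r a = r b := by
    refine ⟨fun h => Nat.eq_of_testBit_eq fun m => ?_, fun h => by simp [h]⟩
    by_cases hm : m < L
    · exact h m hm
    · have hp := Nat.pow_le_pow_right two_pos (not_lt.1 hm)
      rw [Nat.testBit_lt_two_pow ((hr a).trans_le hp), Nat.testBit_lt_two_pow ((hr b).trans_le hp)]
  refine ⟨L, fun j => decide (∀ m < j, (r a).testBit m = (r b).testBit m),
    fun _ => decide (∀ m < L, (r a).testBit m = (r b).testBit m), hL, hr, hr, by simp, rfl,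
    by simp only [he, id], fun j _ => ?_, .inl ⟨rfl, rfl⟩, fun _ _ => rfl, rfl⟩
  simp only [forall_lt_succ_decide]
  rfl

variable [DecidableEq ι]

theorem col_update (r : ι → ℕ) (a : ι) (n j : ℕ) :
    col (Function.update r a n) j = Function.update (col r j) a (n.testBit j) := by
  funext b
  by_cases h : b = a
  · subst h; simp [col]
  · simp [col, h]

theorem update_lt {L n : ℕ} (hr : ∀ a, r a < L) (hn : n < L) (a : ι) :
    ∀ b, Function.update r a n b < L := by
  intro b
  by_cases h : b = a
  · subst h; simpa using hn
  · simpa [h] using hr b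

/-- `a := a + 1` -/
def Mach.inc (a : ι) : Mach ι Unit :=
  Mach.pass true (fun q c => (q && c a, Function.update c a (c a ^^ q))) Prod.mk
    (fun q => if q then some (Function.update (fun _ => false) a true) else none) fun _ => ()

/-- `a := a - 1` -/
def Mach.dec (a : ι) : Mach ι Unit :=
  Mach.pass true (fun q c => (q && !c a, Function.update c a (c a ^^ q))) Prod.mk
    (fun _ => none) fun _ => ()

/-- `a := b` -/
def Mach.copy (a b : ι) : Mach ι Unit :=
  Mach.pass () (fun q c => (q, Function.update c a (c b))) Prod.mk (fun _ => none) id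

/-- `a := a / 2`, with the remainder as exit value -/
def Mach.half (a : ι) : Mach ι Bool :=
  Mach.pass false Prod.mk (fun q c => (c a, Function.update c a q)) (fun _ => none) id

theorem Exec.inc (a : ι) (hB : r a + 1 < 2 ^ B) :
    Exec (Mach.inc a) x B i r () [] i (Function.update r a (r a + 1)) := by
  refine Exec.pass (r₁ := Function.update r a (r a + 1)) fun L hL hr => ?_
  have hbit := testBit_add_one (r a) L
  rw [Nat.testBit_lt_two_pow (hr a), Bool.false_xor] at hbit
  have hδ : ∀ j < L, (decide (∀ m < j, (r a).testBit m = true) && col r j a,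
      Function.update (col r j) a (col r j a ^^ decide (∀ m < j, (r a).testBit m = true))) =
      (decide (∀ m < j + 1, (r a).testBit m = true),
        col (Function.update r a (r a + 1)) j) := by
    intro j _
    rw [col_update, testBit_add_one, forall_lt_succ_decide, Bool.decide_eq_true]
    rfl
  -- If the carry leaves the top column, the tape is extended by one column. There is room, since L
  -- = B would contradict the bound on r a + 1.
  by_cases hc : ∀ m < L, (r a).testBit m = true
  · have hlt : L < B := by
      by_contra hn
      obtain rfl : L = B := by omega
      rw [Nat.testBit_lt_two_pow hB, decide_eq_true hc] at hbit
      exact Bool.false_ne_true hbit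
    have hr' := update_lt (fun b => (hr b).trans (Nat.pow_lt_pow_succ one_lt_two))
      (show r a + 1 < 2 ^ (L + 1) by have := hr a; rw [pow_succ]; omega) a
    refine ⟨L + 1, fun j => decide (∀ m < j, (r a).testBit m = true), fun _ => true, hlt, hr', hr',
      by simp, (decide_eq_true hc).symm, rfl, hδ, .inr ⟨?_, rfl⟩, fun _ _ => rfl, rfl⟩
    rw [col_update, hbit, col_eq_false hr le_rfl]
    simp only [decide_eq_true hc, if_true]
  · have hr' := update_lt hr (show r a + 1 < 2 ^ L by
      refine lt_of_le_of_ne (hr a) fun he => ?_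
      rw [he, Nat.testBit_two_pow_self] at hbit
      simp [hc] at hbit) a
    refine ⟨L, fun j => decide (∀ m < j, (r a).testBit m = true), fun _ => false, hL, hr', hr',
      by simp, (decide_eq_false hc).symm, rfl, hδ, .inl ⟨?_, rfl⟩, fun _ _ => rfl, rfl⟩
    simp only [decide_eq_false hc, Bool.false_eq_true, if_false]

theorem Exec.dec (a : ι) (ha : r a ≠ 0) :
    Exec (Mach.dec a) x B i r () [] i (Function.update r a (r a - 1)) := by
  refine Exec.pass (r₁ := Function.update r a (r a - 1)) fun L hL hr => ?_
  have hr' := update_lt hr ((Nat.sub_le _ 1).trans_lt (hr a)) a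
  refine ⟨L, fun j => decide (∀ m < j, (r a).testBit m = false),
    fun _ => decide (∀ m < L, (r a).testBit m = false), hL, hr', hr',
    by simp, rfl, rfl, fun j _ => ?_, .inl ⟨rfl, rfl⟩, fun _ _ => rfl, rfl⟩
  simp only [col_update, testBit_pred _ _ ha, forall_lt_succ_decide]
  simp [col]

theorem Exec.copy (a b : ι) :
    Exec (Mach.copy a b) x B i r () [] i (Function.update r a (r b)) := by
  refine Exec.pass (r₁ := Function.update r a (r b)) fun L hL hr => ?_
  have hr' := update_lt hr (hr b) a
  refine ⟨L, fun _ => (), fun _ => (), hL, hr', hr', rfl, rfl, rfl, fun j _ => ?_, .inl ⟨rfl, rfl⟩,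
    fun _ _ => rfl, rfl⟩
  rw [col_update]
  rfl

theorem Exec.half (a : ι) : Exec (Mach.half a) x B i r ((r a).testBit 0) [] i
    (Function.update r a (r a / 2)) := by
  refine Exec.pass (r₁ := r) fun L hL hr => ?_
  have hd : ∀ j, (r a / 2).testBit j = (r a).testBit (j + 1) := fun j => (Nat.testBit_succ _ _).symm
  -- The shift happens on the way back: the state carries bit j+1 into column j, and the state that
  -- remains in the end is bit 0.
  refine ⟨L, fun _ => false, (r a).testBit, hL, hr, update_lt hr ((Nat.div_le_self _ 2).trans_lt (hr a)) a,
    rfl, Nat.testBit_lt_two_pow (hr a), rfl, fun _ _ => rfl, .inl ⟨rfl, rfl⟩, fun j _ => ?_, ?_⟩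
  · rw [col_update, hd]
    rfl
  · rw [col_update, hd, Nat.testBit_lt_two_pow ((hr a).trans (Nat.pow_lt_pow_succ one_lt_two)),
      col_eq_false hr le_rfl]
    simp

end Registers

/-! ### Conversion to transducers -/

section Conversion

variable {ι : Type} [Finite ι] {x : List Sym} {B : ℕ}

/-- The blank is an unused column of zeros, so a fresh tape becomes the tape of zero registers with
width 0 once the end marker is written. -/
def Mach.toTransducer (M : Mach ι Unit) : Transducer Sym where
  tapes := 1
  State := M.State
  Work := Cell ι
  finState := M.finState
  finWork := inferInstance
  blank := some (false, fun _ => false)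
  start := M.start
  trans s i c := match M.trans s i (c 0) with
    | .inl (s', mv, wm, o) => some (s', mv, fun _ => wm, o)
    | .inr _ => none

def Mach.cfg (M : Mach ι Unit) (s : M.State) (d : Data ι) : M.toTransducer.Cfg where
  state := s
  inPos := d.inPos
  cells := fun _ => d.tape
  head := fun _ => d.head
  out := d.out

/-- Since steps are deterministic, every configuration that occurs lies on the given run, and the
head bound carries over. -/
theorem Run.transducer {M : Mach ι Unit} {s : M.State} {d d' : Data ι} {e : Unit}
    (h : Run M x B s d e d') :
    (∃ s', Relation.ReflTransGen (fun a b => M.toTransducer.step x a = some b) (M.cfg s d)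
      (M.cfg s' d') ∧ M.toTransducer.step x (M.cfg s' d') = none) ∧
    ∀ c, Relation.ReflTransGen (fun a b => M.toTransducer.step x a = some b) (M.cfg s d) c →
      ∀ i, c.head i < B := by
  induction h with
  | @halt s d e h hB =>
    have hs : M.toTransducer.step x (M.cfg s d) = none := by
      simp [Transducer.step, Mach.toTransducer, Mach.cfg, h]
    refine ⟨⟨s, .refl, hs⟩, fun c hc i => ?_⟩
    rcases hc.cases_head with rfl | ⟨c', hc', -⟩
    · exact hB
    · rw [hs] at hc'
      cases hc'
  | @step s d s' a e d' h hB _ ih =>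
    have hs : M.toTransducer.step x (M.cfg s d) = some (M.cfg s' (d.act x a)) := by
      simp only [Transducer.step, Mach.toTransducer, Mach.cfg, h]
      rfl
    obtain ⟨⟨s'', h₁, h₂⟩, h₃⟩ := ih
    refine ⟨⟨s'', .head hs h₁, h₂⟩, fun c hc i => ?_⟩
    rcases hc.cases_head with rfl | ⟨c', hc', hr⟩
    · exact hB
    · rw [hs] at hc'
      cases hc'
      exact h₃ c hr i

/-- Writes the left end marker. -/
def Mach.mark (ι : Type) : Mach ι Unit where
  State := Bool
  finState := inferInstance
  start := false
  trans
    | false, _, _ => .inl (true, .stay, (none, .stay), none)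
    | true, _, _ => .inr ()

theorem Exec.computesInSpace {M : Mach ι Unit} {i' : ℕ} {r' : ι → ℕ} {w : List Sym}
    (h : Exec M x B 0 (fun _ => 0) () w i' r') :
    (((Mach.mark ι).bind fun _ => M).toTransducer).ComputesInSpace x w (B + 2) := by
  obtain ⟨L', -, -, hr⟩ := h (Nat.zero_le _) 0 (Nat.zero_le _) (fun _ => by simp) []
  have hm : Run (Mach.mark ι) x (B + 2) false ⟨0, fun _ => some (false, fun _ => false), 0, []⟩ ()
      ⟨0, tapeOf 0 fun _ => 0, 0, []⟩ := by
    refine .step (M := Mach.mark ι) (s' := true) (a := (.stay, (none, .stay), none)) rfl (by simp) ?_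
    have ht : Function.update (fun _ => some (false, fun _ => false)) 0 none =
        tapeOf 0 fun _ : ι => 0 := by
      funext m
      rcases m with _ | m <;> simp [tapeOf]
    simp only [Data.act, Transducer.moveHead, Option.toList, List.append_nil, Nat.zero_min, ht]
    exact .halt rfl (by simp)
  obtain ⟨⟨s, h₁, h₂⟩, h₃⟩ := (hm.bind (f := fun _ => M) (Nat.zero_le _) hr).transducer
  exact ⟨⟨_, h₁, h₂, rfl⟩, fun _ => B + 2, (Fin.sum_const 1 (B + 2)).trans_le (by simp), h₃⟩

end Conversion

/-! ### Programs -/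

/-- Sequential composition without exit values. -/
def Mach.seq {ι E : Type} (P : Mach ι Unit) (Q : Mach ι E) : Mach ι E := P.bind fun _ => Q

infixr:60 " ⨟ " => Mach.seq

section Programs

variable {ι E : Type} {x : List Sym} {B i i' i'' : ℕ} {r r' r'' : ι → ℕ} {w w' : List Sym}

theorem Exec.seq {P : Mach ι Unit} {Q : Mach ι E} {e : E} (h : Exec P x B i r () w i' r')
    (h' : Exec Q x B i' r' e w' i'' r'') : Exec (P ⨟ Q) x B i r e (w ++ w') i'' r'' :=
  h.bind h'

theorem Exec.of_le {P : Mach ι E} {e : E} (h : i ≤ x.length + 1 → Exec P x B i r e w i' r') :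
    Exec P x B i r e w i' r' := fun hi => h hi hi

theorem Exec.prim_eq [Finite E] {f : InCell Sym → Move × Option Sym × E} {c : InCell Sym} {e : E}
    (mv : Move) (o : Option Sym) (hc : i ≤ x.length + 1 → Transducer.readInput x i = c)
    (hf : f c = (mv, o, e))
    (hi' : i ≤ x.length + 1 → min (Transducer.moveHead mv i) (x.length + 1) = i') :
    Exec (Mach.prim f) x B i r e o.toList i' r := by
  refine .of_le fun hi => ?_
  have := Exec.prim (x := x) (B := B) (r := r) f (hc hi)
  rwa [hf, hi' hi] at this

/-- Does nothing and exits with `e`. -/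
def Mach.exit [Finite E] (e : E) : Mach ι E := .prim fun _ => (.stay, none, e)

theorem Exec.exit [Finite E] (e : E) : Exec (Mach.exit e) x B i r e [] i r :=
  Exec.prim_eq .stay none (fun _ => rfl) rfl min_eq_left

/-- Outputs a letter. -/
def Mach.emit (a : Sym) : Mach ι Unit := .prim fun _ => (.stay, some a, ())

theorem Exec.emit (a : Sym) : Exec (Mach.emit a) x B i r () [a] i r :=
  Exec.prim_eq .stay (some a) (fun _ => rfl) rfl min_eq_left

/-- Outputs a word. -/
def Mach.emits : List Sym → Mach ι Unit
  | [] => .exit ()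
  | a :: l => .emit a ⨟ .emits l

theorem Exec.emits (l : List Sym) : Exec (Mach.emits l) x B i r () l i r := by
  induction l with
  | nil => exact .exit ()
  | cons a l ih => exact (Exec.emit a).seq ih

/-- Moves the input head to the right. -/
def Mach.forward : Mach ι Unit := .prim fun _ => (.right, none, ())

theorem Exec.forward (hi : i ≤ x.length) : Exec Mach.forward x B i r () [] (i + 1) r :=
  Exec.prim_eq .right none (fun _ => rfl) rfl fun _ => min_eq_left (Nat.succ_le_succ hi)

/-- Moves the input head to the left end marker. -/
def Mach.rewind : Mach ι Unit :=
  .loop (.prim fun | .leftEnd => (.stay, none, false) | _ => (.left, none, true))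

theorem Exec.rewind : Exec Mach.rewind x B i r () [] 0 r := by
  induction i with
  | zero => exact .loop_false (Exec.prim_eq (c := .leftEnd) .stay none (fun _ => rfl) rfl min_eq_left)
  | succ i ih =>
    have hi (hi : i + 1 ≤ x.length + 1) : min (i + 1 - 1) (x.length + 1) = i := by omega
    generalize hc : Transducer.readInput x (i + 1) = c
    cases c with
    | leftEnd =>
      simp only [Transducer.readInput, Nat.succ_ne_zero, if_false] at hc
      split at hc <;> cases hc
    | letter a => exact .loop_true (Exec.prim_eq .left none (fun _ => hc) rfl hi) ih
    | rightEnd => exact .loop_true (Exec.prim_eq .left none (fun _ => hc) rfl hi) ih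

theorem readInput_append (u v : List Sym) (a : Sym) :
    Transducer.readInput (u ++ a :: v) (u.length + 1) = .letter a := by
  simp [Transducer.readInput]

theorem readInput_length (u : List Sym) : Transducer.readInput u (u.length + 1) = .rightEnd := by
  simp [Transducer.readInput]

/-- Moves the input head to the right across letters with property `p`, which are copied to the
output if `out` is set. -/
def Mach.scan (p : Sym → Bool) (out : Bool) : Mach ι Unit :=
  .loop (.prim fun
    | .letter a => if p a then (.right, if out then some a else none, true) else (.stay, none, false)
    | _ => (.stay, none, false))

theorem Exec.scan {p : Sym → Bool} {out : Bool} {u v v' : List Sym} (hx : x = u ++ (v ++ v'))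
    (hv : ∀ a ∈ v, p a = true) (hv' : ∀ a ∈ v'.head?, p a = false) :
    Exec (Mach.scan p out) x B (u.length + 1) r () (if out then v else [])
      ((u ++ v).length + 1) r := by
  induction v generalizing u with
  | nil =>
    rw [List.append_nil, ite_self]
    refine .loop_false ?_
    cases v' with
    | nil =>
      simp only [List.append_nil] at hx
      subst hx
      exact Exec.prim_eq .stay none (fun _ => readInput_length x) rfl min_eq_left
    | cons a v' =>
      subst hx
      exact Exec.prim_eq .stay none (fun _ => readInput_append u v' a)
        (by simp [hv' a rfl]) min_eq_left
  | cons a v ih =>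
    have ih' := ih (u := u ++ [a]) (by simp [hx]) fun b hb => hv b (List.mem_cons_of_mem _ hb)
    have hw : (if out then a :: v else []) =
        (if out then some a else none).toList ++ (if out then v else []) := by
      cases out <;> rfl
    rw [List.append_assoc, List.singleton_append, List.length_append, List.length_singleton] at ih'
    rw [hw]
    refine .loop_true (Exec.prim_eq (c := .letter a) .right _ (fun _ => ?_) ?_ fun _ => ?_) ih'
    · rw [hx]; exact readInput_append u _ a
    · simp only [hv a List.mem_cons_self, if_true]
    · rw [hx]
      simp only [Transducer.moveHead, List.length_append, List.length_cons]
      omega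

/-- Copies the scanned input letter to the output and moves the input head to the right. -/
def Mach.copyLetter : Mach ι Unit :=
  .prim fun | .letter a => (.right, some a, ()) | _ => (.stay, none, ())

theorem Exec.copyLetter {u v : List Sym} {a : Sym} (hx : x = u ++ a :: v) :
    Exec Mach.copyLetter x B (u.length + 1) r () [a] ((u ++ [a]).length + 1) r := by
  refine Exec.prim_eq (c := .letter a) .right (some a) (fun _ => ?_) rfl fun _ => ?_
  · rw [hx]; exact readInput_append u v a
  · rw [hx]
    simp only [Transducer.moveHead, List.length_append, List.length_cons, List.length_nil]
    omega

/-! ### Programs that need no particular position of the input head -/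

/-- The program transforms the registers `r` into `r'` and outputs `w`, wherever the input head is
at the start. -/
def Does (P : Mach ι Unit) (x : List Sym) (B : ℕ) (r : ι → ℕ) (w : List Sym) (r' : ι → ℕ) : Prop :=
  ∀ i, ∃ i', Exec P x B i r () w i' r'

theorem Does.seq {P Q : Mach ι Unit} (h : Does P x B r w r') (h' : Does Q x B r' w' r'') :
    Does (P ⨟ Q) x B r (w ++ w') r'' := by
  intro i
  obtain ⟨i₁, h₁⟩ := h i
  obtain ⟨i₂, h₂⟩ := h' i₁
  exact ⟨i₂, h₁.seq h₂⟩

theorem Does.emits (l : List Sym) : Does (Mach.emits l) x B r l r := fun i => ⟨i, .emits l⟩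

/-! ### Branches and loops -/

/-- Branches according to whether two registers are equal. -/
def Mach.ifEq (a b : ι) (P Q : Mach ι E) : Mach ι E :=
  (Mach.eq a b).bind fun e => if e then P else Q

theorem Exec.ifEq {a b : ι} {P Q : Mach ι E} {e : E}
    (hP : r a = r b → Exec P x B i r e w i' r') (hQ : r a ≠ r b → Exec Q x B i r e w i' r') :
    Exec (Mach.ifEq a b P Q) x B i r e w i' r' := by
  refine Exec.bind (w := []) (Exec.eq a b) ?_
  by_cases h : r a = r b
  · simpa [h] using hP h
  · simpa [h] using hQ h

theorem Does.ifEq {a b : ι} {P Q : Mach ι Unit} (hP : r a = r b → Does P x B r w r')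
    (hQ : r a ≠ r b → Does Q x B r w r') : Does (Mach.ifEq a b P Q) x B r w r' := by
  intro i
  by_cases h : r a = r b
  · obtain ⟨i', hi⟩ := hP h i
    exact ⟨i', .ifEq (fun _ => hi) fun hn => absurd h hn⟩
  · obtain ⟨i', hi⟩ := hQ h i
    exact ⟨i', .ifEq (fun hn => absurd hn h) fun _ => hi⟩

variable [DecidableEq ι]

/-- Executes `P` and increments `a` until `a = b`. -/
def Mach.forLoop (a b : ι) (P : Mach ι Unit) : Mach ι Unit :=
  .loop (.ifEq a b (.exit false) (P ⨟ .inc a ⨟ .exit true))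

/-- The invariant `I` relates the loop counter to the input position, which is needed when the loop
walks through the symbols of Φ. -/
theorem Exec.forLoop {a b : ι} {P : Mach ι Unit} (hab : b ≠ a) (I : ℕ → ℕ → Prop)
    (w : ℕ → List Sym) (n c : ℕ) (hb : r b = c + n) (hB : c + n < 2 ^ B)
    (hP : ∀ j i, c ≤ j → j < c + n → I j i → ∃ i', I (j + 1) i' ∧
      Exec P x B i (Function.update r a j) () (w j) i' (Function.update r a j)) (hi : I c i) :
    ∃ i', I (c + n) i' ∧ Exec (Mach.forLoop a b P) x B i (Function.update r a c) ()
      ((List.range' c n).flatMap w) i' (Function.update r a (c + n)) := by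
  induction n generalizing c i with
  | zero =>
    refine ⟨i, hi, .loop_false (.ifEq (fun _ => .exit false) fun h => absurd ?_ h)⟩
    simp [hab, hb]
  | succ n ih =>
    obtain ⟨i₁, hi₁, h₁⟩ := hP c i le_rfl (by omega) hi
    obtain ⟨i₂, hi₂, h₂⟩ := ih (c + 1) (by omega) (by omega)
      (fun j i hj hj' => hP j i (by omega) (by omega)) hi₁
    have he : c + 1 + n = c + (n + 1) := by omega
    rw [he] at hi₂ h₂
    refine ⟨i₂, hi₂, ?_⟩
    rw [List.range'_succ, List.flatMap_cons]
    refine .loop_true (.ifEq (fun h => ?_) fun _ => ?_) h₂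
    · simp [hab, hb] at h
    · have hinc := Exec.inc (x := x) (i := i₁) (r := Function.update r a c) (B := B) a
        (by simp; omega)
      simp only [Function.update_self, Function.update_idem] at hinc
      simpa using h₁.seq (hinc.seq (Exec.exit true))

theorem Does.inc (a : ι) (h : r a + 1 < 2 ^ B) :
    Does (Mach.inc a) x B r [] (Function.update r a (r a + 1)) := fun i => ⟨i, .inc a h⟩

theorem Does.dec (a : ι) (h : r a ≠ 0) :
    Does (Mach.dec a) x B r [] (Function.update r a (r a - 1)) := fun i => ⟨i, .dec a h⟩

theorem Does.copy (a b : ι) : Does (Mach.copy a b) x B r [] (Function.update r a (r b)) :=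
  fun i => ⟨i, .copy a b⟩

/-- Executes `P` for all values of `a` from the one set by `init` up to, but excluding, the value of
`b`, and resets `a`. -/
def Mach.forFrom (z : ι) (init : Mach ι Unit) (a b : ι) (P : Mach ι Unit) : Mach ι Unit :=
  init ⨟ .forLoop a b P ⨟ .copy a z

/-- The counter is 0 before and after, so the whole loop restores the registers and can be nested
and reused freely. -/
theorem Does.forFrom {z a b : ι} {init P : Mach ι Unit} (hz : r z = 0) (hza : z ≠ a) (ha : r a = 0)
    (hab : b ≠ a) (w : ℕ → List Sym) (c n : ℕ) (hinit : Does init x B r [] (Function.update r a c))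
    (hb : r b = c + n) (hB : r b < 2 ^ B)
    (hP : ∀ j, c ≤ j → j < c + n → Does P x B (Function.update r a j) (w j) (Function.update r a j)) :
    Does (Mach.forFrom z init a b P) x B r ((List.range' c n).flatMap w) r := by
  have hloop : Does (Mach.forLoop a b P) x B (Function.update r a c) ((List.range' c n).flatMap w)
      (Function.update r a (c + n)) := by
    intro i
    obtain ⟨i', -, h⟩ := Exec.forLoop (x := x) (i := i) (P := P) hab (fun _ _ => True) w n c hb
      (hb ▸ hB) (fun j i hj hj' _ => (hP j hj hj' i).imp fun i' h => ⟨trivial, h⟩) trivial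
    exact ⟨i', h⟩
  have := hinit.seq (hloop.seq (Does.copy a z))
  rw [Function.update_idem, Function.update_of_ne hza, hz, ← ha, Function.update_eq_self] at this
  rwa [List.nil_append, List.append_nil] at this

/-- Outputs the binary representation of the register `a`, using the scratch register `t`. -/
def Mach.emitNat (z t a : ι) : Mach ι Unit :=
  .copy t a ⨟ .loop (.ifEq t z (.exit false)
    ((Mach.half t).bind fun b => .emit (if b then .bit1 else .bit0) ⨟ .exit true))

theorem encNat_of_ne_zero {n : ℕ} (hn : n ≠ 0) :
    encNat n = (if n.testBit 0 then Sym.bit1 else Sym.bit0) :: encNat (n / 2) := by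
  have h : n = Nat.bit (n.testBit 0) (n / 2) := by
    rw [Nat.bit_val, Nat.testBit_zero]
    rcases Nat.mod_two_eq_zero_or_one n with h | h <;> simp [h] <;> omega
  have hb : n.bits = n.testBit 0 :: (n / 2).bits := by
    conv_lhs => rw [h]
    refine Nat.bits_append_bit _ _ fun h0 => ?_
    by_contra hne
    rw [h0, Bool.not_eq_true _ |>.mp hne] at h
    exact hn h
  rw [encNat, hb]
  rfl

theorem Does.emitNat {z t a : ι} (hz : r z = 0) (ht : r t = 0) (hzt : z ≠ t) :
    Does (Mach.emitNat z t a) x B r (encNat (r a)) r := by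
  have key : ∀ n i, Exec (.loop (.ifEq t z (.exit false)
      ((Mach.half t).bind fun b => .emit (if b then .bit1 else .bit0) ⨟ .exit true))) x B i
      (Function.update r t n) () (encNat n) i r := by
    intro n
    induction n using Nat.strong_induction_on with
    | _ n ih =>
      intro i
      by_cases hn : n = 0
      · subst hn
        have : Function.update r t 0 = r := by rw [← ht, Function.update_eq_self]
        rw [this]
        exact .loop_false (.ifEq (fun _ => .exit false) fun h => absurd (ht.trans hz.symm) h)
      · rw [encNat_of_ne_zero hn]
        have hh := Exec.half (x := x) (B := B) (i := i) (r := Function.update r t n) t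
        simp only [Function.update_self, Function.update_idem] at hh
        have hbody := hh.bind (f := fun b =>
          Mach.emit (if b then Sym.bit1 else .bit0) ⨟ .exit true) ((Exec.emit _).seq (Exec.exit true))
        refine .loop_true (.ifEq (fun h => ?_) fun _ => hbody) (ih (n / 2) (by omega) i)
        simp [hzt, hz, hn] at h
  intro i
  exact ⟨i, (Exec.copy t a).seq (key (r a) i)⟩

end Programs

/-! ### Access to the input -/

def Sym.isBit : Sym → Bool
  | .bit0 | .bit1 => true
  | _ => false

def Sym.isKind : Sym → Bool
  | .letter | .stair => true
  | _ => false

def Sym.notSep (a : Sym) : Bool := a ≠ .sep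

theorem encNat_isBit {n : ℕ} {a : Sym} (h : a ∈ encNat n) : a.isBit = true := by
  simp only [encNat, List.mem_map] at h
  obtain ⟨b, -, rfl⟩ := h
  cases b <;> rfl

theorem PSym.enc_eq (p : PSym) : ∃ a l, p.enc = a :: l ∧ a.isKind = true ∧ a.isBit = false ∧
    a.notSep = true ∧ ∀ b ∈ l, b.isBit = true := by
  cases p with
  | letter n => exact ⟨_, _, rfl, rfl, rfl, rfl, fun _ => encNat_isBit⟩
  | stair n => exact ⟨_, _, rfl, rfl, rfl, rfl, fun _ => encNat_isBit⟩

theorem Sym.notSep_of_isBit {a : Sym} (h : a.isBit = true) : a.notSep = true := by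
  cases a <;> first | rfl | cases h

theorem Sym.isKind_of_isBit {a : Sym} (h : a.isBit = true) : a.isKind = false := by
  cases a <;> first | rfl | cases h

theorem PSym.notSep_enc (p : PSym) : ∀ a ∈ p.enc, a.notSep = true := by
  obtain ⟨a, l, he, -, -, ha, hl⟩ := p.enc_eq
  rw [he]
  simp only [List.forall_mem_cons]
  exact ⟨ha, fun b hb => Sym.notSep_of_isBit (hl b hb)⟩

/-- Kind letters mark the beginnings of symbols, so counting them in the list field yields |Φ|. -/
theorem PSym.countP_enc (p : PSym) : p.enc.countP Sym.isKind = 1 := by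
  obtain ⟨a, l, he, ha, -, -, hl⟩ := p.enc_eq
  rw [he, List.countP_cons_of_pos ha, List.countP_eq_zero.2]
  intro b hb
  simp [Sym.isKind_of_isBit (hl b hb)]

theorem ML.notSep_enc (α : ML) : ∀ a ∈ α.enc, a.notSep = true := by
  induction α with
  | var p => exact p.notSep_enc
  | top => simp [ML.enc, Sym.notSep]
  | neg a ih => simpa [ML.enc, Sym.notSep] using ih
  | and a b iha ihb =>
    simp only [ML.enc, List.forall_mem_cons, List.forall_mem_append]
    exact ⟨rfl, iha, ihb⟩
  | or a b iha ihb =>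
    simp only [ML.enc, List.forall_mem_cons, List.forall_mem_append]
    exact ⟨rfl, iha, ihb⟩
  | box a ih => simpa [ML.enc, Sym.notSep] using ih
  | dia a ih => simpa [ML.enc, Sym.notSep] using ih

/-- The registers: the constants `0`, `|Φ|`, `top` and `top + 1`, the current level and the one
below it, loop counters, and scratch registers. -/
inductive Reg : Type
  | zero | len | top | top1 | lvl | low | cnt | p | q | m | skip | tmp
  deriving DecidableEq

instance : Finite Reg :=
  Finite.of_surjective (fun i : Fin 12 => [Reg.zero, .len, .top, .top1, .lvl, .low, .cnt, .p, .q,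
    .m, .skip, .tmp].getD i .zero) fun a => by cases a <;> decide

/-- An input together with the top level of the construction and a bound on the bit width of the
registers. -/
structure Task where
  k : ℕ
  Φ : List PSym
  α : ML
  β : ML
  top : ℕ
  B : ℕ

namespace Task

variable (t : Task)

def input : List Sym := encInput t.k t.Φ t.α t.β

/-- The input before the `j`-th symbol of `Φ`. -/
def before (j : ℕ) : List Sym :=
  List.replicate t.k Sym.one ++ [Sym.sep] ++ (t.Φ.take j).flatMap PSym.enc

/-- The `j`-th symbol of `Φ`. -/
def symAt (j : ℕ) : PSym := t.Φ[j]?.getD (.letter 0)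

theorem map_symAt (c n : ℕ) (h : c + n = t.Φ.length) :
    (List.range' c n).map t.symAt = t.Φ.drop c := by
  refine List.ext_getElem? fun j => ?_
  rw [List.getElem?_map, List.getElem?_drop]
  by_cases hj : j < n
  · rw [List.getElem?_range' hj, List.getElem?_eq_getElem (by omega)]
    simp only [Option.map_some, Task.symAt, one_mul]
    rw [List.getElem?_eq_getElem (by omega)]
    rfl
  · rw [List.getElem?_eq_none (by simp; omega), List.getElem?_eq_none (by omega)]
    rfl

theorem input_at {j : ℕ} (hj : j < t.Φ.length) : ∃ a l v, (t.symAt j).enc = a :: l ∧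
    (∀ b ∈ l, b.isBit = true) ∧ (∀ b ∈ v.head?, b.isBit = false) ∧
    t.input = t.before j ++ a :: (l ++ v) ∧ t.before (j + 1) = t.before j ++ a :: l := by
  obtain ⟨a, l, he, -, -, -, hl⟩ := (t.symAt j).enc_eq
  have hs : t.Φ[j] = t.symAt j := by simp [Task.symAt, hj]
  refine ⟨a, l, (t.Φ.drop (j + 1)).flatMap PSym.enc ++ Sym.sep :: (t.α.enc ++ Sym.sep :: t.β.enc),
    he, hl, ?_, ?_, ?_⟩
  · rcases t.Φ.drop (j + 1) with _ | ⟨p, Φ'⟩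
    · simp [Sym.isBit]
    · obtain ⟨b, l', he', -, hb, -⟩ := p.enc_eq
      simp [he', hb]
  · have : t.Φ = t.Φ.take j ++ t.symAt j :: t.Φ.drop (j + 1) := by
      rw [← hs, ← List.drop_eq_getElem_cons hj, List.take_append_drop]
    conv_lhs => rw [Task.input, encInput, this]
    simp [Task.before, he]
  · rw [Task.before, List.take_add_one, List.getElem?_eq_getElem hj, hs]
    simp [Task.before, he]

end Task

/-- The program outputs `w` and restores the registers `r`. -/
def Gives (t : Task) (P : Mach Reg Unit) (r : Reg → ℕ) (w : List Sym) : Prop :=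
  Does P t.input t.B r w r

theorem Gives.seq {t : Task} {P Q : Mach Reg Unit} {r : Reg → ℕ} {w w' : List Sym}
    (h : Gives t P r w) (h' : Gives t Q r w') : Gives t (P ⨟ Q) r (w ++ w') := Does.seq h h'

theorem Gives.emits {t : Task} {r : Reg → ℕ} (l : List Sym) : Gives t (Mach.emits l) r l :=
  Does.emits l

section Access

variable {t : Task} {r : Reg → ℕ}

/-- Skips the input up to and including the next separator. -/
def skipField : Mach Reg Unit := .scan Sym.notSep false ⨟ .forward

theorem Exec.skipField {x u v v' : List Sym} {B : ℕ} (hx : x = u ++ (v ++ Sym.sep :: v'))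
    (hv : ∀ a ∈ v, a.notSep = true) :
    Exec skipField x B (u.length + 1) r () [] ((u ++ (v ++ [Sym.sep])).length + 1) r := by
  have h := Exec.scan (ι := Reg) (B := B) (r := r) (p := Sym.notSep) (out := false) hx hv (by simp [Sym.notSep])
  have h' := Exec.forward (ι := Reg) (x := x) (B := B) (r := r) (i := (u ++ v).length + 1) (by simp [hx])
  have := h.seq h'
  rw [← List.append_assoc, List.length_append (as := u ++ v)]
  exact this

/-- Outputs the symbol of `Φ` with the index in register `c`. -/
def emitSym (c : Reg) : Mach Reg Unit :=
  .rewind ⨟ .forward ⨟ skipField ⨟ .forLoop .skip c (.forward ⨟ .scan Sym.isBit false) ⨟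
    .copyLetter ⨟ .scan Sym.isBit true ⨟ .copy .skip .zero

theorem Gives.emitSym {c : Reg} (hc : c ≠ .skip) (hz : r .zero = 0) (hs : r .skip = 0)
    (hl : r c < t.Φ.length) (hB : t.Φ.length < 2 ^ t.B) :
    Gives t (emitSym c) r (t.symAt (r c)).enc := by
  intro i
  have h₁ := Exec.rewind (ι := Reg) (x := t.input) (B := t.B) (r := r) (i := i)
  have h₂ := Exec.forward (ι := Reg) (x := t.input) (B := t.B) (r := r) (i := 0) (Nat.zero_le _)
  have h₃ := Exec.skipField (x := t.input) (B := t.B) (r := r) (u := [])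
    (v := List.replicate t.k .one) rfl (by simp [Sym.notSep])
  -- The invariant places the head on the first letter of the j-th symbol; the summand 1 accounts
  -- for the left end marker.
  obtain ⟨i₄, rfl, h₄⟩ := Exec.forLoop (x := t.input) (B := t.B) (r := r) (a := .skip) (b := c)
    (P := .forward ⨟ .scan Sym.isBit false) hc (fun j i => i = (t.before j).length + 1)
    (fun _ => []) (r c) 0 (zero_add _).symm (by omega) (fun j i _ hj hi => by
      subst hi
      obtain ⟨a, l, v, -, hl, hv, hx, he⟩ := t.input_at (j := j) (by omega)
      refine ⟨_, rfl, ?_⟩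
      have h₁ := Exec.forward (ι := Reg) (x := t.input) (B := t.B)
        (r := Function.update r .skip j) (i := (t.before j).length + 1) (by rw [hx]; simp)
      have h₂ := Exec.scan (ι := Reg) (x := t.input) (B := t.B) (r := Function.update r .skip j)
        (out := false) (u := t.before j ++ [a]) (v := l) (v' := v) (by rw [hx]; simp) hl hv
      rw [he]
      rw [List.length_append, List.length_singleton, List.append_assoc] at h₂
      exact h₁.seq h₂) (i := (t.before 0).length + 1) rfl
  obtain ⟨a, l, v, hs', hlb, hv, hx, he⟩ := t.input_at hl
  rw [zero_add] at h₄
  have h₅ := Exec.copyLetter (ι := Reg) (x := t.input) (B := t.B)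
    (r := Function.update r .skip (r c)) hx
  have h₆ := Exec.scan (ι := Reg) (x := t.input) (B := t.B) (r := Function.update r .skip (r c))
    (out := true) (u := t.before (r c) ++ [a]) (v := l) (v' := v) (by rw [hx]; simp) hlb hv
  have h₇ := Exec.copy (x := t.input) (B := t.B) (r := Function.update r .skip (r c))
    (i := (t.before (r c) ++ [a] ++ l).length + 1) .skip .zero
  have hr : ∀ n, Function.update (Function.update r .skip n)
      .skip (Function.update r Reg.skip n .zero) = r := by
    intro n
    rw [Function.update_idem, Function.update_of_ne (by decide), hz, ← hs, Function.update_eq_self]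
  have hr' : Function.update r .skip 0 = r := by rw [← hs, Function.update_eq_self]
  rw [hr] at h₇
  rw [hr'] at h₄
  have hb : ([] ++ (List.replicate t.k Sym.one ++ [Sym.sep])).length + 1 =
      (t.before 0).length + 1 := by simp [Task.before]
  rw [hb] at h₃
  have := h₁.seq (h₂.seq (h₃.seq (h₄.seq (h₅.seq (h₆.seq h₇)))))
  refine ⟨(t.before (r c) ++ [a] ++ l).length + 1, ?_⟩
  have hf : (List.range' 0 (r c)).flatMap (fun _ => ([] : List Sym)) = [] := by simp
  rw [hs']
  simp only [hf, List.nil_append, List.append_nil, if_true, List.singleton_append] at this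
  exact this

/-- Outputs `α`. -/
def emitLeft : Mach Reg Unit :=
  .rewind ⨟ .forward ⨟ skipField ⨟ skipField ⨟ .scan Sym.notSep true

/-- Outputs `β`. -/
def emitRight : Mach Reg Unit :=
  .rewind ⨟ .forward ⨟ skipField ⨟ skipField ⨟ skipField ⨟ .scan Sym.notSep true

theorem notSep_flatMap_enc (Φ : List PSym) : ∀ a ∈ Φ.flatMap PSym.enc, a.notSep = true := by
  simp only [List.mem_flatMap]
  rintro a ⟨p, -, ha⟩
  exact p.notSep_enc a ha

theorem Gives.emitLeft : Gives t emitLeft r t.α.enc := by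
  intro i
  have h₁ := Exec.rewind (ι := Reg) (x := t.input) (B := t.B) (r := r) (i := i)
  have h₂ := Exec.forward (ι := Reg) (x := t.input) (B := t.B) (r := r) (i := 0) (Nat.zero_le _)
  have h₃ := Exec.skipField (x := t.input) (B := t.B) (r := r) (u := [])
    (v := List.replicate t.k .one) rfl (by simp [Sym.notSep])
  have h₄ := Exec.skipField (x := t.input) (B := t.B) (r := r)
    (u := [] ++ (List.replicate t.k .one ++ [Sym.sep])) (v := t.Φ.flatMap PSym.enc)
    (by simp [Task.input, encInput]; rfl) (notSep_flatMap_enc _)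
  have h₅ := Exec.scan (ι := Reg) (x := t.input) (B := t.B) (r := r) (p := Sym.notSep) (out := true)
    (u := [] ++ (List.replicate t.k .one ++ [Sym.sep]) ++ (t.Φ.flatMap PSym.enc ++ [Sym.sep]))
    (v := t.α.enc) (v' := .sep :: t.β.enc) (by simp [Task.input, encInput]) t.α.notSep_enc
    (by simp [Sym.notSep])
  exact ⟨_, h₁.seq (h₂.seq (h₃.seq (h₄.seq h₅)))⟩

theorem Gives.emitRight : Gives t emitRight r t.β.enc := by
  intro i
  have h₁ := Exec.rewind (ι := Reg) (x := t.input) (B := t.B) (r := r) (i := i)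
  have h₂ := Exec.forward (ι := Reg) (x := t.input) (B := t.B) (r := r) (i := 0) (Nat.zero_le _)
  have h₃ := Exec.skipField (x := t.input) (B := t.B) (r := r) (u := [])
    (v := List.replicate t.k .one) rfl (by simp [Sym.notSep])
  have h₄ := Exec.skipField (x := t.input) (B := t.B) (r := r)
    (u := [] ++ (List.replicate t.k .one ++ [Sym.sep])) (v := t.Φ.flatMap PSym.enc)
    (by simp [Task.input, encInput]; rfl) (notSep_flatMap_enc _)
  have h₅ := Exec.skipField (x := t.input) (B := t.B) (r := r)
    (u := [] ++ (List.replicate t.k .one ++ [Sym.sep]) ++ (t.Φ.flatMap PSym.enc ++ [Sym.sep]))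
    (v := t.α.enc) (v' := t.β.enc) (by simp [Task.input, encInput]) t.α.notSep_enc
  have h₆ := Exec.scan (ι := Reg) (x := t.input) (B := t.B) (r := r) (p := Sym.notSep) (out := true)
    (u := [] ++ (List.replicate t.k .one ++ [Sym.sep]) ++ (t.Φ.flatMap PSym.enc ++ [Sym.sep]) ++
      (t.α.enc ++ [Sym.sep]))
    (v := t.β.enc) (v' := []) (by simp [Task.input, encInput]) t.β.notSep_enc (by simp)
  exact ⟨_, h₁.seq (h₂.seq (h₃.seq (h₄.seq (h₅.seq h₆))))⟩

/-- Outputs the stair whose index is in register `c`. -/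
def emitStair (c : Reg) : Mach Reg Unit := .emits [.stair] ⨟ .emitNat .zero .tmp c

theorem Gives.emitStair (c : Reg) (hz : r .zero = 0) (ht : r .tmp = 0) :
    Gives t (emitStair c) r (stairVar (r c)).enc :=
  (Gives.emits [.stair]).seq (Does.emitNat hz ht (by decide))

/-- Counts the letters with property `p` up to the next separator in register `a`. -/
def countField (p : Sym → Bool) (a : Reg) : Mach Reg Unit :=
  .loop ((Mach.prim fun
    | .letter b => if b.notSep then (.right, none, some (p b)) else (.stay, none, none)
    | _ => (.stay, none, none)).bind fun
    | none => .exit false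
    | some true => .inc a ⨟ .exit true
    | some false => .exit true)

theorem Exec.countField {p : Sym → Bool} {a : Reg} {x u v v' : List Sym} {B : ℕ}
    (hx : x = u ++ (v ++ Sym.sep :: v')) (hv : ∀ b ∈ v, b.notSep = true)
    (hB : r a + v.countP p < 2 ^ B) : Exec (countField p a) x B (u.length + 1) r () []
      ((u ++ v).length + 1) (Function.update r a (r a + v.countP p)) := by
  induction v generalizing u r with
  | nil =>
    have := Exec.prim_eq (x := x) (B := B) (r := r) (f := fun
      | .letter b => if b.notSep then (.right, none, some (p b)) else (.stay, none, none)
      | _ => (.stay, none, none)) (c := .letter .sep) (i := u.length + 1) (e := none) .stay none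
      (fun _ => by rw [hx]; exact readInput_append u _ _) rfl min_eq_left
    simp only [List.append_nil, List.countP_nil, add_zero, Function.update_eq_self]
    exact .loop_false (this.bind (Exec.exit false))
  | cons b v ih =>
    have hstep := Exec.prim_eq (x := x) (B := B) (r := r) (f := fun
      | .letter b => if b.notSep then (.right, none, some (p b)) else (.stay, none, none)
      | _ => (.stay, none, none)) (c := .letter b) (i := u.length + 1) (i' := u.length + 1 + 1)
      (e := some (p b)) .right none
      (fun _ => by rw [hx]; exact readInput_append u _ _)
      (by simp [hv b List.mem_cons_self]) fun _ => by simp [Transducer.moveHead, hx]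
    have hx' : x = (u ++ [b]) ++ (v ++ Sym.sep :: v') := by simp [hx]
    have hv' : ∀ b ∈ v, b.notSep = true := fun c hc => hv c (List.mem_cons_of_mem _ hc)
    have hpos : ((u ++ [b]) ++ v).length + 1 = (u ++ b :: v).length + 1 := by simp
    cases hp : p b
    · rw [List.countP_cons_of_neg (by simp [hp])] at hB ⊢
      have := ih hx' hv' hB
      rw [hpos, List.length_append, List.length_singleton] at this
      rw [hp] at hstep
      exact .loop_true (hstep.bind (Exec.exit true)) this
    · rw [List.countP_cons_of_pos hp] at hB ⊢
      have := ih (r := Function.update r a (r a + 1)) hx' hv' (by simp; omega)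
      rw [hpos, List.length_append, List.length_singleton, Function.update_self,
        Function.update_idem] at this
      rw [hp] at hstep
      have he : r a + 1 + v.countP p = r a + (v.countP p + 1) := by omega
      rw [he] at this
      exact .loop_true (hstep.bind ((Exec.inc a (by omega)).seq (Exec.exit true))) this

end Access

/-! ### Output of formulas -/

/-- The program outputs the encodings of the formulas `f c` up to the encoding of `c`, which is
their suffix. -/
def Ctx (t : Task) (P : Mach Reg Unit) (r : Reg → ℕ) (f : MTL → MTL) : Prop :=
  ∃ w, Gives t P r w ∧ ∀ c, (f c).enc = w ++ c.enc

section Formulas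

variable {t : Task} {r : Reg → ℕ} {P Q A B : Mach Reg Unit} {f g : MTL → MTL} {φ : MTL}
  {α β : ML} {p : PSym}

theorem Ctx.comp (h : Ctx t P r f) (h' : Ctx t Q r g) : Ctx t (P ⨟ Q) r fun c => f (g c) := by
  obtain ⟨w, hw, he⟩ := h
  obtain ⟨w', hw', he'⟩ := h'
  exact ⟨w ++ w', hw.seq hw', fun c => by rw [he, he', List.append_assoc]⟩

theorem Ctx.apply (h : Ctx t P r f) (h' : Gives t Q r φ.enc) : Gives t (P ⨟ Q) r (f φ).enc := by
  obtain ⟨w, hw, he⟩ := h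
  rw [he]
  exact hw.seq h'

def outTilde : Mach Reg Unit := .emits [.tilde]

theorem Ctx.tilde : Ctx t outTilde r .tilde := ⟨_, .emits _, fun _ => rfl⟩

def outBox : Mach Reg Unit := .emits [.box]

theorem Ctx.box : Ctx t outBox r .box := ⟨_, .emits _, fun _ => rfl⟩

def outAnd (P : Mach Reg Unit) : Mach Reg Unit := .emits [.and] ⨟ P

theorem Ctx.and (h : Gives t P r φ.enc) : Ctx t (outAnd P) r (.and φ) :=
  ⟨_, (Gives.emits _).seq h, fun c => by simp [MTL.enc]⟩

def outOr (P : Mach Reg Unit) : Mach Reg Unit := .emits [.or] ⨟ P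

theorem Ctx.or (h : Gives t P r φ.enc) : Ctx t (outOr P) r (.or φ) :=
  ⟨_, (Gives.emits _).seq h, fun c => by simp [MTL.enc]⟩

def outMl (A : Mach Reg Unit) : Mach Reg Unit := .emits [.ml] ⨟ A

theorem Gives.ml (h : Gives t A r α.enc) : Gives t (outMl A) r (MTL.ml α).enc :=
  (Gives.emits _).seq h

def outNeg (A : Mach Reg Unit) : Mach Reg Unit := .emits [.neg] ⨟ A

theorem Gives.neg (h : Gives t A r α.enc) : Gives t (outNeg A) r (ML.neg α).enc :=
  (Gives.emits _).seq h

def outDisj (A B : Mach Reg Unit) : Mach Reg Unit := .emits [.or] ⨟ A ⨟ B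

theorem Gives.or (hA : Gives t A r α.enc) (hB : Gives t B r β.enc) :
    Gives t (outDisj A B) r (ML.or α β).enc :=
  (Gives.emits _).seq (hA.seq hB)

def outOvee (P : Mach Reg Unit) : Mach Reg Unit :=
  outTilde ⨟ outAnd (outTilde ⨟ P) ⨟ outTilde

theorem Ctx.ovee (h : Gives t P r φ.enc) : Ctx t (outOvee P) r (.ovee φ) :=
  Ctx.tilde.comp ((Ctx.and (Ctx.tilde.apply h)).comp Ctx.tilde)

def outE (A : Mach Reg Unit) : Mach Reg Unit := outTilde ⨟ outMl (outNeg A)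

theorem Gives.E (h : Gives t A r α.enc) : Gives t (outE A) r (MTL.E α).enc :=
  Ctx.tilde.apply h.neg.ml

def outHook (A : Mach Reg Unit) : Mach Reg Unit := outOr (outMl (outNeg A)) ⨟ outAnd (outMl A)

theorem Ctx.hook (h : Gives t A r α.enc) : Ctx t (outHook A) r (.hook α) :=
  (Ctx.or h.neg.ml).comp (Ctx.and h.ml)

def outDep (P : Mach Reg Unit) : Mach Reg Unit := outOvee (outMl P) ⨟ outMl (outNeg P)

theorem Gives.dep (h : Gives t P r p.enc) : Gives t (outDep P) r (MTL.dep p).enc :=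
  have h' : Gives t P r (ML.var p).enc := h
  (Ctx.ovee h'.ml).apply h'.neg.ml

def outExOne (A : Mach Reg Unit) : Mach Reg Unit :=
  outOr (outMl A) ⨟ outAnd (outE A) ⨟ outTilde ⨟ outOr (outMl A) ⨟ outTilde ⨟
    outOvee (outTilde ⨟ outE A)

theorem Ctx.exOne (h : Gives t A r α.enc) : Ctx t (outExOne A) r (.exOne α) :=
  (Ctx.or h.ml).comp ((Ctx.and h.E).comp (Ctx.tilde.comp ((Ctx.or h.ml).comp
    (Ctx.tilde.comp (Ctx.ovee (Ctx.tilde.apply h.E))))))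

def outAllOne (A : Mach Reg Unit) : Mach Reg Unit := outTilde ⨟ outExOne A ⨟ outTilde

theorem Ctx.allOne (h : Gives t A r α.enc) : Ctx t (outAllOne A) r (.allOne α) :=
  Ctx.tilde.comp ((Ctx.exOne h).comp Ctx.tilde)

def outChiStar (A B : Mach Reg Unit) : Mach Reg Unit :=
  outOvee (outAnd (outMl (outNeg A)) ⨟ outMl (outNeg B)) ⨟ outAnd (outE A) ⨟ outAnd (outE B) ⨟
    outTilde ⨟ outOr (outOvee (outMl A) ⨟ outMl B) ⨟ outAnd (outE A) ⨟ outAnd (outE B) ⨟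
    outTilde ⨟ outExOne A ⨟ outExOne B

theorem Ctx.chiStarOf (hA : Gives t A r α.enc) (hB : Gives t B r β.enc) :
    Ctx t (outChiStar A B) r fun c => MTLOrder.chiStarOf c α β :=
  (Ctx.ovee ((Ctx.and hA.neg.ml).apply hB.neg.ml)).comp ((Ctx.and hA.E).comp ((Ctx.and hB.E).comp
    (Ctx.tilde.comp ((Ctx.or ((Ctx.ovee hA.ml).apply hB.ml)).comp ((Ctx.and hA.E).comp
      ((Ctx.and hB.E).comp (Ctx.tilde.comp ((Ctx.exOne hA).comp (Ctx.exOne hB)))))))))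

theorem MTL.enc_bigAnd (l : List MTL) :
    (MTL.bigAnd l).enc = l.flatMap (fun f => Sym.and :: f.enc) ++ [Sym.ml, .top] := by
  induction l with
  | nil => rfl
  | cons f l ih =>
    have : MTL.bigAnd (f :: l) = .and f (.bigAnd l) := rfl
    simp [this, MTL.enc, ih]

theorem MTL.enc_bigOvee (l : List MTL) : (MTL.bigOvee l).enc =
    l.flatMap (fun f => [Sym.tilde, .and, .tilde] ++ f.enc ++ [.tilde]) ++
      [Sym.tilde, .ml, .top] := by
  induction l with
  | nil => rfl
  | cons f l ih =>
    have : MTL.bigOvee (f :: l) = .ovee f (.bigOvee l) := rfl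
    simp [this, MTL.ovee, MTL.enc, ih]

/-- The invariant of the registers outside of the loops over symbols. -/
structure Ready (t : Task) (l l' : ℕ) (r : Reg → ℕ) : Prop where
  zero : r .zero = 0
  len : r .len = t.Φ.length
  top : r .top = t.top
  top1 : r .top1 = t.top + 1
  lvl : r .lvl = l
  low : r .low = l'
  m : r .m = 0
  skip : r .skip = 0
  tmp : r .tmp = 0
  len_lt : t.Φ.length < 2 ^ t.B
  top_lt : t.top + 1 < 2 ^ t.B
  lvl_le : l ≤ t.top
  low_le : l' ≤ t.top

variable {l l' : ℕ}

theorem Ready.update (h : Ready t l l' r) {a : Reg} (ha : a = .p ∨ a = .q ∨ a = .cnt) (n : ℕ) :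
    Ready t l l' (Function.update r a n) := by
  obtain ⟨h₁, h₂, h₃, h₄, h₅, h₆, h₇, h₈, h₉, h₁₀, h₁₁, h₁₂, h₁₃⟩ := h
  rcases ha with rfl | rfl | rfl <;> constructor <;> simpa

/-- The formula `φ`, given by a program for each register content with the invariant. -/
def Outputs (t : Task) (l l' : ℕ) (A : Mach Reg Unit) (α : ML) : Prop :=
  ∀ r, Ready t l l' r → Gives t A r α.enc

def outChiZero (A B : Mach Reg Unit) : Mach Reg Unit :=
  outHook (outDisj A B) ⨟
    .forFrom .zero (.copy .p .zero) .p .len (.emits [.and] ⨟ outDep (emitSym .p)) ⨟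
    .emits [.ml, .top]

theorem Gives.forSymbols {F : PSym → List Sym} {a : Reg} {init : Mach Reg Unit} {c : ℕ}
    (hr : Ready t l l' r) (ha : a = .p ∨ a = .q) (ha₀ : r a = 0)
    (hinit : Does init t.input t.B r [] (Function.update r a c)) (hc : c ≤ t.Φ.length)
    (hP : ∀ j < t.Φ.length, c ≤ j → Gives t P (Function.update r a j) (F (t.symAt j))) :
    Gives t (.forFrom .zero init a .len P) r ((t.Φ.drop c).flatMap F) := by
  have hn : c + (t.Φ.length - c) = t.Φ.length := by omega
  rw [← t.map_symAt c _ hn, List.flatMap_map]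
  refine Does.forFrom hr.zero ?_ ha₀ ?_ _ c _ hinit (hr.len.trans hn.symm)
    (hr.len.trans_lt hr.len_lt) fun j hj hj' => hP j (by omega) hj
  · rcases ha with rfl | rfl <;> decide
  · rcases ha with rfl | rfl <;> decide

theorem Ready.emitSym (hr : Ready t l l' r) {a : Reg} (ha : a = .p ∨ a = .q)
    (hj : r a < t.Φ.length) : Gives t (emitSym a) r (t.symAt (r a)).enc := by
  refine Gives.emitSym ?_ hr.zero hr.skip hj hr.len_lt
  rcases ha with rfl | rfl <;> decide

theorem Gives.chiZero (hA : Outputs t l l' A α) (hB : Outputs t l l' B β) (hr : Ready t l l' r)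
    (hp : r .p = 0) : Gives t (outChiZero A B) r (MTLOrder.chiZero t.Φ α β).enc := by
  refine (Ctx.hook ((hA r hr).or (hB r hr))).apply ?_
  rw [MTL.enc_bigAnd, List.flatMap_map]
  refine Gives.seq (Gives.forSymbols (c := 0) hr (.inl rfl) hp ?_ (Nat.zero_le _) fun j hj _ => ?_)
    (Gives.emits _)
  · rw [← hr.zero]
    exact Does.copy _ _
  · have := (hr.update (.inl rfl) j).emitSym (a := .p) (.inl rfl) (by simpa using hj)
    rw [Function.update_self] at this
    exact (Gives.emits [.and]).seq this.dep

def outChi (A B : Mach Reg Unit) : Mach Reg Unit :=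
  .forFrom .zero (.copy .cnt .zero) .cnt .low
    (outAnd (outChiZero A B) ⨟ outBox ⨟ outChiStar A B) ⨟ outChiZero A B

/-- The prefix of χ_{n+1} before χ_n is the same word at every level, so χ_n is n copies of it
followed by χ_0. The list `L` matters only through its length. -/
theorem enc_chi {Φ : List PSym} {w : List Sym}
    (hw : ∀ c, (MTL.and (chiZero Φ α β) (.box (chiStarOf c α β))).enc = w ++ c.enc) (L : List ℕ) :
    L.flatMap (fun _ => w) ++ (chiZero Φ α β).enc = (chi Φ L.length α β).enc := by
  induction L with
  | nil => rfl
  | cons a L ih => rw [List.length_cons, chi, hw, List.flatMap_cons, List.append_assoc, ih]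

theorem Ctx.chiStep (hA : Outputs t l l' A α) (hB : Outputs t l l' B β) (hr : Ready t l l' r)
    (hp : r .p = 0) : Ctx t (outAnd (outChiZero A B) ⨟ outBox ⨟ outChiStar A B) r
      fun c => MTL.and (MTLOrder.chiZero t.Φ α β) (.box (MTLOrder.chiStarOf c α β)) :=
  (Ctx.and (Gives.chiZero hA hB hr hp)).comp (Ctx.box.comp (Ctx.chiStarOf (hA r hr) (hB r hr)))

theorem Gives.chi (hA : Outputs t l l' A α) (hB : Outputs t l l' B β) (hr : Ready t l l' r)
    (hp : r .p = 0) (hcnt : r .cnt = 0) : Gives t (outChi A B) r (MTLOrder.chi t.Φ l' α β).enc := by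
  obtain ⟨w, -, hw⟩ := Ctx.chiStep hA hB hr hp
  have he := enc_chi hw (List.range' 0 l')
  rw [List.length_range'] at he
  rw [← he]
  have hlow := hr.low_le
  have htop := hr.top_lt
  refine Gives.seq (Does.forFrom hr.zero (by decide) hcnt (by decide) (fun _ => w) 0 l' ?_
    (by rw [hr.low, zero_add]) (by rw [hr.low]; omega) fun j _ _ => ?_) (Gives.chiZero hA hB hr hp)
  · have := Does.copy (x := t.input) (B := t.B) (r := r) .cnt .zero
    rwa [hr.zero] at this
  · obtain ⟨w', hg, hw'⟩ := Ctx.chiStep hA hB (hr.update (.inr (.inr rfl)) j) (by simpa using hp)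
    -- The prefix is independent of the loop counter: both words precede the same suffix in the
    -- encoding of one formula.
    have := (hw (.ml .top)).symm.trans (hw' (.ml .top))
    rw [List.append_cancel_right this]
    exact hg

def outZetaZero (A B : Mach Reg Unit) : Mach Reg Unit :=
  .forFrom .zero (.copy .p .zero) .p .len (outOvee
    (outAnd (outHook A ⨟ outMl (outNeg (emitSym .p))) ⨟
      outAnd (outHook B ⨟ outMl (emitSym .p)) ⨟
      .forFrom .zero (.copy .q .p ⨟ .inc .q) .q .len
        (.emits [.and] ⨟ outHook (outDisj A B) ⨟ outDep (emitSym .q)) ⨟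
      .emits [.ml, .top])) ⨟
  .emits [.tilde, .ml, .top]

/-- Without repetitions, positions determine the order, so the symbols above the j-th one form a
tail of the list and can be enumerated by a counter. -/
theorem filter_idxOf_lt {Φ : List PSym} (hΦ : Φ.Nodup) {j : ℕ} (hj : j < Φ.length) :
    (Φ.filter fun q => decide (Φ.idxOf Φ[j] < Φ.idxOf q)) = Φ.drop (j + 1) := by
  have hidx : ∀ i (hi : i < Φ.length), Φ.idxOf Φ[i] = i := fun i hi => hΦ.idxOf_getElem i hi
  rw [hidx j hj]
  conv_lhs => rw [← List.take_append_drop (j + 1) Φ]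
  rw [List.filter_append, List.filter_eq_nil_iff.2, List.filter_eq_self.2, List.nil_append]
  · intro q hq
    rw [List.take_append_drop]
    obtain ⟨i, hi, rfl⟩ := List.getElem_of_mem hq
    rw [List.getElem_drop, hidx]
    simp
    omega
  · intro q hq
    rw [List.take_append_drop]
    obtain ⟨i, hi, rfl⟩ := List.getElem_of_mem hq
    rw [List.getElem_take, hidx]
    rw [List.length_take] at hi
    simp
    omega

theorem Gives.zetaZero (hΦ : t.Φ.Nodup) (hA : Outputs t l l' A α) (hB : Outputs t l l' B β)
    (hr : Ready t l l' r) (hp : r .p = 0) (hq : r .q = 0) :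
    Gives t (outZetaZero A B) r (MTLOrder.zetaZero t.Φ α β).enc := by
  rw [MTLOrder.zetaZero, MTL.enc_bigOvee, List.flatMap_map]
  refine Gives.seq (Gives.forSymbols (c := 0) hr (.inl rfl) hp ?_ (Nat.zero_le _) fun j hj _ => ?_)
    (Gives.emits _)
  · rw [← hr.zero]
    exact Does.copy _ _
  have hs : t.Φ[j] = t.symAt j := by simp [Task.symAt, hj]
  have hr' := hr.update (a := .p) (.inl rfl) j
  have hpj := hr'.emitSym (a := .p) (.inl rfl) (by simpa using hj)
  rw [Function.update_self] at hpj
  have hv : Gives t (MTLOrder.emitSym .p) (Function.update r .p j) (ML.var (t.symAt j)).enc := hpj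
  have key : Gives t (Mach.forFrom .zero (.copy .q .p ⨟ .inc .q) .q .len
      (.emits [.and] ⨟ outHook (outDisj A B) ⨟ outDep (MTLOrder.emitSym .q)) ⨟ .emits [.ml, .top])
      (Function.update r .p j) (MTL.bigAnd
        ((t.Φ.filter fun q => decide (t.Φ.idxOf (t.symAt j) < t.Φ.idxOf q)).map fun q =>
          .hook (.or α β) (.dep q))).enc := by
    rw [← hs, filter_idxOf_lt hΦ hj, MTL.enc_bigAnd, List.flatMap_map]
    refine Gives.seq (Gives.forSymbols (c := j + 1) hr' (.inr rfl) (by simpa using hq) ?_ hj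
      fun i hi _ => ?_) (Gives.emits _)
    · have h₁ := Does.copy (x := t.input) (B := t.B) (r := Function.update r .p j) .q .p
      have hlen := hr.len_lt
      have h₂ := Does.inc (x := t.input) (B := t.B)
        (r := Function.update (Function.update r .p j) .q (Function.update r .p j .p)) .q
        (by simp; omega)
      have := h₁.seq h₂
      simpa using this
    · have hr'' := hr'.update (a := .q) (.inr (.inl rfl)) i
      have := hr''.emitSym (a := .q) (.inr rfl) (by simpa using hi)
      rw [Function.update_self] at this
      exact (Gives.emits [.and]).seq
        ((Ctx.hook ((hA _ hr'').or (hB _ hr''))).apply this.dep)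
  have hbody := (Ctx.and ((Ctx.hook (hA _ hr')).apply hv.neg.ml)).apply
    ((Ctx.and ((Ctx.hook (hB _ hr')).apply hv.ml)).apply key)
  have := ((Gives.emits (t := t) (r := Function.update r .p j) [Sym.tilde]).seq
    (((Gives.emits [Sym.and]).seq ((Gives.emits [Sym.tilde]).seq hbody)).seq
      (Gives.emits [Sym.tilde])))
  simpa [outOvee, outAnd, outTilde] using this

def outZetaStar (S A B : Mach Reg Unit) : Mach Reg Unit :=
  outExOne S ⨟ outAnd (outExOne B ⨟ outChi S B) ⨟ outAnd (outTilde ⨟ outExOne A ⨟ outChi S A) ⨟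
    outOr (outAnd (outChiStar A B ⨟ outChi A B) ⨟ outMl (outDisj A B)) ⨟
    outAllOne (outDisj A B) ⨟ outTilde

theorem Ctx.zetaStarOf {S : Mach Reg Unit} {σ : ML} (hS : Outputs t l l' S σ)
    (hA : Outputs t l l' A α) (hB : Outputs t l l' B β) (hr : Ready t l l' r) (hp : r .p = 0)
    (hcnt : r .cnt = 0) :
    Ctx t (outZetaStar S A B) r fun z => MTLOrder.zetaStarOf t.Φ l' σ z α β := by
  have hA' := hA r hr
  have hB' := hB r hr
  exact (Ctx.exOne (hS r hr)).comp ((Ctx.and ((Ctx.exOne hB').apply (.chi hS hB hr hp hcnt))).comp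
    ((Ctx.and (Ctx.tilde.apply ((Ctx.exOne hA').apply (.chi hS hA hr hp hcnt)))).comp
      ((Ctx.or ((Ctx.and ((Ctx.chiStarOf hA' hB').apply (.chi hA hB hr hp hcnt))).apply
        (hA'.or hB').ml)).comp ((Ctx.allOne (hA'.or hB')).comp Ctx.tilde))))

end Formulas

/-! ### The construction of the order formulas -/

section While

variable {ι : Type} {x : List Sym} {B : ℕ} {r r' r'' : ι → ℕ} {w w' : List Sym}

/-- Repeats `P` until `a = z`. -/
def Mach.whileNe (a z : ι) (P : Mach ι Unit) : Mach ι Unit :=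
  .loop (.ifEq a z (.exit false) (P ⨟ .exit true))

theorem Does.whileNe_done {a z : ι} {P : Mach ι Unit} (h : r a = r z) :
    Does (Mach.whileNe a z P) x B r [] r :=
  fun i => ⟨i, .loop_false (.ifEq (fun _ => .exit false) fun hn => absurd h hn)⟩

theorem Does.whileNe_step {a z : ι} {P : Mach ι Unit} (h : r a ≠ r z) (hP : Does P x B r w r')
    (h' : Does (Mach.whileNe a z P) x B r' w' r'') :
    Does (Mach.whileNe a z P) x B r (w ++ w') r'' := by
  intro i
  obtain ⟨i₁, h₁⟩ := hP i
  obtain ⟨i₂, h₂⟩ := h' i₁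
  have h₃ := h₁.seq (Exec.exit true)
  rw [List.append_nil] at h₃
  exact ⟨i₂, .loop_true (.ifEq (fun he => absurd he h) fun _ => h₃) h₂⟩

end While

/-- The first argument of `ζ_m` in the unfolding of the formula at the top level. -/
def Task.leftAt (t : Task) (m : ℕ) : ML := if m = t.top then t.α else stairVar m

/-- The second argument of `ζ_j` in the unfolding of the formula at the top level. -/
def Task.rightAt (t : Task) (j : ℕ) : ML :=
  (List.range' (j + 1) (t.top - j)).foldr (fun m b => .or (t.leftAt m) b) t.β

section Order

variable {t : Task} {r : Reg → ℕ} {l l' : ℕ}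

theorem Task.leftAt_top : t.leftAt t.top = t.α := if_pos rfl

theorem Task.rightAt_top : t.rightAt t.top = t.β := by simp [Task.rightAt]

theorem Task.leftAt_of_lt (h : l < t.top) : t.leftAt l = stairVar l := if_neg h.ne

theorem Task.rightAt_of_lt (h : l < t.top) :
    t.rightAt l = .or (t.leftAt (l + 1)) (t.rightAt (l + 1)) := by
  have : t.top - l = t.top - (l + 1) + 1 := by omega
  rw [Task.rightAt, this, List.range'_succ]
  rfl

def outLeft (c : Reg) : Mach Reg Unit := .ifEq c .top emitLeft (emitStair c)

theorem Gives.leftAt {c : Reg} (hz : r .zero = 0) (htmp : r .tmp = 0) (htop : r .top = t.top) :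
    Gives t (outLeft c) r (t.leftAt (r c)).enc := by
  refine Does.ifEq (fun h => ?_) fun h => ?_
  · rw [h, htop, Task.leftAt_top]
    exact Gives.emitLeft
  · rw [Task.leftAt, if_neg (htop ▸ h)]
    exact Gives.emitStair c hz htmp

def outRight : Mach Reg Unit :=
  .forFrom .zero (.copy .m .lvl ⨟ .inc .m) .m .top1 (.emits [.or] ⨟ outLeft .m) ⨟ emitRight

theorem outputs_leftAt : Outputs t l l' (outLeft .lvl) (t.leftAt l) := by
  intro r hr
  rw [← hr.lvl]
  exact .leftAt hr.zero hr.tmp hr.top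

theorem outputs_stair : Outputs t l l' (emitStair .low) (stairVar l') := by
  intro r hr
  rw [← hr.low]
  exact .emitStair _ hr.zero hr.tmp

theorem enc_foldr_or (F : ℕ → ML) (β : ML) (L : List ℕ) :
    (L.foldr (fun m b => ML.or (F m) b) β).enc =
      L.flatMap (fun m => Sym.or :: (F m).enc) ++ β.enc := by
  induction L with
  | nil => rfl
  | cons m L ih => simp [ML.enc, ih]

theorem outputs_rightAt : Outputs t l l' outRight (t.rightAt l) := by
  intro r hr
  have htop := hr.top_lt
  have hle := hr.lvl_le
  rw [Task.rightAt, enc_foldr_or]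
  refine Gives.seq (Does.forFrom hr.zero (by decide) hr.m (by decide) _ (l + 1) (t.top - l) ?_
    (by rw [hr.top1]; omega) (by rw [hr.top1]; exact htop) fun j _ _ => ?_) .emitRight
  · have h₁ := Does.copy (x := t.input) (B := t.B) (r := r) .m .lvl
    have h₂ := Does.inc (x := t.input) (B := t.B) (r := Function.update r .m (r .lvl)) .m
      (by simp [hr.lvl]; omega)
    have := h₁.seq h₂
    simpa [hr.lvl] using this
  · have := Gives.leftAt (t := t) (r := Function.update r .m j) (c := .m) (by simpa using hr.zero)
      (by simpa using hr.tmp) (by simpa using hr.top)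
    rw [Function.update_self] at this
    exact (Gives.emits [.or]).seq this

/-- Outputs `ζ*` at the level `low` up to the recursive occurrence of `ζ`. -/
def outStar : Mach Reg Unit := outZetaStar (emitStair .low) (outLeft .lvl) outRight

/-- Outputs `ζ_0` at the current level. -/
def outZero : Mach Reg Unit := outZetaZero (outLeft .lvl) outRight

/-- Sets `low` to the level below. -/
def lower : Mach Reg Unit := .copy .low .lvl ⨟ .dec .low

def outLevel : Mach Reg Unit :=
  lower ⨟ (outOvee outZero ⨟ outAnd (outChiZero (outLeft .lvl) outRight) ⨟ outBox ⨟ outStar) ⨟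
    .copy .lvl .low

def outLevels : Mach Reg Unit := .whileNe .lvl .zero outLevel

theorem Ready.lower (hr : Ready t (l + 1) l' r) :
    Does lower t.input t.B r [] (Function.update r .low l) ∧
      Ready t (l + 1) l (Function.update r .low l) := by
  constructor
  · have h₁ := Does.copy (x := t.input) (B := t.B) (r := r) .low .lvl
    have h₂ := Does.dec (x := t.input) (B := t.B) (r := Function.update r .low (r .lvl)) .low
      (by simp [hr.lvl])
    have := h₁.seq h₂
    simp only [hr.lvl, Function.update_self, Function.update_idem, Nat.add_sub_cancel] at this
    exact this
  · obtain ⟨h₁, h₂, h₃, h₄, h₅, -, h₇, h₈, h₉, h₁₀, h₁₁, h₁₂, h₁₃⟩ := hr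
    constructor <;> (try simp) <;> omega

theorem Ready.descend (hr : Ready t (l + 1) l r) :
    Does (.copy .lvl .low) t.input t.B r [] (Function.update r .lvl l) ∧
      Ready t l l (Function.update r .lvl l) := by
  constructor
  · have := Does.copy (x := t.input) (B := t.B) (r := r) .lvl .low
    rwa [hr.low] at this
  · obtain ⟨h₁, h₂, h₃, h₄, -, h₆, h₇, h₈, h₉, h₁₀, h₁₁, h₁₂, h₁₃⟩ := hr
    constructor <;> (try simp) <;> omega

/-- The word `w` collects the prefixes of all levels down to 1. The final ζ_0 is kept separate since
`outZero` follows the loop in the program. -/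
theorem Does.outLevels (hΦ : t.Φ.Nodup) (hr : Ready t l l' r) (hp : r .p = 0) (hq : r .q = 0)
    (hcnt : r .cnt = 0) : ∃ w r', Does outLevels t.input t.B r w r' ∧ Gives t outZero r'
      (zetaZero t.Φ (t.leftAt 0) (t.rightAt 0)).enc ∧
      w ++ (zetaZero t.Φ (t.leftAt 0) (t.rightAt 0)).enc =
        (zeta t.Φ stairVar l (t.leftAt l) (t.rightAt l)).enc := by
  induction l generalizing l' r with
  | zero =>
    refine ⟨[], r, .whileNe_done (by rw [hr.lvl, hr.zero]), ?_, rfl⟩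
    exact .zetaZero hΦ outputs_leftAt outputs_rightAt hr hp hq
  | succ l ih =>
    obtain ⟨h₁, hr₁⟩ := hr.lower
    have hp₁ : Function.update r .low l .p = 0 := by simpa using hp
    have hq₁ : Function.update r .low l .q = 0 := by simpa using hq
    have hcnt₁ : Function.update r .low l .cnt = 0 := by simpa using hcnt
    obtain ⟨w, h₂, he⟩ := (Ctx.ovee (Gives.zetaZero hΦ outputs_leftAt outputs_rightAt hr₁ hp₁ hq₁)).comp
      ((Ctx.and (Gives.chiZero outputs_leftAt outputs_rightAt hr₁ hp₁)).comp
        (Ctx.box.comp (Ctx.zetaStarOf outputs_stair outputs_leftAt outputs_rightAt hr₁ hp₁ hcnt₁)))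
    obtain ⟨h₃, hr₃⟩ := hr₁.descend
    obtain ⟨w', r', h₄, h₅, he'⟩ := ih hr₃ (by simpa using hp) (by simpa using hq)
      (by simpa using hcnt)
    have hstep := h₁.seq ((Does.seq h₂ h₃))
    rw [List.append_nil, List.nil_append] at hstep
    refine ⟨w ++ w', r', .whileNe_step (by rw [hr.lvl, hr.zero]; omega) hstep h₄, h₅, ?_⟩
    -- Below the top, the arguments are a stair and the disjunction of the two arguments one level
    -- up, exactly as in the recursive call.
    have hlt : l < t.top := hr.lvl_le
    rw [List.append_assoc, he', Task.leftAt_of_lt hlt, Task.rightAt_of_lt hlt, ← he]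
    rfl

/-- Initializes the registers for the top level `k` or `k + 1`. -/
def setup (star : Bool) : Mach Reg Unit :=
  .forward ⨟ countField (fun a => decide (a = .one)) .top ⨟
    (if star then .inc .top else .exit ()) ⨟ .copy .top1 .top ⨟ .inc .top1 ⨟
    .copy .lvl .top ⨟ .forward ⨟ countField Sym.isKind .len

/-- The registers after the initialization. -/
def initial (t : Task) : Reg → ℕ
  | .len => t.Φ.length
  | .top | .lvl => t.top
  | .top1 => t.top + 1
  | _ => 0

theorem countP_flatMap_enc (Φ : List PSym) : (Φ.flatMap PSym.enc).countP Sym.isKind = Φ.length := by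
  induction Φ with
  | nil => rfl
  | cons p Φ ih =>
    rw [List.flatMap_cons, List.countP_append, ih, p.countP_enc, List.length_cons, add_comm]

theorem Exec.setup {star : Bool} (htop : t.top = t.k + star.toNat) (hlen : t.Φ.length < 2 ^ t.B)
    (ht : t.top + 1 < 2 ^ t.B) :
    ∃ i', Exec (setup star) t.input t.B 0 (fun _ => 0) () [] i' (initial t) := by
  have hcount : (List.replicate t.k Sym.one).countP (fun a => decide (a = .one)) = t.k := by
    simp [List.countP_replicate]
  have h₁ := Exec.forward (ι := Reg) (x := t.input) (B := t.B) (r := fun _ => 0) (i := 0)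
    (Nat.zero_le _)
  have h₂ := Exec.countField (x := t.input) (B := t.B) (r := fun _ => 0) (u := [])
    (p := fun a => decide (a = .one)) (a := .top)
    (v := List.replicate t.k .one) rfl (by simp [Sym.notSep]) (by rw [hcount]; omega)
  rw [hcount, zero_add] at h₂
  set i := ([] ++ List.replicate t.k Sym.one).length + 1
  set r₂ : Reg → ℕ := Function.update (fun _ => 0) .top t.k with hr₂
  have h₃ : Exec (if star then Mach.inc Reg.top else Mach.exit ()) t.input t.B i r₂ () [] i
      (Function.update r₂ .top t.top) := by
    cases star
    · have : Function.update r₂ .top t.top = r₂ := by rw [htop, hr₂, Function.update_idem]; rfl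
      rw [this]
      exact Exec.exit ()
    · have := Exec.inc (x := t.input) (B := t.B) (i := i) (r := r₂) .top (by simp [hr₂]; omega)
      simp only [hr₂, Function.update_self] at this
      rw [htop]
      exact this
  set r₃ := Function.update r₂ .top t.top with hr₃
  have h₄ := Exec.copy (x := t.input) (B := t.B) (i := i) (r := r₃) .top1 .top
  set r₄ := Function.update r₃ .top1 (r₃ .top) with hr₄
  have h₅ := Exec.inc (x := t.input) (B := t.B) (i := i) (r := r₄) .top1 (by simpa [hr₄, hr₃] using ht)
  set r₅ := Function.update r₄ .top1 (r₄ .top1 + 1) with hr₅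
  have h₆ := Exec.copy (x := t.input) (B := t.B) (i := i) (r := r₅) .lvl .top
  set r₆ := Function.update r₅ .lvl (r₅ .top) with hr₆
  have h₇ := Exec.forward (ι := Reg) (x := t.input) (B := t.B) (r := r₆) (i := i)
    (by simp [i, Task.input, encInput])
  have h₈ := Exec.countField (x := t.input) (B := t.B) (r := r₆) (p := Sym.isKind) (a := .len)
    (u := [] ++ (List.replicate t.k Sym.one ++ [Sym.sep])) (v := t.Φ.flatMap PSym.enc)
    (v' := t.α.enc ++ Sym.sep :: t.β.enc)
    (by simp [Task.input, encInput]) (notSep_flatMap_enc _)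
    (by rw [countP_flatMap_enc]; simpa [hr₆, hr₅, hr₄, hr₃, hr₂] using hlen)
  have hpos : ([] ++ (List.replicate t.k Sym.one ++ [Sym.sep])).length + 1 = i + 1 := by simp [i]
  rw [hpos] at h₈
  have hfin : Function.update r₆ .len (r₆ .len + (t.Φ.flatMap PSym.enc).countP Sym.isKind) =
      initial t := by
    funext a
    rw [countP_flatMap_enc]
    cases a <;> simp [hr₆, hr₅, hr₄, hr₃, hr₂, initial]
  rw [hfin] at h₈
  exact ⟨_, h₁.seq (h₂.seq (h₃.seq (h₄.seq (h₅.seq (h₆.seq (h₇.seq h₈))))))⟩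

theorem ready_initial (hlen : t.Φ.length < 2 ^ t.B) (ht : t.top + 1 < 2 ^ t.B) :
    Ready t t.top 0 (initial t) := by
  constructor <;> first | rfl | assumption | omega

def zetaMach : Mach Reg Unit := setup false ⨟ outLevels ⨟ outZero

/-- ζ*_k is the part of ζ_{k+1} under the box. So α and β are placed at the top level k+1, only the
prefix of the starred formula is printed there, and the usual loop continues from level k. -/
def zetaStarMach : Mach Reg Unit :=
  setup true ⨟ (lower ⨟ outStar ⨟ .copy .lvl .low) ⨟ outLevels ⨟ outZero

theorem Exec.zetaMach (hΦ : t.Φ.Nodup) (htop : t.top = t.k) (hlen : t.Φ.length < 2 ^ t.B)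
    (ht : t.top + 1 < 2 ^ t.B) : ∃ i' r', Exec zetaMach t.input t.B 0 (fun _ => 0) ()
      (zeta t.Φ stairVar t.k t.α t.β).enc i' r' := by
  obtain ⟨i₁, h₁⟩ := Exec.setup (star := false) htop hlen ht
  obtain ⟨w, r', h₂, h₃, he⟩ := Does.outLevels hΦ (ready_initial hlen ht) rfl rfl rfl
  rw [Task.leftAt_top, Task.rightAt_top] at he
  obtain ⟨i', h⟩ := h₂.seq h₃ i₁
  rw [he, htop] at h
  exact ⟨i', r', h₁.seq h⟩

theorem Exec.zetaStarMach (hΦ : t.Φ.Nodup) (htop : t.top = t.k + 1) (hlen : t.Φ.length < 2 ^ t.B)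
    (ht : t.top + 1 < 2 ^ t.B) : ∃ i' r', Exec zetaStarMach t.input t.B 0 (fun _ => 0) ()
      (zetaStar t.Φ stairVar t.k t.α t.β).enc i' r' := by
  obtain ⟨i₁, h₁⟩ := Exec.setup (star := true) htop hlen ht
  have hr := ready_initial hlen ht
  rw [htop] at hr
  obtain ⟨h₂, hr₂⟩ := hr.lower
  obtain ⟨w, h₃, he⟩ := Ctx.zetaStarOf outputs_stair outputs_leftAt outputs_rightAt hr₂ rfl rfl
  obtain ⟨h₄, hr₄⟩ := hr₂.descend
  obtain ⟨w', r', h₅, h₆, he'⟩ := Does.outLevels hΦ hr₄ rfl rfl rfl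
  have hlt : t.k < t.top := by omega
  obtain ⟨i', h⟩ := (h₂.seq (Does.seq h₃ h₄)).seq (h₅.seq h₆) i₁
  rw [he', List.nil_append, List.append_nil, ← he, Task.leftAt_of_lt hlt, Task.rightAt_of_lt hlt,
    ← htop, Task.leftAt_top, Task.rightAt_top] at h
  exact ⟨i', r', h₁.seq h⟩

end Order

/-! ### Space bounds -/

theorem ML.enc_length_pos (α : ML) : 0 < α.enc.length := by
  cases α with
  | var p => obtain ⟨a, l, he, -⟩ := p.enc_eq; simp [ML.enc, he]
  | _ => simp [ML.enc]

theorem Transducer.ComputesInSpace.mono {A : Type} {M : Transducer A} {x y : List A} {m n : ℕ}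
    (h : M.ComputesInSpace x y m) (hmn : m ≤ n) : M.ComputesInSpace x y n :=
  ⟨h.1, h.2.imp fun _ hb => ⟨hb.1.trans hmn, hb.2⟩⟩

theorem LogspaceConstructible.of_mach {F : ℕ → List PSym → ML → ML → MTL} (M : Mach Reg Unit)
    (h : ∀ (k : ℕ) (Φ : List PSym) (α β : ML) (B : ℕ), Φ.Nodup → Φ.length < 2 ^ B →
      k + 2 < 2 ^ B → ∃ i' r', Exec M (encInput k Φ α β) B 0 (fun _ => 0) () (F k Φ α β).enc i' r') :
    LogspaceConstructible F := by
  -- With bit width B = log n + 1 the space is B + 2 = log n + 3, and this is at most 5 log n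
  -- because the nonempty encodings of α and β give n ≥ 2. They also give k + 2 ≤ n < 2^B.
  refine ⟨((Mach.mark Reg).bind fun _ => M).toTransducer, 5, fun k Φ α β hΦ => ?_⟩
  have hα := α.enc_length_pos
  have hβ := β.enc_length_pos
  set n := k + Φ.length + α.enc.length + β.enc.length with hn
  have hlt : n < 2 ^ (Nat.log 2 n + 1) := Nat.lt_pow_succ_log_self one_lt_two n
  have hlog : 1 ≤ Nat.log 2 n := Nat.log_pos one_lt_two (by omega)
  obtain ⟨i', r', hrun⟩ := h k Φ α β (Nat.log 2 n + 1) hΦ (by omega) (by omega)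
  exact hrun.computesInSpace.mono (by omega)

theorem zeta_logspaceConstructible :
    LogspaceConstructible fun k Φ α β => zeta Φ stairVar k α β :=
  .of_mach zetaMach fun k Φ α β B hΦ hlen hk =>
    Exec.zetaMach (t := ⟨k, Φ, α, β, k, B⟩) hΦ rfl hlen (show k + 1 < 2 ^ B by omega)

theorem zetaStar_logspaceConstructible :
    LogspaceConstructible fun k Φ α β => zetaStar Φ stairVar k α β :=
  .of_mach zetaStarMach fun k Φ α β B hΦ hlen hk =>
    Exec.zetaStarMach (t := ⟨k, Φ, α, β, k + 1, B⟩) hΦ rfl hlen hk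

end MTLOrder

/-! ### The main theorem -/

theorem mainTheorem7 :
    (∀ (W : Type u) (K : MTLOrder.Kripke W) (Φ : List MTLOrder.PSym) (k : ℕ)
      (s : ℕ → MTLOrder.ML) (α β : MTLOrder.ML) (T : Set W),
      Φ.Nodup →
      MTLOrder.DisjointScopes K (MTLOrder.symSet Φ) k s α β →
      MTLOrder.IsStaircase K (MTLOrder.symSet Φ) s k T →
      (∀ w ∈ K.cond T α, ∀ v ∈ K.cond T β,
        (MTLOrder.MTL.Sat K (K.sel (K.sel T α {w}) β {v}) (MTLOrder.zeta Φ s k α β) ↔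
          MTLOrder.TypeLT.{u} Φ k
            (MTLOrder.typeOf K (MTLOrder.symSet Φ) k w)
            (MTLOrder.typeOf K (MTLOrder.symSet Φ) k v))) ∧
      (MTLOrder.MTL.Sat K T (MTLOrder.zetaStar Φ s k α β) ↔
        MTLOrder.TypeSetLT.{u} Φ k
          (MTLOrder.typesOf K (MTLOrder.symSet Φ) k (K.cond T α))
          (MTLOrder.typesOf K (MTLOrder.symSet Φ) k (K.cond T β)))) ∧
    (∀ (Φ : List MTLOrder.PSym) (k : ℕ) (s : ℕ → MTLOrder.ML) (α β : MTLOrder.ML),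
      α.md = 0 → β.md = 0 → (∀ i ≤ k, (s i).md = 0) →
      MTLOrder.zeta Φ s k α β ∈ MTLOrder.MTLfrag k ∧
      MTLOrder.zetaStar Φ s k α β ∈ MTLOrder.MTLfrag k) ∧
    MTLOrder.LogspaceConstructible
      (fun k Φ α β => MTLOrder.zeta Φ MTLOrder.stairVar k α β) ∧
    MTLOrder.LogspaceConstructible
      (fun k Φ α β => MTLOrder.zetaStar Φ MTLOrder.stairVar k α β) := by
  refine ⟨fun W K Φ k s α β T _ hd hT => ⟨fun w hw v hv => ?_, ?_⟩,
    fun Φ k s α β hα hβ hs => ⟨?_, ?_⟩, ?_, ?_⟩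
  · exact MTLOrder.MTL.sat_zeta_sel hd hT hw hv
  · exact MTLOrder.MTL.sat_zetaStar hd hT
  · exact (MTLOrder.md_zeta hs hα hβ).le
  · exact (MTLOrder.md_zetaStar hs hα hβ).le
  · exact MTLOrder.zeta_logspaceConstructible
  · exact MTLOrder.zetaStar_logspaceConstructible
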